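/- Conventions. All multicategories are non-symmetric. A multitensor $(E,u,\sigma)$ on a category $V$ consists of functors $E_n:V^n\to V$ ($n\ge 0$), natural maps $u_X:X\to E_1(X)$ and natural maps $\sigma:E_k(E_{n_1}(X_{11},\dots,X_{1n_1}),\dots,E_{n_k}(X_{k1},\dots,X_{kn_k}))\to E_{n_1+\dots+n_k}(X_{11},\dots,X_{kn_k})$ satisfying the unit and associativity axioms; its unary part $E_1$ is a monad on $V$. It is a functor operad if $u$ is invertible (so $E_1$ is isomorphic to the identity monad), a monoidal structure if $u$ and $\sigma$ are invertible, distributive (resp. cocomplete) if each $E_n$ preserves small coproducts (resp. small colimits) in each variable. An $E$-category is a $V$-graph $X$ (a set of objects with homs $X(a,b)\in V$) with composition maps $E_n(X(x_0,x_1),\dots,X(x_{n-1},x_n))\to X(x_0,x_n)$ satisfying the unit and associativity axioms; each hom is then an $E_1$-algebra, so there is a forgetful functor from $E$-categories to the category $\mathcal G(V^{E_1})$ of $V^{E_1}$-graphs. A lift of $E$ is a distributive functor operad $E'$ on $V^{E_1}$ such that the category of $E'$-categories is isomorphic, over $\mathcal G(V^{E_1})$, to the category of $E$-categories. Proposition.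 Let $\mathbb C$ be a small multicategory with set of objects $\mathbb C_0$ and category of linear (i.e. one-input) maps $\mathbb C_l$. Let $E$ be the multitensor on $[\mathbb C_0,\mathbf{Set}]$ given by $$E(X_1,\dots,X_n)(C)=\coprod_{C_1,\dots,C_n}\mathbb C(C_1,\dots,C_n;C)\times\prod_i X_i(C_i)$$ and $F$ the standard convolution on $[\mathbb C_l,\mathbf{Set}]$ given by $$F(X_1,\dots,X_n)=\int^{C_1,\dots,C_n}\mathbb C(C_1,\dots,C_n;-)\times\prod_i X_i(C_i),$$ with units and substitutions induced by those of $\mathbb C$. Then $E$ is cocomplete, $F$ is a cocomplete functor operad, and the canonical functor $[\mathbb C_l,\mathbf{Set}]\to[\mathbb C_0,\mathbf{Set}]^{E_1}$ is an equivalence. A lift $E'$ of $E$ exists, and for every lift $E'$ of $E$ there is an isomorphism $F\cong E'$ of multitensors along this equivalence. In particular, if $\mathbb C$ is promonoidal, meaning that all functions $$\int^{B_1,\dots,B_k}\mathbb C(B_1,\dots,B_k;C)\times\prod_i\mathbb C(A_{i1},\dots,A_{in_i};B_i)\to\mathbb C(A_{11},\dots,A_{kn_k};C)$$ induced by substitution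 are bijective, then $F$ is a monoidal structure (unenriched Day convolution), and it arises as the lift of $E$. -/

import Mathlib

open CategoryTheory

universe w v v' u u'

/-- `IsConcat X Y`: the finite sequence `Y` is the concatenation of the doubly nested sequence `X`. -/
def IsConcat {α : Type w} {k : ℕ} {n : Fin k → ℕ} {N : ℕ}
    (X : ∀ i : Fin k, Fin (n i) → α) (Y : Fin N → α) : Prop :=
  List.ofFn Y = (List.ofFn fun i => List.ofFn (X i)).flatten

namespace IsConcat

theorem map {α : Type w} {β : Type v} (f : α → β) {k : ℕ} {n : Fin k → ℕ} {N : ℕ}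
    {X : ∀ i : Fin k, Fin (n i) → α} {Y : Fin N → α} (h : IsConcat X Y) :
    IsConcat (fun i j => f (X i j)) (fun a => f (Y a)) := by
  have h2 := congrArg (List.map f) h
  unfold IsConcat
  simpa [List.map_flatten, List.map_ofFn, Function.comp_def] using h2

theorem unique {α : Type w} {k : ℕ} {n : Fin k → ℕ} {N : ℕ}
    {X : ∀ i : Fin k, Fin (n i) → α} {Y Y' : Fin N → α} (h : IsConcat X Y) (h' : IsConcat X Y') : Y = Y' :=
  List.ofFn_injective (Eq.trans h (Eq.symm h'))

theorem single {α : Type w} {n : ℕ} (X : Fin n → α) : IsConcat (fun _ : Fin 1 => X) X := by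
  simp [IsConcat]

theorem singles {α : Type w} {n : ℕ} (X : Fin n → α) : IsConcat (fun i (_ : Fin 1) => X i) X := by
  unfold IsConcat
  have : (List.ofFn fun i => List.ofFn (fun _ : Fin 1 => X i)) = (List.ofFn X).map fun x => [x] := by
    simp [List.map_ofFn, Function.comp_def]
  rw [this]
  induction List.ofFn X with
  | nil => rfl
  | cons a l ih => simpa using ih

/-- Concatenation of triply nested sequences is associative. -/
theorem assoc {α : Type w} {k : ℕ} {n : Fin k → ℕ} {p : ∀ i, Fin (n i) → ℕ} {P : Fin k → ℕ}
    {M N : ℕ} {q : Fin M → ℕ}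
    {X : ∀ i j, Fin (p i j) → α} {Y : ∀ i, Fin (P i) → α} {Z : ∀ a, Fin (q a) → α} {W : Fin N → α}
    (hXZ : IsConcat (fun i j => (⟨p i j, X i j⟩ : Σ m, Fin m → α)) (fun a => ⟨q a, Z a⟩))
    (hXY : ∀ i, IsConcat (X i) (Y i)) (hYW : IsConcat Y W) : IsConcat Z W := by
  have h1 := hXZ.map (fun s => List.ofFn s.2)
  unfold IsConcat at *
  rw [hYW, h1, List.flatten_flatten, List.map_ofFn]
  congr 2
  funext i
  exact hXY i

/-- The position, in the doubly nested sequence, of an entry of the concatenation. -/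
theorem exists_pos {α : Type w} {k : ℕ} {n : Fin k → ℕ} {N : ℕ}
    {X : ∀ i : Fin k, Fin (n i) → α} {Y : Fin N → α} (h : IsConcat X Y) :
    ∃ pos : Fin N → Σ i, Fin (n i),
      IsConcat (fun i j => (⟨i, j⟩ : Σ i, Fin (n i))) pos ∧ ∀ a, X (pos a).1 (pos a).2 = Y a := by
  let L : List (Σ i, Fin (n i)) := (List.ofFn fun i => List.ofFn fun j => ⟨i, j⟩).flatten
  have hL : L.map (fun s => X s.1 s.2) = List.ofFn Y := by
    rw [h]
    simp [L, List.map_flatten, List.map_ofFn, Function.comp_def]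
  have hlen : L.length = N := by
    have := congrArg List.length hL
    simpa using this
  subst hlen
  have hc : IsConcat (fun i j => (⟨i, j⟩ : Σ i, Fin (n i))) L.get := by
    show List.ofFn L.get = L
    exact List.ofFn_get L
  refine ⟨L.get, hc, fun a => ?_⟩
  exact congrFun ((hc.map fun s => X s.1 s.2).unique h) a

/-- Concatenation of a doubly nested sequence of elements `v i j : B (X i j)`. -/
noncomputable def glue {α : Type w} (B : α → Type v) {k : ℕ} {n : Fin k → ℕ} {N : ℕ}
    {X : ∀ i : Fin k, Fin (n i) → α} {Y : Fin N → α} (h : IsConcat X Y)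
    (x : ∀ i j, B (X i j)) (a : Fin N) : B (Y a) :=
  h.exists_pos.choose_spec.2 a ▸
    x (h.exists_pos.choose a).1 (h.exists_pos.choose a).2

theorem con_glue {α : Type w} (B : α → Type v) {k : ℕ} {n : Fin k → ℕ} {N : ℕ}
    {X : ∀ i : Fin k, Fin (n i) → α} {Y : Fin N → α} (h : IsConcat X Y) (x : ∀ i j, B (X i j)) :
    IsConcat (fun i j => (⟨X i j, x i j⟩ : Σ a, B a)) (fun a => ⟨Y a, h.glue B x a⟩) := by
  have h1 := h.exists_pos.choose_spec.1.map
    (fun s => (⟨X s.1 s.2, x s.1 s.2⟩ : Σ a, B a))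
  convert h1 using 2 with a
  have key : ∀ (y : α) (e : X (h.exists_pos.choose a).1 (h.exists_pos.choose a).2 = y),
      (⟨y, e ▸ x (h.exists_pos.choose a).1 (h.exists_pos.choose a).2⟩ : Σ a, B a) =
        ⟨X (h.exists_pos.choose a).1 (h.exists_pos.choose a).2,
          x (h.exists_pos.choose a).1 (h.exists_pos.choose a).2⟩ := by
    intro y e; subst e; rfl
  exact key _ _

theorem eq_glue {α : Type w} (B : α → Type v) {k : ℕ} {n : Fin k → ℕ} {N : ℕ}
    {X : ∀ i : Fin k, Fin (n i) → α} {Y : Fin N → α} (h : IsConcat X Y) (x : ∀ i j, B (X i j))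
    (y : ∀ a, B (Y a))
    (hy : IsConcat (fun i j => (⟨X i j, x i j⟩ : Σ a, B a)) (fun a => ⟨Y a, y a⟩)) :
    y = h.glue B x := by
  have h1 := hy.unique (h.con_glue B x)
  funext a
  have h2 := congrFun h1 a
  simpa using h2

end IsConcat

/-- A (non-symmetric) multicategory: multimaps `(A_1, ..., A_n) → c`, identities and substitution. -/
structure Multicategory where
  /-- objects -/
  Ob : Type u
  /-- multimaps -/
  Hom : ∀ {n : ℕ}, (Fin n → Ob) → Ob → Type u
  /-- identity linear maps -/
  id : ∀ a : Ob, Hom (fun _ : Fin 1 => a) a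
  /-- substitution, where `L` is the concatenation of the sequences `A i` -/
  comp : ∀ {k : ℕ} {n : Fin k → ℕ} {N : ℕ} {A : ∀ i, Fin (n i) → Ob} {L : Fin N → Ob}
    {B : Fin k → Ob} {c : Ob}, IsConcat A L → Hom B c → (∀ i, Hom (A i) (B i)) → Hom L c
  id_comp : ∀ {n : ℕ} {A : Fin n → Ob} {c : Ob} (f : Hom A c),
    comp (IsConcat.single A) (id c) (fun _ => f) = f
  comp_id : ∀ {n : ℕ} {A : Fin n → Ob} {c : Ob} (f : Hom A c),
    comp (IsConcat.singles A) f (fun i => id (A i)) = f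
  /-- `h'` is the concatenation of the doubly nested sequence of multimaps `h` -/
  assoc : ∀ {k : ℕ} {n : Fin k → ℕ} {p : ∀ i, Fin (n i) → ℕ} {P : Fin k → ℕ} {M N : ℕ}
    {q : Fin M → ℕ} {A : ∀ i j, Fin (p i j) → Ob} {A' : ∀ i, Fin (P i) → Ob}
    {A'' : ∀ a, Fin (q a) → Ob} {L : Fin N → Ob} {B : ∀ i, Fin (n i) → Ob} {B' : Fin M → Ob}
    {D : Fin k → Ob} {e : Ob} (f : Hom D e) (g : ∀ i, Hom (B i) (D i))
    (h : ∀ i j, Hom (A i j) (B i j)) (h' : ∀ a, Hom (A'' a) (B' a))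
    (_ : IsConcat (fun i j => (⟨B i j, ⟨p i j, A i j⟩, h i j⟩ :
        Σ (b : Ob) (l : Σ m, Fin m → Ob), Hom l.2 b))
      (fun a => ⟨B' a, ⟨q a, A'' a⟩, h' a⟩))
    (hA : ∀ i, IsConcat (A i) (A' i)) (hA' : IsConcat A' L) (hA'' : IsConcat A'' L) (hB : IsConcat B B'),
    comp hA' f (fun i => comp (hA i) (g i) (h i)) = comp hA'' (comp hB f g) h'

/-- A multitensor (lax monoidal structure) on `V`. -/
structure Multitensor (V : Type u) [Category.{v} V] where
  /-- the `n`-ary tensor product -/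
  T : ∀ n : ℕ, (Fin n → V) ⥤ V
  /-- the unit -/
  u : ∀ X : V, X ⟶ (T 1).obj (fun _ => X)
  /-- the substitution, where `Y` is the concatenation of the sequences `X i` -/
  σ : ∀ {k : ℕ} {n : Fin k → ℕ} {N : ℕ} (X : ∀ i, Fin (n i) → V) (Y : Fin N → V), IsConcat X Y →
    ((T k).obj (fun i => (T (n i)).obj (X i)) ⟶ (T N).obj Y)
  u_naturality : ∀ {X Y : V} (f : X ⟶ Y), f ≫ u Y = u X ≫ (T 1).map (fun _ => f)
  σ_naturality : ∀ {k : ℕ} {n : Fin k → ℕ} {N : ℕ} {X X' : ∀ i, Fin (n i) → V} {Y Y' : Fin N → V}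
    (f : ∀ i j, X i j ⟶ X' i j) (g : ∀ a, Y a ⟶ Y' a)
    (_ : IsConcat (fun i j => Arrow.mk (f i j)) (fun a => Arrow.mk (g a)))
    (h : IsConcat X Y) (h' : IsConcat X' Y'),
    σ X Y h ≫ (T N).map g = (T k).map (fun i => (T (n i)).map (f i)) ≫ σ X' Y' h'
  u_σ : ∀ {n : ℕ} (X : Fin n → V),
    u ((T n).obj X) ≫ σ (fun _ : Fin 1 => X) X (IsConcat.single X) = 𝟙 _
  map_u_σ : ∀ {n : ℕ} (X : Fin n → V),
    (T n).map (fun i => u (X i)) ≫ σ (fun i (_ : Fin 1) => X i) X (IsConcat.singles X) = 𝟙 _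
  /-- `Z` is the concatenation of the doubly nested sequence `X` of sequences -/
  assoc : ∀ {k : ℕ} {n : Fin k → ℕ} {p : ∀ i, Fin (n i) → ℕ} {P : Fin k → ℕ} {M N : ℕ}
    {q : Fin M → ℕ} (X : ∀ i j, Fin (p i j) → V) (Y : ∀ i, Fin (P i) → V)
    (Z : ∀ a, Fin (q a) → V) (W : Fin N → V)
    (_ : IsConcat (fun i j => (⟨p i j, X i j⟩ : Σ m, Fin m → V)) (fun a => ⟨q a, Z a⟩))
    (hT : IsConcat (fun i j => (T (p i j)).obj (X i j)) (fun a => (T (q a)).obj (Z a)))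
    (hXY : ∀ i, IsConcat (X i) (Y i)) (hYW : IsConcat Y W) (hZW : IsConcat Z W),
    σ (fun i j => (T (p i j)).obj (X i j)) (fun a => (T (q a)).obj (Z a)) hT ≫ σ Z W hZW =
      (T k).map (fun i => σ (X i) (Y i) (hXY i)) ≫ σ Y W hYW

namespace IsConcat

theorem glue_map {α : Type w} {B : α → Type v} {B' : α → Type v'} (τ : ∀ a, B a → B' a)
    {k : ℕ} {n : Fin k → ℕ} {N : ℕ}
    {X : ∀ i : Fin k, Fin (n i) → α} {Y : Fin N → α} (h : IsConcat X Y)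
    (x : ∀ i j, B (X i j)) (a : Fin N) :
    h.glue B' (fun i j => τ _ (x i j)) a = τ _ (h.glue B x a) := by
  have := h.eq_glue B' (fun i j => τ _ (x i j)) (fun a => τ _ (h.glue B x a))
    ((h.con_glue B x).map fun s => (⟨s.1, τ s.1 s.2⟩ : Σ a, B' a))
  exact (congrFun this a).symm

theorem glue_comap {α : Type w} {β : Type u} (F : α → β) (B : β → Type v)
    {k : ℕ} {n : Fin k → ℕ} {N : ℕ}
    {X : ∀ i : Fin k, Fin (n i) → α} {Y : Fin N → α} (h : IsConcat X Y)
    (h' : IsConcat (fun i j => F (X i j)) (fun a => F (Y a)))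
    (x : ∀ i j, B (F (X i j))) (a : Fin N) :
    h'.glue B x a = h.glue (fun z => B (F z)) x a := by
  have := h'.eq_glue B x (h.glue (fun z => B (F z)) x)
    ((h.con_glue (fun z => B (F z)) x).map fun s => (⟨F s.1, s.2⟩ : Σ a, B a))
  exact (congrFun this a).symm

end IsConcat

namespace Multicategory

variable (C : Multicategory.{u})

/-- An element of `∐ (C_1, ..., C_n), C(C_1, ..., C_n; c) × ∏ i, X_i(C_i)`. -/
structure Pt {n : ℕ} (X : Fin n → C.Ob → Type u) (c : C.Ob) : Type u where
  /-- the index `(C_1, ..., C_n)` of the summand -/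
  inp : Fin n → C.Ob
  /-- the multimap -/
  op : C.Hom inp c
  /-- the elements of the `X_i(C_i)` -/
  val : ∀ i, X i (inp i)

namespace Pt

variable {C}

/-- The element with prescribed pairs `(C_i, x_i)`. -/
def ofPairs {n : ℕ} {X : Fin n → C.Ob → Type u} {c : C.Ob} (g : ∀ i, Σ d, X i d)
    (f : C.Hom (fun i => (g i).1) c) : C.Pt X c := ⟨fun i => (g i).1, f, fun i => (g i).2⟩

/-- The pairs `(C_i, x_i)` of an element. -/
def pair {n : ℕ} {X : Fin n → C.Ob → Type u} {c : C.Ob} (p : C.Pt X c) (i : Fin n) : Σ d, X i d :=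
  ⟨p.inp i, p.val i⟩

/-- Functoriality in the `X_i`. -/
def map {n : ℕ} {X Y : Fin n → C.Ob → Type u} {c : C.Ob} (f : ∀ i d, X i d → Y i d)
    (p : C.Pt X c) : C.Pt Y c := ⟨p.inp, p.op, fun i => f i _ (p.val i)⟩

/-- Substitution: `(φ, (ψ_i, (x_ij)_j)_i)` is sent to `(φ(ψ_1, ..., ψ_k), con(x_ij))`. -/
noncomputable def subst {k : ℕ} {n : Fin k → ℕ} {N : ℕ}
    {X : ∀ i, Fin (n i) → C.Ob → Type u} {Y : Fin N → C.Ob → Type u} (h : IsConcat X Y)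
    {B : Fin k → C.Ob} {c : C.Ob} (f : C.Hom B c) (r : ∀ i, C.Pt (X i) (B i)) : C.Pt Y c :=
  ofPairs (h.glue (fun Z => Σ d, Z d) fun i j => (r i).pair j)
    (C.comp ((h.con_glue (fun Z => Σ d, Z d) fun i j => (r i).pair j).map fun s => s.2.1)
      f fun i => (r i).op)

theorem ofPairs_comp_eq {k : ℕ} {n : Fin k → ℕ} {N : ℕ}
    {A : ∀ i, Fin (n i) → C.Ob} {Y : Fin N → C.Ob → Type u}
    {B : Fin k → C.Ob} {c : C.Ob} (f : C.Hom B c) (g : ∀ i, C.Hom (A i) (B i))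
    {s t : ∀ a, Σ d, Y a d} (hst : s = t)
    (hs : IsConcat A (fun a => (s a).1)) (ht : IsConcat A (fun a => (t a).1)) :
    ofPairs s (C.comp hs f g) = ofPairs t (C.comp ht f g) := by
  subst hst; rfl

/-- The substitution, computed with any concatenation of the pairs. -/
theorem subst_eq {k : ℕ} {n : Fin k → ℕ} {N : ℕ}
    {X : ∀ i, Fin (n i) → C.Ob → Type u} {Y : Fin N → C.Ob → Type u} (h : IsConcat X Y)
    {B : Fin k → C.Ob} {c : C.Ob} (f : C.Hom B c) (r : ∀ i, C.Pt (X i) (B i))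
    (s : ∀ a, Σ d, Y a d)
    (hs : IsConcat (fun i j => (⟨X i j, (r i).pair j⟩ : Σ Z : C.Ob → Type u, Σ d, Z d))
      (fun a => ⟨Y a, s a⟩)) :
    subst h f r = ofPairs s (C.comp (hs.map fun s => s.2.1) f fun i => (r i).op) :=
  ofPairs_comp_eq f (fun i => (r i).op) (h.eq_glue (fun Z : C.Ob → Type u => Σ d, Z d)
    (fun i j => (r i).pair j) s hs).symm _ (hs.map fun s => s.2.1)

theorem subst_pair {k : ℕ} {n : Fin k → ℕ} {N : ℕ}
    {X : ∀ i, Fin (n i) → C.Ob → Type u} {Y : Fin N → C.Ob → Type u} (h : IsConcat X Y)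
    {B : Fin k → C.Ob} {c : C.Ob} (f : C.Hom B c) (r : ∀ i, C.Pt (X i) (B i)) (a : Fin N) :
    (subst h f r).pair a = h.glue (fun Z => Σ d, Z d) (fun i j => (r i).pair j) a := rfl

theorem con_subst {k : ℕ} {n : Fin k → ℕ} {N : ℕ}
    {X : ∀ i, Fin (n i) → C.Ob → Type u} {Y : Fin N → C.Ob → Type u} (h : IsConcat X Y)
    {B : Fin k → C.Ob} {c : C.Ob} (f : C.Hom B c) (r : ∀ i, C.Pt (X i) (B i)) :
    IsConcat (fun i j => (⟨X i j, (r i).pair j⟩ : Σ Z : C.Ob → Type u, Σ d, Z d))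
      (fun a => ⟨Y a, (subst h f r).pair a⟩) :=
  h.con_glue (fun Z => Σ d, Z d) fun i j => (r i).pair j

theorem subst_single {n : ℕ} {X : Fin n → C.Ob → Type u} {c : C.Ob} (p : C.Pt X c) :
    subst (IsConcat.single X) (C.id c) (fun _ => p) = p := by
  rw [subst_eq (IsConcat.single X) (C.id c) (fun _ => p) p.pair (IsConcat.single _)]
  obtain ⟨i, f, v⟩ := p
  change Pt.mk i (C.comp (IsConcat.single i) (C.id c) fun _ => f) v = _
  rw [C.id_comp]

theorem subst_singles {n : ℕ} {X : Fin n → C.Ob → Type u} {c : C.Ob} (p : C.Pt X c) :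
    subst (IsConcat.singles X) p.op (fun i => (⟨fun _ => p.inp i, C.id _, fun _ => p.val i⟩ :
      C.Pt (fun _ : Fin 1 => X i) (p.inp i))) = p := by
  rw [subst_eq (IsConcat.singles X) _ _ p.pair (IsConcat.singles _)]
  obtain ⟨i, f, v⟩ := p
  change Pt.mk i (C.comp (IsConcat.singles i) f fun _ => C.id _) v = _
  rw [C.comp_id]

theorem subst_map {k : ℕ} {n : Fin k → ℕ} {N : ℕ}
    {X X' : ∀ i, Fin (n i) → C.Ob → Type u} {Y Y' : Fin N → C.Ob → Type u}
    (f : ∀ i j d, X i j d → X' i j d) (g : ∀ a d, Y a d → Y' a d)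
    (hfg : IsConcat (fun i j => (⟨X i j, X' i j, f i j⟩ :
      Σ Z : C.Ob → Type u, Σ Z' : C.Ob → Type u, ∀ d, Z d → Z' d)) (fun a => ⟨Y a, Y' a, g a⟩))
    (h : IsConcat X Y) (h' : IsConcat X' Y')
    {B : Fin k → C.Ob} {c : C.Ob} (e : C.Hom B c) (r : ∀ i, C.Pt (X i) (B i)) :
    (subst h e r).map g = subst h' e (fun i => (r i).map (f i)) := by
  let 𝔸 := Σ Z : C.Ob → Type u, Σ Z' : C.Ob → Type u, ∀ d, Z d → Z' d
  let v := hfg.glue (fun Z : 𝔸 => Σ d, Z.1 d) (fun i j => (r i).pair j)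
  have hv := hfg.con_glue (fun Z : 𝔸 => Σ d, Z.1 d) (fun i j => (r i).pair j)
  rw [subst_eq h e r v (hv.map fun s => (⟨s.1.1, s.2⟩ : Σ Z : C.Ob → Type u, Σ d, Z d)),
    subst_eq h' e (fun i => (r i).map (f i)) (fun a => ⟨(v a).1, g a _ (v a).2⟩)
      (hv.map fun s => (⟨s.1.2.1, s.2.1, s.1.2.2 _ s.2.2⟩ : Σ Z : C.Ob → Type u, Σ d, Z d))]
  rfl

theorem subst_subst {k : ℕ} {n : Fin k → ℕ} {p : ∀ i, Fin (n i) → ℕ} {P : Fin k → ℕ} {M N : ℕ}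
    {q : Fin M → ℕ} {X : ∀ i j, Fin (p i j) → C.Ob → Type u} {Y : ∀ i, Fin (P i) → C.Ob → Type u}
    {Z : ∀ a, Fin (q a) → C.Ob → Type u} {W : Fin N → C.Ob → Type u}
    (hXY : ∀ i, IsConcat (X i) (Y i)) (hYW : IsConcat Y W) (hZW : IsConcat Z W)
    {A : ∀ i, Fin (n i) → C.Ob} {A' : Fin M → C.Ob} (hA : IsConcat A A')
    {B : Fin k → C.Ob} {c : C.Ob} (e : C.Hom B c) (f : ∀ i, C.Hom (A i) (B i))
    (r : ∀ i j, C.Pt (X i j) (A i j)) (r' : ∀ a, C.Pt (Z a) (A' a))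
    (hr : IsConcat (fun i j => (⟨⟨p i j, X i j⟩, A i j, r i j⟩ :
      Σ (x : Σ m, Fin m → C.Ob → Type u) (d : C.Ob), C.Pt x.2 d)) (fun a => ⟨⟨q a, Z a⟩, A' a, r' a⟩)) :
    subst hZW (C.comp hA e f) r' = subst hYW e (fun i => subst (hXY i) (f i) (r i)) := by
  have h1 := con_subst hYW e (fun i => subst (hXY i) (f i) (r i))
  have h2 := IsConcat.assoc (hr.map fun s => (⟨s.1.1, fun l => ⟨s.1.2 l, s.2.2.pair l⟩⟩ :
    Σ m, Fin m → Σ Z : C.Ob → Type u, Σ d, Z d))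
    (fun i => con_subst (hXY i) (f i) (r i)) h1
  rw [subst_eq hZW _ r' _ h2]
  refine congrArg (ofPairs _) ?_
  refine (C.assoc e f (fun i j => (r i j).op) (fun a => (r' a).op) (hr.map fun s =>
    (⟨s.2.1, ⟨s.1.1, s.2.2.inp⟩, s.2.2.op⟩ : Σ (b : C.Ob) (l : Σ m, Fin m → C.Ob), C.Hom l.2 b))
    _ _ _ _).symm

end Pt

/-- The multitensor `E` on `[C_0, Set]` given by
`E(X_1, ..., X_n)(c) = ∐ (C_1, ..., C_n), C(C_1, ..., C_n; c) × ∏ i, X_i(C_i)`. -/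
noncomputable def multitensor : Multitensor (C.Ob → Type u) where
  T n :=
    { obj := fun X c => C.Pt X c
      map := fun f c => TypeCat.ofHom (Pt.map fun i d => f i d)
      map_id := fun X => by ext c x; rfl
      map_comp := fun f g => by ext c x; rfl }
  u X c := TypeCat.ofHom fun x => ⟨fun _ => c, C.id c, fun _ => x⟩
  σ X Y h c := TypeCat.ofHom fun p => Pt.subst h p.op p.val
  u_naturality f := by ext c x; rfl
  σ_naturality {k n N X X' Y Y'} f g hfg h h' := by
    ext c x
    exact Pt.subst_map (fun i j d => f i j d) (fun a d => g a d)
      (hfg.map fun s : Arrow (C.Ob → Type u) => (⟨s.left, s.right, fun d => s.hom d⟩ :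
        Σ Z : C.Ob → Type u, Σ Z' : C.Ob → Type u, ∀ d, Z d → Z' d)) h h' x.op x.val
  u_σ X := by
    ext c x
    exact Pt.subst_single x
  map_u_σ X := by
    ext c x
    exact Pt.subst_singles x
  assoc {k n p P M N q} X Y Z W hXZ hT hXY hYW hZW := by
    ext c x
    refine Pt.subst_subst hXY hYW hZW _ x.op (fun i => (x.val i).op) (fun i j => (x.val i).val j)
      _ ?_
    have h1 := hXZ.con_glue (fun Z => Σ d, C.Pt Z.2 d) (fun i j => (x.val i).pair j)
    refine Eq.mp (congrArg (IsConcat _) (funext fun a => ?_)) h1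
    exact congrArg (Sigma.mk _) (hXZ.glue_comap
      (fun Z : Σ m, Fin m → C.Ob → Type u => (fun d => C.Pt Z.2 d))
      (fun Z => Σ d, Z d) hT (fun i j => (x.val i).pair j) a).symm

/-- The objects of the linear part `C_l`. -/
def Lin : Type u := C.Ob

variable {C}

/-- Postcomposition of a multimap with a linear map. -/
def post {n : ℕ} {A : Fin n → C.Ob} {c d : C.Ob} (g : C.Hom (fun _ : Fin 1 => c) d)
    (f : C.Hom A c) : C.Hom A d := C.comp (IsConcat.single A) g (fun _ => f)

/-- Precomposition of a multimap with a sequence of linear maps. -/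
def pre {n : ℕ} {A B : Fin n → C.Ob} {c : C.Ob} (f : C.Hom B c)
    (g : ∀ i, C.Hom (fun _ : Fin 1 => A i) (B i)) : C.Hom A c := C.comp (IsConcat.singles A) f g

theorem post_comp {k : ℕ} {n : Fin k → ℕ} {N : ℕ} {A : ∀ i, Fin (n i) → C.Ob} {L : Fin N → C.Ob}
    (h : IsConcat A L) {B : Fin k → C.Ob} {c d : C.Ob} (g : C.Hom (fun _ : Fin 1 => c) d)
    (f : C.Hom B c) (e : ∀ i, C.Hom (A i) (B i)) :
    post g (C.comp h f e) = C.comp h (post g f) e :=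
  C.assoc g (fun _ => f) (fun _ => e) e (IsConcat.single _) (fun _ => h) (IsConcat.single L) h
    (IsConcat.single B)

theorem pre_comp {k : ℕ} {n : Fin k → ℕ} {N : ℕ} {A : ∀ i, Fin (n i) → C.Ob} {L : Fin N → C.Ob}
    (h : IsConcat A L) {B B' : Fin k → C.Ob} {c : C.Ob} (f : C.Hom B' c)
    (g : ∀ i, C.Hom (fun _ : Fin 1 => B i) (B' i)) (e : ∀ i, C.Hom (A i) (B i)) :
    C.comp h f (fun i => post (g i) (e i)) = C.comp h (pre f g) e :=
  C.assoc f g (fun i _ => e i) e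
    (IsConcat.singles fun i => (⟨B i, ⟨n i, A i⟩, e i⟩ :
      Σ (b : C.Ob) (l : Σ m, Fin m → C.Ob), C.Hom l.2 b))
    (fun i => IsConcat.single (A i)) h h (IsConcat.singles B)

theorem comp_pre {k : ℕ} {n : Fin k → ℕ} {N : ℕ} {A A' : ∀ i, Fin (n i) → C.Ob}
    {L L' : Fin N → C.Ob} (h : IsConcat A L) (h' : IsConcat A' L') {B : Fin k → C.Ob} {c : C.Ob}
    (f : C.Hom B c) (e : ∀ i, C.Hom (A' i) (B i))
    (g : ∀ i j, C.Hom (fun _ : Fin 1 => A i j) (A' i j))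
    (g' : ∀ a, C.Hom (fun _ : Fin 1 => L a) (L' a))
    (hg : IsConcat (fun i j => (⟨A i j, A' i j, g i j⟩ :
        Σ (a b : C.Ob), C.Hom (fun _ : Fin 1 => a) b)) (fun a => ⟨L a, L' a, g' a⟩)) :
    C.comp h f (fun i => pre (e i) (g i)) = pre (C.comp h' f e) g' :=
  C.assoc f e g g' (hg.map fun s => (⟨s.2.1, ⟨1, fun _ => s.1⟩, s.2.2⟩ :
      Σ (b : C.Ob) (l : Σ m, Fin m → C.Ob), C.Hom l.2 b))
    (fun i => IsConcat.singles (A i)) h (IsConcat.singles L) h'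

theorem post_id {n : ℕ} {A : Fin n → C.Ob} {c : C.Ob} (f : C.Hom A c) : post (C.id c) f = f :=
  C.id_comp f

theorem pre_id {n : ℕ} {A : Fin n → C.Ob} {c : C.Ob} (f : C.Hom A c) :
    pre f (fun i => C.id (A i)) = f :=
  C.comp_id f

theorem post_post {n : ℕ} {A : Fin n → C.Ob} {c d e : C.Ob} (h : C.Hom (fun _ : Fin 1 => d) e)
    (g : C.Hom (fun _ : Fin 1 => c) d) (f : C.Hom A c) : post h (post g f) = post (post h g) f :=
  post_comp _ _ _ _

variable (C)

/-- The linear part `C_l`: objects those of `C`, morphisms the multimaps with one input. -/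
instance : Category.{u} C.Lin where
  Hom a b := C.Hom (fun _ : Fin 1 => (a : C.Ob)) (b : C.Ob)
  id a := C.id a
  comp f g := post g f
  id_comp f := C.comp_id f
  comp_id f := C.id_comp f
  assoc f g h := post_post h g f

/-- The relation generating the equivalence relation which defines the coend
`∫^(C_1, ..., C_n) C(C_1, ..., C_n; c) × ∏ i, X_i(C_i)`, for `C_1, ..., C_n` in `C_l`:
`(φ(f_1, ..., f_n), (x_i)_i)` is identified with `(φ, (X_i(f_i)(x_i))_i)`. -/
def Rel {n : ℕ} (X : Fin n → C.Lin ⥤ Type u) (c : C.Ob)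
    (p q : C.Pt (fun i => (X i).obj) c) : Prop :=
  ∃ f : ∀ i, C.Hom (fun _ : Fin 1 => p.inp i) (q.inp i),
    p.op = pre q.op f ∧ ∀ i, (X i).map (f i) (p.val i) = q.val i

/-- The coend `∫^(C_1, ..., C_n) C(C_1, ..., C_n; c) × ∏ i, X_i(C_i)`. -/
def Coend {n : ℕ} (X : Fin n → C.Lin ⥤ Type u) (c : C.Ob) : Type u := Quot (C.Rel X c)

variable {C}

/-- A representative of an element of the coend. -/
noncomputable def Coend.out {n : ℕ} {X : Fin n → C.Lin ⥤ Type u} {c : C.Ob} (x : C.Coend X c) :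
    C.Pt (fun i => (X i).obj) c := Quot.out (r := C.Rel X c) x

theorem Rel.refl {n : ℕ} {X : Fin n → C.Lin ⥤ Type u} {c : C.Ob}
    (p : C.Pt (fun i => (X i).obj) c) : C.Rel X c p p :=
  ⟨fun i => C.id _, (pre_id _).symm, fun i => by
    exact congrArg (fun g => g (p.val i)) ((X i).map_id (p.inp i))⟩

/-- Postcomposition of an element of the coproduct with a linear map. -/
def Pt.post {n : ℕ} {X : Fin n → C.Ob → Type u} {c d : C.Ob} (g : C.Hom (fun _ : Fin 1 => c) d)
    (p : C.Pt X c) : C.Pt X d := ⟨p.inp, Multicategory.post g p.op, p.val⟩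

theorem Rel.post {n : ℕ} {X : Fin n → C.Lin ⥤ Type u} {c d : C.Ob}
    (g : C.Hom (fun _ : Fin 1 => c) d) {p q : C.Pt (fun i => (X i).obj) c} (h : C.Rel X c p q) :
    C.Rel X d (p.post g) (q.post g) := by
  obtain ⟨f, h1, h2⟩ := h
  refine ⟨f, ?_, h2⟩
  change Multicategory.post g p.op = _
  rw [h1]
  exact post_comp _ _ _ _

theorem Rel.map {n : ℕ} {X Y : Fin n → C.Lin ⥤ Type u} (f : ∀ i, X i ⟶ Y i) {c : C.Ob}
    {p q : C.Pt (fun i => (X i).obj) c} (h : C.Rel X c p q) :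
    C.Rel Y c (p.map fun i d => (f i).app d) (q.map fun i d => (f i).app d) := by
  obtain ⟨e, h1, h2⟩ := h
  refine ⟨e, h1, fun i => ?_⟩
  change (Y i).map (e i) ((f i).app _ (p.val i)) = (f i).app _ (q.val i)
  rw [← h2]
  exact (NatTrans.naturality_apply (f i) (e i) (p.val i)).symm

/-- The functor `c ↦ ∫^(C_1, ..., C_n) C(C_1, ..., C_n; c) × ∏ i, X_i(C_i)`. -/
def convObj {n : ℕ} (X : Fin n → C.Lin ⥤ Type u) : C.Lin ⥤ Type u where
  obj c := C.Coend X c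
  map g := TypeCat.ofHom (Quot.map (Pt.post g) fun _ _ h => h.post g)
  map_id c := by
    ext x
    obtain ⟨p, rfl⟩ := Quot.exists_rep x
    exact congrArg (fun o => Quot.mk _ (Pt.mk p.inp o p.val)) (post_id p.op)
  map_comp f g := by
    ext x
    obtain ⟨p, rfl⟩ := Quot.exists_rep x
    exact congrArg (fun o => Quot.mk _ (Pt.mk p.inp o p.val)) (post_post g f p.op).symm

/-- The `n`-ary convolution product. -/
def conv (C : Multicategory.{u}) (n : ℕ) : (Fin n → C.Lin ⥤ Type u) ⥤ (C.Lin ⥤ Type u) where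
  obj X := convObj X
  map f :=
    { app := fun c => TypeCat.ofHom (Quot.map (Pt.map fun i d => (f i).app d) fun _ _ h => h.map f)
      naturality := fun c d g => by
        ext x
        obtain ⟨p, rfl⟩ := Quot.exists_rep x
        rfl }
  map_id X := by
    ext c x
    obtain ⟨p, rfl⟩ := Quot.exists_rep x
    rfl
  map_comp f g := by
    ext c x
    obtain ⟨p, rfl⟩ := Quot.exists_rep x
    rfl

theorem Rel.subst {k : ℕ} {n : Fin k → ℕ} {N : ℕ}
    {X : ∀ i, Fin (n i) → C.Lin ⥤ Type u} {Y : Fin N → C.Lin ⥤ Type u} (h : IsConcat X Y)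
    {B : Fin k → C.Ob} {c : C.Ob} (f : C.Hom B c)
    {r r' : ∀ i, C.Pt (fun j => (X i j).obj) (B i)} (hr : ∀ i, C.Rel (X i) (B i) (r i) (r' i)) :
    C.Rel Y c (Pt.subst (h.map fun Z => Z.obj) f r) (Pt.subst (h.map fun Z => Z.obj) f r') := by
  choose e h1 h2 using hr
  let 𝔹 : (C.Lin ⥤ Type u) → Type u := fun Z => Σ (a b : C.Ob), C.Hom (fun _ : Fin 1 => a) b × Z.obj a
  let v : ∀ i j, 𝔹 (X i j) := fun i j => ⟨_, _, e i j, (r i).val j⟩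
  have hv := h.con_glue 𝔹 v
  rw [Pt.subst_eq (h.map fun Z => Z.obj) f r (fun a => ⟨(h.glue 𝔹 v a).1, (h.glue 𝔹 v a).2.2.2⟩)
      (hv.map fun s => (⟨s.1.obj, s.2.1, s.2.2.2.2⟩ : Σ Z : C.Ob → Type u, Σ d, Z d)),
    Pt.subst_eq (h.map fun Z => Z.obj) f r'
      (fun a => ⟨(h.glue 𝔹 v a).2.1, (Y a).map (h.glue 𝔹 v a).2.2.1 (h.glue 𝔹 v a).2.2.2⟩) ?_]
  · refine ⟨fun a => (h.glue 𝔹 v a).2.2.1, ?_, fun a => rfl⟩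
    change C.comp _ f (fun i => (r i).op) = _
    rw [show (fun i => (r i).op) = fun i => pre (r' i).op (e i) from funext h1]
    exact comp_pre _ _ f (fun i => (r' i).op) e _
      (hv.map fun s => (⟨s.2.1, s.2.2.1, s.2.2.2.1⟩ :
        Σ (a b : C.Ob), C.Hom (fun _ : Fin 1 => a) b))
  · have h3 := hv.map fun s => (⟨s.1.obj, s.2.2.1, s.1.map s.2.2.2.1 s.2.2.2.2⟩ :
      Σ Z : C.Ob → Type u, Σ d, Z d)
    refine Eq.mp (congrArg (fun t => IsConcat t _) (funext fun i => funext fun j => ?_)) h3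
    have := h2 i j
    exact congrArg (fun y => (⟨(X i j).obj, (r' i).inp j, y⟩ : Σ Z : C.Ob → Type u, Σ d, Z d)) this

theorem eq_of_quot_eq {ι : Type} [Finite ι] {α : ι → Type u} {β : Type v}
    (R : ∀ i, α i → α i → Prop) (f : (∀ i, α i) → β) (hR : ∀ i x, R i x x)
    (hf : ∀ a b, (∀ i, R i (a i) (b i)) → f a = f b) (a b : ∀ i, α i)
    (h : ∀ i, Quot.mk (R i) (a i) = Quot.mk (R i) (b i)) : f a = f b := by
  classical
  have step : ∀ (a : ∀ i, α i) (i : ι) (x y : α i), Quot.mk (R i) x = Quot.mk (R i) y →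
      f (Function.update a i x) = f (Function.update a i y) := by
    intro a i x y hxy
    refine congrArg (Quot.lift (fun z => f (Function.update a i z)) ?_) hxy
    intro x y hr
    refine hf _ _ fun j => ?_
    rcases eq_or_ne j i with rfl | hj
    · simpa using hr
    · simpa [hj] using hR j _
  have := Fintype.ofFinite ι
  have key : ∀ s : Finset ι, f a = f (fun i => if i ∈ s then b i else a i) := by
    intro s
    induction s using Finset.induction_on with
    | empty => simp
    | insert i s hi ih =>
      have h1 := step (fun j => if j ∈ s then b j else a j) i _ _ (h i)
      rw [ih]
      convert h1 using 2
      · funext j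
        rcases eq_or_ne j i with rfl | hj
        · simp [hi]
        · simp [hj]
      · funext j
        rcases eq_or_ne j i with rfl | hj
        · simp
        · simp [hj]
  simpa using key Finset.univ

theorem mk_subst_eq {k : ℕ} {n : Fin k → ℕ} {N : ℕ}
    {X : ∀ i, Fin (n i) → C.Lin ⥤ Type u} {Y : Fin N → C.Lin ⥤ Type u} (h : IsConcat X Y)
    {B : Fin k → C.Ob} {c : C.Ob} (f : C.Hom B c)
    (r r' : ∀ i, C.Pt (fun j => (X i j).obj) (B i))
    (hr : ∀ i, Quot.mk (C.Rel (X i) (B i)) (r i) = Quot.mk (C.Rel (X i) (B i)) (r' i)) :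
    Quot.mk (C.Rel Y c) (Pt.subst (h.map fun Z => Z.obj) f r) =
      Quot.mk (C.Rel Y c) (Pt.subst (h.map fun Z => Z.obj) f r') :=
  eq_of_quot_eq (fun i => C.Rel (X i) (B i))
    (fun r => Quot.mk (C.Rel Y c) (Pt.subst (h.map fun Z => Z.obj) f r)) (fun _ x => Rel.refl x)
    (fun _ _ h' => Quot.sound (Rel.subst h f h')) r r' hr

/-- Substitution for the convolution products: the class of `(φ, ([ψ_i, (x_ij)_j])_i)` is sent to the
class of `(φ(ψ_1, ..., ψ_k), con(x_ij))`. -/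
noncomputable def convSubst {k : ℕ} {n : Fin k → ℕ} {N : ℕ}
    {X : ∀ i, Fin (n i) → C.Lin ⥤ Type u} {Y : Fin N → C.Lin ⥤ Type u} (h : IsConcat X Y)
    (c : C.Ob) : C.Coend (fun i => convObj (X i)) c → C.Coend Y c :=
  Quot.lift (fun p => Quot.mk _ (Pt.subst (h.map fun Z => Z.obj) p.op
      fun i => Coend.out (p.val i))) <| by
    rintro p q ⟨f, h1, h2⟩
    let r : ∀ i, C.Pt (fun j => (X i j).obj) (p.inp i) := fun i =>
      Coend.out (p.val i)
    have h3 : Pt.subst (h.map fun Z => Z.obj) p.op r =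
        Pt.subst (h.map fun Z => Z.obj) q.op (fun i => (r i).post (f i)) := by
      rw [h1]
      exact congrArg (Pt.ofPairs _) (pre_comp _ q.op f fun i => (r i).op).symm
    change Quot.mk _ (Pt.subst (h.map fun Z => Z.obj) p.op r) = _
    rw [h3]
    refine mk_subst_eq h q.op _ _ fun i => ?_
    refine Eq.trans ?_ (Quot.out_eq _).symm
    rw [← h2 i]
    have h4 : p.val i = Quot.mk (C.Rel (X i) (p.inp i)) (r i) := (Quot.out_eq _).symm
    rw [h4]
    rfl

theorem convSubst_mk {k : ℕ} {n : Fin k → ℕ} {N : ℕ}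
    {X : ∀ i, Fin (n i) → C.Lin ⥤ Type u} {Y : Fin N → C.Lin ⥤ Type u} (h : IsConcat X Y)
    {B : Fin k → C.Ob} {c : C.Ob} (f : C.Hom B c) (r : ∀ i, C.Pt (fun j => (X i j).obj) (B i)) :
    convSubst h c (Quot.mk _ ⟨B, f, fun i => (Quot.mk _ (r i) : C.Coend (X i) (B i))⟩) =
      Quot.mk _ (Pt.subst (h.map fun Z => Z.obj) f r) :=
  mk_subst_eq h f _ _ fun _ => Quot.out_eq _

theorem exists_rep {k : ℕ} {n : Fin k → ℕ} {X : ∀ i, Fin (n i) → C.Lin ⥤ Type u} {c : C.Ob}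
    (x : C.Coend (fun i => convObj (X i)) c) :
    ∃ (B : Fin k → C.Ob) (f : C.Hom B c) (r : ∀ i, C.Pt (fun j => (X i j).obj) (B i)),
      x = Quot.mk _ ⟨B, f, fun i => (Quot.mk _ (r i) : C.Coend (X i) (B i))⟩ := by
  obtain ⟨⟨B, f, v⟩, rfl⟩ := Quot.exists_rep x
  choose r hr using fun i => Quot.exists_rep (v i : Quot (C.Rel (X i) (B i)))
  obtain rfl : v = fun i => Quot.mk (C.Rel (X i) (B i)) (r i) := (funext hr).symm
  exact ⟨B, f, r, rfl⟩

theorem Pt.subst_post {k : ℕ} {n : Fin k → ℕ} {N : ℕ}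
    {X : ∀ i, Fin (n i) → C.Ob → Type u} {Y : Fin N → C.Ob → Type u} (h : IsConcat X Y)
    {B : Fin k → C.Ob} {c d : C.Ob} (g : C.Hom (fun _ : Fin 1 => c) d) (f : C.Hom B c)
    (r : ∀ i, C.Pt (X i) (B i)) :
    (Pt.subst h f r).post g = Pt.subst h (Multicategory.post g f) r :=
  congrArg (Pt.ofPairs _) (post_comp _ g f fun i => (r i).op)

/-- The standard convolution `F` on `[C_l, Set]`:
`F(X_1, ..., X_n) = ∫^(C_1, ..., C_n) C(C_1, ..., C_n; -) × ∏ i, X_i(C_i)`. -/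
noncomputable def convolution (C : Multicategory.{u}) : Multitensor (C.Lin ⥤ Type u) where
  T n := conv C n
  u X :=
    { app := fun c => TypeCat.ofHom fun x => Quot.mk _ ⟨fun _ => c, C.id c, fun _ => x⟩
      naturality := fun c d g => by
        ext x
        refine (Quot.sound ⟨fun _ => g, ?_, fun _ => rfl⟩ : Quot.mk (C.Rel (fun _ : Fin 1 => X) d)
          ⟨fun _ => c, post g (C.id c), fun _ => x⟩ =
          Quot.mk (C.Rel (fun _ : Fin 1 => X) d) ⟨fun _ => d, C.id d, fun _ => X.map g x⟩).symm
        exact (C.comp_id (A := fun _ => c) g).trans (C.id_comp g).symm }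
  σ {k n N} X Y h :=
    { app := fun c => TypeCat.ofHom (convSubst h c)
      naturality := fun c d g => by
        ext x
        obtain ⟨B, f, r, rfl⟩ := exists_rep x
        refine (convSubst_mk h (post g f) r).trans ?_
        refine Eq.trans ?_ (congrArg ((convObj Y).map g) (convSubst_mk h f r)).symm
        exact congrArg (Quot.mk _) (Pt.subst_post _ g f r).symm }
  u_naturality f := by
    ext c x
    rfl
  σ_naturality {k n N X X' Y Y'} f g hfg h h' := by
    ext c x
    obtain ⟨B, e, r, rfl⟩ := exists_rep x
    refine (congrArg (((conv C N).map g).app c) (convSubst_mk h e r)).trans ?_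
    refine Eq.trans ?_ (convSubst_mk h' e fun i => (r i).map fun j d => (f i j).app d).symm
    exact congrArg (Quot.mk _) (Pt.subst_map (fun i j d => (f i j).app d) (fun a d => (g a).app d)
      (hfg.map fun s : Arrow (C.Lin ⥤ Type u) => (⟨s.left.obj, s.right.obj, fun d => s.hom.app d⟩ :
        Σ Z : C.Ob → Type u, Σ Z' : C.Ob → Type u, ∀ d, Z d → Z' d)) _ _ e r)
  u_σ X := by
    ext c x
    obtain ⟨p, rfl⟩ := Quot.exists_rep x
    refine (convSubst_mk (IsConcat.single X) (C.id c) (fun _ => p)).trans ?_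
    exact congrArg (Quot.mk _) (Pt.subst_single p)
  map_u_σ X := by
    ext c x
    obtain ⟨p, rfl⟩ := Quot.exists_rep x
    refine (convSubst_mk (IsConcat.singles X) p.op _).trans ?_
    exact congrArg (Quot.mk _) (Pt.subst_singles p)
  assoc {k n p P M N q} X Y Z W hXZ hT hXY hYW hZW := by
    ext c x
    obtain ⟨B, e, r, rfl⟩ := exists_rep x
    choose s hs using fun i j => Quot.exists_rep (r := C.Rel (X i j) ((r i).inp j)) ((r i).val j)
    let r' := hXZ.glue (fun Z : Σ m, Fin m → C.Lin ⥤ Type u => Σ d, C.Pt (fun l => (Z.2 l).obj) d)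
      (fun i j => ⟨(r i).inp j, s i j⟩)
    have hr' := hXZ.con_glue
      (fun Z : Σ m, Fin m → C.Lin ⥤ Type u => Σ d, C.Pt (fun l => (Z.2 l).obj) d)
      (fun i j => ⟨(r i).inp j, s i j⟩)
    have hA : IsConcat (fun i j => (r i).inp j) (fun a => (r' a).1) := hr'.map fun z => z.2.1
    have e1 : Pt.subst (hT.map fun Z => Z.obj) e r =
        ⟨fun a => (r' a).1, C.comp hA e (fun i => (r i).op),
          fun a => (Quot.mk _ (r' a).2 : C.Coend (Z a) (r' a).1)⟩ := by
      refine Pt.subst_eq (hT.map fun Z => Z.obj) e r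
        (fun a => ⟨(r' a).1, (Quot.mk _ (r' a).2 : C.Coend (Z a) (r' a).1)⟩) ?_
      refine Eq.mp (congrArg (fun t => IsConcat t _) (funext fun i => funext fun j => ?_))
        (hr'.map fun z => (⟨fun d => C.Coend z.1.2 d, z.2.1, Quot.mk _ z.2.2⟩ :
          Σ Z : C.Ob → Type u, Σ d, Z d))
      exact congrArg (fun y => (⟨fun d => C.Coend (X i j) d, (r i).inp j, y⟩ :
        Σ Z : C.Ob → Type u, Σ d, Z d)) (hs i j)
    have e2 : ∀ i, convSubst (hXY i) (B i) (Quot.mk _ (r i)) =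
        Quot.mk _ (Pt.subst ((hXY i).map fun Z => Z.obj) (r i).op (s i)) := by
      intro i
      rw [← convSubst_mk]
      exact congrArg (fun v => convSubst (hXY i) (B i) (Quot.mk _ ⟨(r i).inp, (r i).op, v⟩))
        (funext fun j => (hs i j).symm)
    refine (congrArg (convSubst hZW c) (convSubst_mk hT e r)).trans ?_
    rw [e1]
    refine (convSubst_mk hZW _ _).trans ?_
    refine Eq.trans ?_ (congrArg (fun v => convSubst hYW c (Quot.mk _ ⟨B, e, v⟩))
      (funext e2)).symm
    refine Eq.trans ?_ (convSubst_mk hYW e _).symm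
    refine congrArg (Quot.mk _) ?_
    exact Pt.subst_subst (fun i => (hXY i).map fun Z => Z.obj) (hYW.map fun Z => Z.obj)
      (hZW.map fun Z => Z.obj) hA e (fun i => (r i).op) s (fun a => (r' a).2)
      (hr'.map fun z => (⟨⟨z.1.1, fun l => (z.1.2 l).obj⟩, z.2.1, z.2.2⟩ :
        Σ (x : Σ m, Fin m → C.Ob → Type u) (d : C.Ob), C.Pt x.2 d))

end Multicategory

namespace Multitensor

variable {V : Type u} [Category.{v} V] (E : Multitensor V)

/-- The unary part of a multitensor. -/
def unary : Monad V where
  obj X := (E.T 1).obj (fun _ => X)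
  map f := (E.T 1).map (fun _ => f)
  map_id X := (E.T 1).map_id (fun _ => X)
  map_comp f g := (E.T 1).map_comp (fun _ => f) (fun _ => g)
  η := { app := E.u, naturality := fun _ _ f => E.u_naturality f }
  μ :=
    { app := fun X => E.σ (k := 1) (n := fun _ => 1) (fun _ _ => X) (fun _ => X)
        (IsConcat.single fun _ : Fin 1 => X)
      naturality := fun X Y f => (E.σ_naturality (fun _ _ => f) (fun _ => f)
        (IsConcat.single fun _ : Fin 1 => Arrow.mk f) (IsConcat.single fun _ : Fin 1 => X)
        (IsConcat.single fun _ : Fin 1 => Y)).symm }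
  assoc X := (E.assoc (k := 1) (n := fun _ => 1) (p := fun _ _ => 1) (P := fun _ => 1) (M := 1)
    (q := fun _ => 1) (fun _ _ _ => X) (fun _ _ => X) (fun _ _ => X) (fun _ => X)
    (IsConcat.single _) (IsConcat.single _) (fun _ => IsConcat.single _) (IsConcat.single _)
    (IsConcat.single _)).symm
  left_unit X := E.u_σ (fun _ : Fin 1 => X)
  right_unit X := E.map_u_σ (fun _ : Fin 1 => X)

/-- A functor operad: a multitensor whose unit is invertible, so that its unary part is isomorphic to
the identity monad. -/
def IsFunctorOperad : Prop := ∀ X : V, IsIso (E.u X)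

/-- The multitensor is a monoidal structure: its unit and substitution are invertible. -/
def IsMonoidal : Prop :=
  (∀ X : V, IsIso (E.u X)) ∧
    ∀ {k : ℕ} {n : Fin k → ℕ} {N : ℕ} (X : ∀ i, Fin (n i) → V) (Y : Fin N → V)
      (h : IsConcat X Y), IsIso (E.σ X Y h)

/-- The functor `V ⥤ V`, `A ↦ E(X_1, ..., A, ..., X_n)` with `A` in the `i`-th place. -/
def variableFunctor {n : ℕ} (X : Fin n → V) (i : Fin n) : V ⥤ V :=
  Functor.pi' (fun j => if j = i then 𝟭 V else (Functor.const V).obj (X j)) ⋙ E.T n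

/-- Each `E_n` preserves small coproducts in each variable. -/
def IsDistributive : Prop :=
  ∀ {n : ℕ} (X : Fin n → V) (i : Fin n) (J : Type v),
    Limits.PreservesColimitsOfShape (Discrete J) (E.variableFunctor X i)

/-- Each `E_n` preserves small colimits in each variable. -/
def IsCocomplete : Prop :=
  ∀ {n : ℕ} (X : Fin n → V) (i : Fin n),
    Limits.PreservesColimitsOfSize.{v, v} (E.variableFunctor X i)

end Multitensor

/-- Isomorphisms of multitensors `F ≅ E` along a functor `K` between the underlying categories:
natural isomorphisms `K(F(X_1, ..., X_n)) ≅ E(KX_1, ..., KX_n)` compatible with the units and the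
substitutions. -/
structure MultitensorIso {W : Type u'} [Category.{v'} W] {V : Type u} [Category.{v} V]
    (K : W ⥤ V) (F : Multitensor W) (E : Multitensor V) where
  /-- the components -/
  iso : ∀ {n : ℕ} (X : Fin n → W), K.obj ((F.T n).obj X) ≅ (E.T n).obj (fun i => K.obj (X i))
  naturality : ∀ {n : ℕ} {X Y : Fin n → W} (f : ∀ i, X i ⟶ Y i),
    K.map ((F.T n).map f) ≫ (iso Y).hom = (iso X).hom ≫ (E.T n).map (fun i => K.map (f i))
  unit : ∀ X : W, K.map (F.u X) ≫ (iso fun _ => X).hom = E.u (K.obj X)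
  subst : ∀ {k : ℕ} {n : Fin k → ℕ} {N : ℕ} (X : ∀ i, Fin (n i) → W) (Y : Fin N → W)
    (h : IsConcat X Y),
    K.map (F.σ X Y h) ≫ (iso Y).hom =
      (iso fun i => (F.T (n i)).obj (X i)).hom ≫ (E.T k).map (fun i => (iso (X i)).hom) ≫
        E.σ (fun i j => K.obj (X i j)) (fun a => K.obj (Y a)) (h.map K.obj)

/-- A graph enriched in `V`. -/
structure EnrichedGraph (V : Type u) where
  /-- objects -/
  Ob : Type w
  /-- homs -/
  hom : Ob → Ob → V

namespace EnrichedGraph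

variable {V : Type u} [Category.{v} V]

/-- Morphisms of enriched graphs. -/
@[ext]
structure Hom (X Y : EnrichedGraph.{w} V) where
  /-- object map -/
  obj : X.Ob → Y.Ob
  /-- hom maps -/
  map : ∀ a b, X.hom a b ⟶ Y.hom (obj a) (obj b)

instance : Category (EnrichedGraph.{w} V) where
  Hom := Hom
  id X := ⟨fun a => a, fun _ _ => 𝟙 _⟩
  comp f g := ⟨fun a => g.obj (f.obj a), fun a b => f.map a b ≫ g.map _ _⟩
  id_comp f := Hom.ext rfl (heq_of_eq (by funext a b; exact Category.id_comp _))
  comp_id f := Hom.ext rfl (heq_of_eq (by funext a b; exact Category.comp_id _))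
  assoc f g h := Hom.ext rfl (heq_of_eq (by funext a b; exact Category.assoc _ _ _))

end EnrichedGraph

/-- There is a sequence `(x_0, ..., x_n)` with `x_0 = a`, `x_n = b`, `s = (x_0, ..., x_{n-1})` and
`t = (x_1, ..., x_n)`. -/
def IsPath {O : Type w} {n : ℕ} (a b : O) (s t : Fin n → O) : Prop :=
  ∃ x : Fin (n + 1) → O, x 0 = a ∧ x (Fin.last n) = b ∧
    (∀ i, s i = x i.castSucc) ∧ ∀ i, t i = x i.succ

namespace IsPath

theorem single {O : Type w} (a b : O) : IsPath a b (fun _ : Fin 1 => a) (fun _ => b) :=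
  ⟨![a, b], rfl, rfl, fun i => by rw [Subsingleton.elim i 0]; rfl,
    fun i => by rw [Subsingleton.elim i 0]; rfl⟩

theorem map {O : Type w} {O' : Type v} (f : O → O') {n : ℕ} {a b : O} {s t : Fin n → O}
    (h : IsPath a b s t) : IsPath (f a) (f b) (fun i => f (s i)) (fun i => f (t i)) := by
  obtain ⟨x, h0, h1, h2, h3⟩ := h
  exact ⟨fun i => f (x i), congrArg f h0, congrArg f h1, fun i => congrArg f (h2 i),
    fun i => congrArg f (h3 i)⟩

end IsPath

/-- A category enriched in the multitensor `E`. A sequence of objects `(x_0, ..., x_n)` is given by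
its ends and by the sequences `s = (x_0, ..., x_{n-1})` and `t = (x_1, ..., x_n)`. -/
structure EnrichedCat {V : Type u} [Category.{v} V] (E : Multitensor V) where
  /-- the underlying graph -/
  graph : EnrichedGraph.{w} V
  /-- the composition `E(X(x_0, x_1), ..., X(x_{n-1}, x_n)) ⟶ X(x_0, x_n)` -/
  comp : ∀ {n : ℕ} {a b : graph.Ob} {s t : Fin n → graph.Ob}, IsPath a b s t →
    ((E.T n).obj (fun i => graph.hom (s i) (t i)) ⟶ graph.hom a b)
  unit : ∀ a b, E.u (graph.hom a b) ≫ comp (IsPath.single a b) = 𝟙 _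
  assoc : ∀ {k : ℕ} {n : Fin k → ℕ} {N : ℕ} {a b : graph.Ob} {s t : Fin k → graph.Ob}
    (h : IsPath a b s t) {s' t' : ∀ i, Fin (n i) → graph.Ob}
    (h' : ∀ i, IsPath (s i) (t i) (s' i) (t' i)) {S T : Fin N → graph.Ob}
    (_ : IsConcat (fun i j => (s' i j, t' i j)) (fun l => (S l, T l)))
    (H : IsPath a b S T)
    (hc : IsConcat (fun i j => graph.hom (s' i j) (t' i j)) (fun l => graph.hom (S l) (T l))),
    E.σ (fun i j => graph.hom (s' i j) (t' i j)) (fun l => graph.hom (S l) (T l)) hc ≫ comp H =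
      (E.T k).map (fun i => comp (h' i)) ≫ comp h

namespace EnrichedCat

variable {V : Type u} [Category.{v} V] {E : Multitensor V}

/-- `E`-functors. -/
@[ext]
structure Hom (X Y : EnrichedCat.{w} E) where
  /-- the underlying morphism of graphs -/
  toGraph : X.graph ⟶ Y.graph
  comm : ∀ {n : ℕ} {a b : X.graph.Ob} {s t : Fin n → X.graph.Ob} (h : IsPath a b s t),
    X.comp h ≫ toGraph.map a b =
      (E.T n).map (fun i => toGraph.map (s i) (t i)) ≫ Y.comp (h.map toGraph.obj)

instance : Category (EnrichedCat.{w} E) where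
  Hom := Hom
  id X := ⟨𝟙 X.graph, fun h => by
    refine (Category.comp_id _).trans ?_
    refine Eq.trans (Category.id_comp _).symm ?_
    exact congrArg (· ≫ X.comp h) ((E.T _).map_id _).symm⟩
  comp {X Y Z} f g := ⟨f.toGraph ≫ g.toGraph, fun {n a b s t} h => by
    change X.comp h ≫ f.toGraph.map a b ≫ g.toGraph.map _ _ = (E.T n).map
      ((fun i => f.toGraph.map (s i) (t i)) ≫ fun i => g.toGraph.map _ _) ≫ Z.comp _
    rw [Functor.map_comp, Category.assoc, ← g.comm (h.map f.toGraph.obj), ← Category.assoc, f.comm,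
      Category.assoc]⟩
  id_comp f := Hom.ext (Category.id_comp _)
  comp_id f := Hom.ext (Category.comp_id _)
  assoc f g h := Hom.ext (Category.assoc _ _ _)

variable (E)

/-- The forgetful functor from `E`-categories to graphs enriched in `V`. -/
def forget : EnrichedCat.{w} E ⥤ EnrichedGraph.{w} V where
  obj X := X.graph
  map f := f.toGraph

variable {E}

/-- The homs of an `E`-category are algebras of the unary part of `E`. -/
def homAlgebra (X : EnrichedCat.{w} E) (a b : X.graph.Ob) : E.unary.Algebra where
  A := X.graph.hom a b
  a := X.comp (IsPath.single a b)
  unit := X.unit a b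
  assoc := X.assoc (k := 1) (n := fun _ => 1) (IsPath.single a b) (fun _ => IsPath.single a b)
    (IsConcat.single fun _ : Fin 1 => (a, b)) (IsPath.single a b) (IsConcat.single _)

variable (E)

/-- The forgetful functor from `E`-categories to graphs enriched in the category of algebras of the
unary part of `E`. -/
def forgetToAlgebra : EnrichedCat.{w} E ⥤ EnrichedGraph.{w} E.unary.Algebra where
  obj X := ⟨X.graph.Ob, X.homAlgebra⟩
  map f := ⟨f.toGraph.obj, fun a b => ⟨f.toGraph.map a b, (f.comm (IsPath.single a b)).symm⟩⟩

end EnrichedCat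

/-- `A` and `B` are isomorphic as categories over `G`. -/
def IsoOver {A : Type u} [Category.{v} A] {B : Type u'} [Category.{v'} B] {G : Type*} [Category* G]
    (U : A ⥤ G) (U' : B ⥤ G) : Prop :=
  ∃ (Φ : A ⥤ B) (Ψ : B ⥤ A), Φ ⋙ Ψ = 𝟭 A ∧ Ψ ⋙ Φ = 𝟭 B ∧ Φ ⋙ U' = U

/-- `E'` is a lift of `E`: a distributive functor operad on the category of algebras of the unary
part of `E`, whose categories are the `E`-categories. -/
def IsLift {V : Type u} [Category.{v} V] (E : Multitensor V) (E' : Multitensor E.unary.Algebra) :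
    Prop :=
  E'.IsFunctorOperad ∧ E'.IsDistributive ∧
    IsoOver (EnrichedCat.forget.{v} E') (EnrichedCat.forgetToAlgebra.{v} E)

namespace Multicategory

variable {C : Multicategory.{u}}

/-- A multimap with one input, as a linear map. -/
def toLin {A : Fin 1 → C.Ob} {c : C.Ob} (f : C.Hom A c) : C.Hom (fun _ : Fin 1 => A 0) c :=
  (funext fun i => congrArg A (Subsingleton.elim i 0) : A = fun _ => A 0) ▸ f

theorem Pt.exists_unary {X : C.Ob → Type u} {c : C.Ob} (p : C.Pt (fun _ : Fin 1 => X) c) :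
    ∃ (a : C.Ob) (f : C.Hom (fun _ : Fin 1 => a) c) (x : X a),
      p = ⟨fun _ => a, f, fun _ => x⟩ := by
  obtain ⟨A, f, v⟩ := p
  obtain ⟨a, rfl⟩ : ∃ a, A = fun _ => a :=
    ⟨A 0, funext fun i => congrArg A (Subsingleton.elim i 0)⟩
  refine ⟨a, f, v 0, ?_⟩
  exact congrArg (Pt.mk (fun _ => a) f) (funext fun i => by rw [Subsingleton.elim i 0])

theorem Pt.subst_unary {X : C.Ob → Type u} {a b c : C.Ob} (f : C.Hom (fun _ : Fin 1 => b) c)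
    (g : C.Hom (fun _ : Fin 1 => a) b) (x : X a) (h : IsConcat (fun _ _ : Fin 1 => X) fun _ => X) :
    Pt.subst (k := 1) (n := fun _ => 1) h f
      (fun _ => (⟨fun _ => a, g, fun _ => x⟩ : C.Pt (fun _ : Fin 1 => X) b)) =
      ⟨fun _ => a, Multicategory.post f g, fun _ => x⟩ :=
  Pt.subst_eq h f _ (fun _ => ⟨a, x⟩) (IsConcat.single _)

/-- The action of the unary part of `E` on (the object part of) a functor `C_l ⥤ Set`:
`(f, x) ↦ X(f)(x)`. -/
def action (X : C.Lin ⥤ Type u) (c : C.Ob) (p : C.Pt (fun _ : Fin 1 => X.obj) c) : X.obj c :=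
  X.map (toLin p.op : (show C.Lin from p.inp 0) ⟶ c) (p.val 0)

variable (C)

/-- The comparison functor from `[C_l, Set]` to the category of algebras of the unary part
of `E`. -/
noncomputable def comparison : (C.Lin ⥤ Type u) ⥤ C.multitensor.unary.Algebra where
  obj X :=
    { A := X.obj
      a := fun c => TypeCat.ofHom (action X c)
      unit := by
        funext c
        ext x
        exact congrArg (fun g => g x) (X.map_id c)
      assoc := by
        funext c
        ext p
        obtain ⟨b, f, q, rfl⟩ := Pt.exists_unary p
        obtain ⟨a, g, x, rfl⟩ := Pt.exists_unary q
        refine (congrArg (action X c) (Pt.subst_unary f g x _)).trans ?_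
        exact congrArg (fun g => g x) (X.map_comp (X := a) (Y := b) (Z := c) g f) }
  map f :=
    { f := fun c => f.app c
      h := by
        funext c
        ext p
        obtain ⟨a, g, x, rfl⟩ := Pt.exists_unary p
        exact (NatTrans.naturality_apply f (X := a) (Y := c) g x).symm }

variable {C}

/-- The functor `C(A_1, ..., A_n; -)` on the linear part. -/
def corep {n : ℕ} (A : Fin n → C.Ob) : C.Lin ⥤ Type u where
  obj c := C.Hom A c
  map g := TypeCat.ofHom (post g)
  map_id c := by ext f; exact post_id f
  map_comp g h := by ext f; exact (post_post h g f).symm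

/-- The function
`∫^(B_1, ..., B_k) C(B_1, ..., B_k; c) × ∏ i, C(A_i1, ..., A_in_i; B_i) → C(A_11, ..., A_kn_k; c)`
induced by substitution. -/
def inducedSubst {k : ℕ} {n : Fin k → ℕ} {N : ℕ} {A : ∀ i, Fin (n i) → C.Ob} {L : Fin N → C.Ob}
    (h : IsConcat A L) (c : C.Ob) : C.Coend (fun i => corep (A i)) c → C.Hom L c :=
  Quot.lift (fun p => C.comp h p.op p.val) <| by
    rintro ⟨B, f, v⟩ ⟨B', f', v'⟩ ⟨g, h1, h2⟩
    refine (congrArg (fun z => C.comp h z v) h1).trans ?_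
    refine (pre_comp h f' g v).symm.trans ?_
    exact congrArg (C.comp h f') (funext h2)

variable (C)

/-- A promonoidal category (in the unenriched sense): the induced substitution functions are
bijective. -/
def IsPromonoidal : Prop :=
  ∀ {k : ℕ} {n : Fin k → ℕ} {N : ℕ} (A : ∀ i, Fin (n i) → C.Ob) (L : Fin N → C.Ob)
    (h : IsConcat A L) (c : C.Ob), Function.Bijective (inducedSubst h c)

end Multicategory

section Slot

variable {V : Type u'} [Category.{v'} V]

/-- The functor which is the identity if `p` holds and constant at `Z` otherwise. -/
abbrev slot (p : Prop) [Decidable p] (Z : V) : V ⥤ V :=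
  if p then 𝟭 V else (Functor.const V).obj Z

variable {p : Prop} [inst : Decidable p] {Z A A' A'' : V} {ev ev' : V ⥤ Type v}

/-- The element of the argument underlying an element of a slot filled with it. -/
def slotGet (h : p) : ev.obj ((slot p Z).obj A) → ev.obj A := by
  cases inst with
  | isTrue _ => exact id
  | isFalse h' => exact absurd h h'

/-- Change of the argument of a slot, on elements. -/
def slotMap (e : p → ev.obj A → ev.obj A') :
    ev.obj ((slot p Z).obj A) → ev.obj ((slot p Z).obj A') := by
  cases inst with
  | isTrue h => exact e h
  | isFalse _ => exact id

theorem slotMap_congr {e e' : p → ev.obj A → ev.obj A'} {v : ev.obj ((slot p Z).obj A)}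
    (h : ∀ hp, e hp (slotGet hp v) = e' hp (slotGet hp v)) : slotMap e v = slotMap e' v := by
  cases inst with
  | isTrue hp => exact h hp
  | isFalse _ => rfl

theorem slot_map (f : A ⟶ A') (v : ev.obj ((slot p Z).obj A)) :
    ev.map ((slot p Z).map f) v = slotMap (fun _ => ev.map f) v := by
  cases inst with
  | isTrue hp => rfl
  | isFalse _ => exact congrArg (fun g => g v) (ev.map_id Z)

theorem slotMap_slotMap (e : p → ev.obj A → ev.obj A') (e' : p → ev.obj A' → ev.obj A'')
    (v : ev.obj ((slot p Z).obj A)) :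
    slotMap e' (slotMap e v) = slotMap (fun h x => e' h (e h x)) v := by
  cases inst <;> rfl

theorem slotGet_slotMap (e : p → ev.obj A → ev.obj A') (h : p) (v : ev.obj ((slot p Z).obj A)) :
    slotGet h (slotMap e v) = e h (slotGet h v) := by
  cases inst with
  | isTrue hp => rfl
  | isFalse h' => exact absurd h h'

theorem slotGet_slot_map (f : A ⟶ A') (h : p) (v : ev.obj ((slot p Z).obj A)) :
    slotGet h (ev.map ((slot p Z).map f) v) = ev.map f (slotGet h v) := by
  rw [slot_map, slotGet_slotMap]

theorem slotMap_id (v : ev.obj ((slot p Z).obj A)) : slotMap (fun _ x => x) v = v := by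
  cases inst <;> rfl

theorem slotGet_app (τ : ev ⟶ ev') (h : p) (v : ev.obj ((slot p Z).obj A)) :
    slotGet h (τ.app _ v) = τ.app _ (slotGet h v) := by
  cases inst with
  | isTrue hp => rfl
  | isFalse h' => exact absurd h h'

theorem slotMap_app (τ : ev ⟶ ev') {e : p → ev.obj A → ev.obj A'} {e' : p → ev'.obj A → ev'.obj A'}
    {v : ev.obj ((slot p Z).obj A)}
    (h : ∀ hp, τ.app _ (e hp (slotGet hp v)) = e' hp (τ.app _ (slotGet hp v))) :
    τ.app _ (slotMap e v) = slotMap e' (τ.app _ v) := by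
  cases inst with
  | isTrue hp => exact h hp
  | isFalse _ => rfl

end Slot

namespace Multicategory

variable {C : Multicategory.{u}}

section Coproduct

/-- Evaluation of families at an object. -/
abbrev familyEval (d : C.Ob) : (C.Ob → Type u) ⥤ Type u := Pi.eval _ d

variable {n : ℕ} (X : Fin n → C.Ob → Type u) (i : Fin n)

/-- The representable family at `d`. -/
def unitFamily (d : C.Ob) : C.Ob → Type u := fun c => ULift (PLift (d = c))

/-- The map out of a representable family given by an element. -/
def unitFamilyHom {A : C.Ob → Type u} {d : C.Ob} (x : A d) : unitFamily d ⟶ A :=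
  fun _ => TypeCat.ofHom fun h => h.down.down ▸ x

/-- The mate, for the variable functors of `E`, of a map out of a family. -/
noncomputable def multitensorMateInv {A B : C.Ob → Type u}
    (ψ : ∀ d, A d → ((C.multitensor.variableFunctor X i).obj (unitFamily d) ⟶ B)) :
    (C.multitensor.variableFunctor X i).obj A ⟶ B := fun c =>
  TypeCat.ofHom fun (z : C.Pt (fun j => (slot (j = i) (X j)).obj A) c) =>
    ψ (z.inp i) (slotGet (Z := X i) (ev := familyEval (z.inp i)) (rfl : i = i) (z.val i)) c
      (⟨z.inp, z.op, fun j => slotMap (ev := familyEval (z.inp j)) (Z := X j) (A := A)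
        (A' := unitFamily (z.inp i)) (p := j = i) (fun h _ => ⟨⟨by rw [h]⟩⟩) (z.val j)⟩ :
        C.Pt (fun j => (slot (j = i) (X j)).obj (unitFamily (z.inp i))) c)

/-- Maps out of a variable functor of `E` correspond to maps into a right adjoint. -/
noncomputable def multitensorHomEquiv (A B : C.Ob → Type u) :
    ((C.multitensor.variableFunctor X i).obj A ⟶ B) ≃
      (A ⟶ fun d => (C.multitensor.variableFunctor X i).obj (unitFamily d) ⟶ B) where
  toFun φ := fun d => TypeCat.ofHom fun x =>
    (C.multitensor.variableFunctor X i).map (unitFamilyHom x) ≫ φ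
  invFun ψ := multitensorMateInv X i fun d x => ψ d x
  left_inv φ := by
    refine funext fun c => ConcreteCategory.hom_ext _ _ fun z => ?_
    change C.Pt (fun j => (slot (j = i) (X j)).obj A) c at z
    refine congrArg (φ c) (congrArg (Pt.mk z.inp z.op) (funext fun j => ?_) :
      _ = (z : C.Pt (fun j => (slot (j = i) (X j)).obj A) c))
    refine (slot_map (ev := familyEval (z.inp j)) _ _).trans ((slotMap_slotMap _ _ _).trans
      ((slotMap_congr fun h => ?_).trans (slotMap_id (ev := familyEval (z.inp j)) _)))
    subst h
    rfl
  right_inv ψ := by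
    refine funext fun d => ConcreteCategory.hom_ext _ _ fun x => ?_
    refine funext fun c => ConcreteCategory.hom_ext _ _ fun z => ?_
    change C.Pt (fun j => (slot (j = i) (X j)).obj (unitFamily d)) c at z
    have key : ∀ (e : C.Ob) (y : A e) (hd : e = z.inp i) (hde : d = e) (_ : hde ▸ x = y),
        ψ e y c (⟨z.inp, z.op, fun j => slotMap (ev := familyEval (z.inp j))
          (A' := unitFamily e) (fun h _ => ⟨⟨by rw [h, hd]⟩⟩) (z.val j)⟩ :
          C.Pt (fun j => (slot (j = i) (X j)).obj (unitFamily e)) c) = ψ d x c z := by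
      rintro e y hd rfl rfl
      refine congrArg (ψ d x c) (congrArg (Pt.mk z.inp z.op) (funext fun j => ?_) :
        _ = (z : C.Pt (fun j => (slot (j = i) (X j)).obj (unitFamily d)) c))
      exact (slotMap_congr fun h => rfl).trans (slotMap_id (ev := familyEval (z.inp j)) _)
    refine Eq.trans ?_ (key (z.inp i)
      (slotGet (ev := familyEval (z.inp i)) (Z := X i) (rfl : i = i)
        ((familyEval (z.inp i)).map ((slot (i = i) (X i)).map (unitFamilyHom x)) (z.val i))) rfl
      (slotGet (ev := familyEval (z.inp i)) (Z := X i) (rfl : i = i) (z.val i)).down.down ?_)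
    · refine congrArg (ψ (z.inp i) _ c) (congrArg (Pt.mk z.inp z.op) (funext fun j => ?_))
      refine (congrArg (slotMap _) (slot_map (ev := familyEval (z.inp j)) _ _)).trans
        ((slotMap_slotMap _ _ _).trans (slotMap_congr fun h => rfl))
    · exact (slotGet_slot_map (ev := familyEval (z.inp i)) (p := i = i) (Z := X i)
        (unitFamilyHom x) rfl (z.val i)).symm

instance multitensor_variableFunctor_isLeftAdjoint :
    (C.multitensor.variableFunctor X i).IsLeftAdjoint :=
  (Adjunction.adjunctionOfEquivRight (multitensorHomEquiv X i) (by
    intro A' A B f g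
    refine funext fun d => ConcreteCategory.hom_ext _ _ fun x => ?_
    have : unitFamilyHom x ≫ f = unitFamilyHom (f d x) := by
      refine funext fun c => ConcreteCategory.hom_ext _ _ ?_
      rintro ⟨⟨rfl⟩⟩
      rfl
    change (C.multitensor.variableFunctor X i).map (unitFamilyHom x) ≫
      (C.multitensor.variableFunctor X i).map f ≫ g =
        (C.multitensor.variableFunctor X i).map (unitFamilyHom (f d x)) ≫ g
    rw [← this, Functor.map_comp, Category.assoc])).isLeftAdjoint

end Coproduct

theorem multitensor_isCocomplete (C : Multicategory.{u}) : C.multitensor.IsCocomplete :=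
  fun _ _ => inferInstance

section Coend

open Opposite

/-- Evaluation of functors at an object. -/
abbrev linEval (d : C.Lin) : (C.Lin ⥤ Type u) ⥤ Type u := (evaluation _ _).obj d

variable {n : ℕ} (X : Fin n → C.Lin ⥤ Type u) (i : Fin n)

/-- The right adjoint, on objects, of a variable functor of the convolution. -/
noncomputable def convolutionRightAdjoint (B : C.Lin ⥤ Type u) : C.Lin ⥤ Type u :=
  opOp _ ⋙ (coyoneda ⋙ C.convolution.variableFunctor X i).op ⋙ yoneda.obj B

theorem slotMap_linEval_map {p : Prop} [Decidable p] {Z A A' : C.Lin ⥤ Type u} {a b : C.Lin}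
    (f : a ⟶ b) {e : p → A.obj a → A'.obj a} {e' : p → A.obj b → A'.obj b}
    {v : ((slot p Z).obj A).obj a}
    (h : ∀ hp, A'.map f (e hp (slotGet (ev := linEval a) hp v)) =
      e' hp (A.map f (slotGet (ev := linEval a) hp v))) :
    ((slot p Z).obj A').map f (slotMap (ev := linEval a) e v) =
      slotMap (ev := linEval b) e' (((slot p Z).obj A).map f v) :=
  slotMap_app ((evaluation C.Lin (Type u)).map f) h

/-- The element of `∐ (C_1, ..., C_n), C(C_1, ..., C_n; c) × ∏ j, X_j(C_j)` obtained by replacing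
the `i`-th entry by an identity. -/
noncomputable def unitAt {A : C.Lin ⥤ Type u} {c : C.Ob}
    (z : C.Pt (fun j => ((slot (j = i) (X j)).obj A).obj) c) :
    C.Pt (fun j => ((slot (j = i) (X j)).obj (coyoneda.obj (op (z.inp i : C.Lin)))).obj) c :=
  ⟨z.inp, z.op, fun j => slotMap (ev := linEval (z.inp j)) (Z := X j) (A := A)
    (A' := coyoneda.obj (op (z.inp i : C.Lin))) (p := j = i)
    (fun h _ => eqToHom (congrArg z.inp h.symm : (z.inp i : C.Lin) = z.inp j)) (z.val j)⟩

/-- The mate, for the variable functors of `F`, of a natural map into the right adjoint. -/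
noncomputable def convolutionMateInv {A B : C.Lin ⥤ Type u}
    (ψ : A ⟶ convolutionRightAdjoint X i B) :
    (C.convolution.variableFunctor X i).obj A ⟶ B where
  app c := TypeCat.ofHom (Quot.lift
    (fun (z : C.Pt (fun j => ((slot (j = i) (X j)).obj A).obj) c) =>
      NatTrans.app (ψ.app (z.inp i)
        (slotGet (Z := X i) (ev := linEval (z.inp i)) (rfl : i = i) (z.val i))) c
        (Quot.mk _ (unitAt X i z))) (by
    rintro z z' ⟨f, h1, h2⟩
    have h3 : slotGet (Z := X i) (ev := linEval (z'.inp i)) (rfl : i = i) (z'.val i) =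
        A.map (f i) (slotGet (Z := X i) (ev := linEval (z.inp i)) (rfl : i = i) (z.val i)) := by
      rw [← h2 i]
      exact slotGet_app ((evaluation C.Lin (Type u)).map (f i)) rfl (z.val i)
    let fi : @Quiver.Hom C.Lin _ (z.inp i) (z'.inp i) := f i
    set x := slotGet (Z := X i) (ev := linEval (z.inp i)) (rfl : i = i) (z.val i)
    rw [h3]
    have h4 := congrArg (fun g => g x) (ψ.naturality fi)
    change ψ.app (z'.inp i) (A.map (f i) x) =
      (C.convolution.variableFunctor X i).map (coyoneda.map fi.op) ≫
        ψ.app (z.inp i) x at h4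
    rw [h4]
    refine congrArg (NatTrans.app (ψ.app (z.inp i) x) c) (Quot.sound ⟨f, h1, fun j => ?_⟩)
    refine (slotMap_linEval_map (f j) (e' := fun h _ => fi ≫ eqToHom (congrArg z'.inp h.symm : (z'.inp i : C.Lin) = z'.inp j)) ?_).trans ?_
    · rintro rfl
      exact (Category.id_comp fi).trans (Category.comp_id fi).symm
    · refine Eq.symm ((slot_map (ev := linEval (z'.inp j)) _ _).trans ((slotMap_slotMap _ _ _).trans ?_))
      exact congrArg _ (h2 j).symm))
  naturality c d g := by
    refine ConcreteCategory.hom_ext _ _ fun z => ?_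
    obtain ⟨z, rfl⟩ := Quot.exists_rep z
    exact (NatTrans.naturality_apply (ψ.app (z.inp i) _) g (Quot.mk _ (unitAt X i z)))

/-- Maps out of a variable functor of `F` correspond to maps into the right adjoint. -/
noncomputable def convolutionHomEquiv (A B : C.Lin ⥤ Type u) :
    ((C.convolution.variableFunctor X i).obj A ⟶ B) ≃ (A ⟶ convolutionRightAdjoint X i B) where
  toFun φ :=
    { app d := TypeCat.ofHom fun x =>
        (C.convolution.variableFunctor X i).map (coyonedaEquiv.symm x) ≫ φ
      naturality d e f := by
        refine ConcreteCategory.hom_ext _ _ fun x => ?_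
        have : coyoneda.map f.op ≫ coyonedaEquiv.symm x = coyonedaEquiv.symm (A.map f x) := by
          ext c g
          exact congrArg (fun h => h x) (A.map_comp f g)
        change (C.convolution.variableFunctor X i).map (coyonedaEquiv.symm (A.map f x)) ≫ φ =
          (C.convolution.variableFunctor X i).map (coyoneda.map f.op) ≫
            (C.convolution.variableFunctor X i).map (coyonedaEquiv.symm x) ≫ φ
        rw [← this, Functor.map_comp, Category.assoc] }
  invFun ψ := convolutionMateInv X i ψ
  left_inv φ := by
    ext c z
    obtain ⟨z, rfl⟩ := Quot.exists_rep z
    change C.Pt (fun j => ((slot (j = i) (X j)).obj A).obj) c at z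
    refine congrArg (φ.app c) (congrArg (Quot.mk _) (congrArg (Pt.mk z.inp z.op)
      (funext fun j => ?_) : _ = (z : C.Pt (fun j => ((slot (j = i) (X j)).obj A).obj) c)))
    refine (slot_map (ev := linEval (z.inp j)) _ _).trans ((slotMap_slotMap _ _ _).trans
      ((slotMap_congr fun h => ?_).trans (slotMap_id (ev := linEval (z.inp j)) _)))
    subst h
    exact congrArg (fun g : A.obj (z.inp j) ⟶ A.obj (z.inp j) =>
      g (slotGet (Z := X j) (ev := linEval (z.inp j)) (rfl : j = j) (z.val j))) (A.map_id (z.inp j))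
  right_inv ψ := by
    ext d x
    refine NatTrans.ext (funext fun c => ConcreteCategory.hom_ext _ _ fun z => ?_)
    obtain ⟨z, rfl⟩ := Quot.exists_rep z
    change C.Pt (fun j => ((slot (j = i) (X j)).obj (coyoneda.obj (op d))).obj) c at z
    let g : d ⟶ (z.inp i : C.Lin) :=
      slotGet (Z := X i) (ev := linEval (z.inp i)) (rfl : i = i) (z.val i)
    let z' : C.Pt (fun j => ((slot (j = i) (X j)).obj A).obj) c :=
      z.map fun j e => ((slot (j = i) (X j)).map (coyonedaEquiv.symm x)).app e
    have h3 : slotGet (Z := X i) (ev := linEval (z.inp i)) (rfl : i = i) (z'.val i) =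
        A.map g x := by
      exact slotGet_slot_map (ev := linEval (z.inp i)) _ _ _
    have h4 := congrArg (fun h => h x) (ψ.naturality g)
    change ψ.app (z.inp i) (A.map g x) =
      (C.convolution.variableFunctor X i).map (coyoneda.map g.op) ≫ ψ.app d x at h4
    change NatTrans.app (ψ.app (z.inp i)
        (slotGet (Z := X i) (ev := linEval (z.inp i)) (rfl : i = i) (z'.val i))) c
        (Quot.mk _ (unitAt X i z')) = _
    rw [h3, h4]
    refine congrArg (NatTrans.app (ψ.app d x) c) (congrArg (Quot.mk _) (congrArg (Pt.mk z.inp z.op)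
      (funext fun j => ?_) :
        _ = (z : C.Pt (fun j => ((slot (j = i) (X j)).obj (coyoneda.obj (op d))).obj) c)))
    refine (slot_map (ev := linEval (z.inp j)) _ _).trans ((slotMap_slotMap _ _ _).trans ?_)
    refine (congrArg _ (slot_map (ev := linEval (z.inp j)) _ _)).trans ?_
    refine (slotMap_slotMap _ _ _).trans
      ((slotMap_congr fun h => ?_).trans (slotMap_id (ev := linEval (z.inp j)) _))
    subst h
    exact Category.comp_id g

instance convolution_variableFunctor_isLeftAdjoint :
    (C.convolution.variableFunctor X i).IsLeftAdjoint :=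
  (Adjunction.adjunctionOfEquivRight (convolutionHomEquiv X i) (by
    intro A' A B f g
    ext d x
    have : coyonedaEquiv.symm x ≫ f = coyonedaEquiv.symm (f.app d x) := by
      ext c h
      exact (NatTrans.naturality_apply f h x)
    change (C.convolution.variableFunctor X i).map (coyonedaEquiv.symm x) ≫
      (C.convolution.variableFunctor X i).map f ≫ g =
        (C.convolution.variableFunctor X i).map (coyonedaEquiv.symm (f.app d x)) ≫ g
    rw [← this, Functor.map_comp, Category.assoc])).isLeftAdjoint

end Coend

theorem convolution_isCocomplete (C : Multicategory.{u}) : C.convolution.IsCocomplete :=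
  fun _ _ => inferInstance

end Multicategory

namespace IsConcat

theorem card_eq {α : Type w} {k : ℕ} {n : Fin k → ℕ} {N : ℕ}
    {X : ∀ i : Fin k, Fin (n i) → α} {Y : Fin N → α} (h : IsConcat X Y) : N = ∑ i, n i := by
  have := congrArg List.length h
  simpa [List.sum_ofFn] using this

theorem injective {α : Type w} {k : ℕ} {n : Fin k → ℕ} {N : ℕ}
    {X X' : ∀ i : Fin k, Fin (n i) → α} {Y : Fin N → α} (h : IsConcat X Y) (h' : IsConcat X' Y) :
    X = X' := by
  obtain ⟨pos, h1, -⟩ := h.exists_pos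
  have h2 := (h1.map fun s => X s.1 s.2).unique h
  have h3 := (h1.map fun s => X' s.1 s.2).unique h'
  funext i j
  have h4 : (⟨i, j⟩ : Σ i, Fin (n i)) ∈ List.ofFn pos := by
    rw [h1]
    simp
  obtain ⟨a, ha⟩ := (List.mem_ofFn' _ _).1 h4
  have h5 := (congrFun h2 a).trans (congrFun h3 a).symm
  rw [ha] at h5
  exact h5

/-- A sequence over a concatenation is itself a concatenation. -/
theorem exists_split {α : Type w} (B : α → Type v) {k : ℕ} {n : Fin k → ℕ} {N : ℕ}
    {X : ∀ i : Fin k, Fin (n i) → α} {Y : Fin N → α} (h : IsConcat X Y) (y : ∀ a, B (Y a)) :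
    ∃ x : ∀ i j, B (X i j),
      IsConcat (fun i j => (⟨X i j, x i j⟩ : Σ a, B a)) (fun a => ⟨Y a, y a⟩) := by
  obtain ⟨pos, h1, h2⟩ := h.exists_pos
  have hsurj : Function.Surjective pos := by
    rintro ⟨i, j⟩
    have h4 : (⟨i, j⟩ : Σ i, Fin (n i)) ∈ List.ofFn pos := by
      rw [h1]
      simp
    exact (List.mem_ofFn' _ _).1 h4
  have hbij : Function.Bijective pos :=
    (Fintype.bijective_iff_surjective_and_card pos).2 ⟨hsurj, by simpa using h.card_eq⟩
  let e := Equiv.ofBijective pos hbij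
  have h3 : ∀ i j, Y (e.symm ⟨i, j⟩) = X i j := fun i j => by
    rw [← h2]
    have : pos (e.symm ⟨i, j⟩) = ⟨i, j⟩ := e.apply_symm_apply _
    rw [this]
  refine ⟨fun i j => h3 i j ▸ y (e.symm ⟨i, j⟩), ?_⟩
  have h5 : (fun i j => (⟨X i j, h3 i j ▸ y (e.symm ⟨i, j⟩)⟩ : Σ a, B a)) =
      fun i j => ⟨Y (e.symm ⟨i, j⟩), y (e.symm ⟨i, j⟩)⟩ := by
    funext i j
    have : ∀ (z : α) (hz : Y (e.symm ⟨i, j⟩) = z), (⟨z, hz ▸ y (e.symm ⟨i, j⟩)⟩ : Σ a, B a) =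
        ⟨Y (e.symm ⟨i, j⟩), y (e.symm ⟨i, j⟩)⟩ := by
      rintro z rfl
      rfl
    exact this _ _
  rw [h5]
  have h6 := h1.map fun s => (⟨Y (e.symm s), y (e.symm s)⟩ : Σ a, B a)
  have h7 : ∀ a, e.symm (pos a) = a := fun a => e.symm_apply_apply a
  have h8 : (fun a => (⟨Y (e.symm (pos a)), y (e.symm (pos a))⟩ : Σ a, B a)) =
      fun a => ⟨Y a, y a⟩ :=
    funext fun a => congrArg (fun b => (⟨Y b, y b⟩ : Σ a, B a)) (h7 a)
  exact h8 ▸ h6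

end IsConcat

namespace Multicategory

variable {C : Multicategory.{u}}

theorem action_rel {X : C.Lin ⥤ Type u} {c : C.Ob} {p q : C.Pt (fun _ : Fin 1 => X.obj) c}
    (h : C.Rel (fun _ : Fin 1 => X) c p q) : action X c p = action X c q := by
  obtain ⟨a, f, x, rfl⟩ := Pt.exists_unary p
  obtain ⟨b, g, y, rfl⟩ := Pt.exists_unary q
  obtain ⟨e, h1, h2⟩ := h
  have h3 : f = post g (e 0) := h1.trans
    (congrArg (pre (A := fun _ => a) (B := fun _ => b) g)
      (funext fun i => by rw [Subsingleton.elim i 0]))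
  have h4 : X.map (e 0) x = y := h2 0
  change X.map (X := a) (Y := c) f x = X.map (X := b) (Y := c) g y
  rw [h3, ← h4]
  exact congrArg (fun g => g x) (X.map_comp (X := a) (Y := b) (Z := c) (e 0) g)

/-- The unary convolution product is the identity. -/
theorem convolution_isFunctorOperad (C : Multicategory.{u}) :
    C.convolution.IsFunctorOperad := by
  intro X
  have : ∀ c, IsIso ((C.convolution.u X).app c) := by
    intro c
    rw [isIso_iff_bijective]
    constructor
    · intro x y hxy
      have := congrArg (Quot.lift (action X c) fun _ _ => action_rel) hxy
      have h1 : ∀ x : X.obj c, action X c ⟨fun _ => c, C.id c, fun _ => x⟩ = x := fun x =>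
        congrArg (fun g => g x) (X.map_id c)
      exact (h1 x).symm.trans (this.trans (h1 y))
    · intro p
      obtain ⟨p, rfl⟩ := Quot.exists_rep p
      obtain ⟨a, f, x, rfl⟩ := Pt.exists_unary p
      refine ⟨X.map (X := a) (Y := c) f x, (Quot.sound ⟨fun _ => f, ?_, fun _ => rfl⟩ :
        Quot.mk (C.Rel (fun _ : Fin 1 => X) c) ⟨fun _ => a, f, fun _ => x⟩ =
          Quot.mk (C.Rel (fun _ : Fin 1 => X) c)
            ⟨fun _ => c, C.id c, fun _ => X.map (X := a) (Y := c) f x⟩).symm⟩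
      exact (C.id_comp f).symm
  exact NatIso.isIso_of_isIso_app _

/-- The functor `C_l ⥤ Set` given by an algebra of the unary part of `E`. -/
def functorOfAlgebra (X : C.multitensor.unary.Algebra) : C.Lin ⥤ Type u where
  obj := X.A
  map {a b} f := TypeCat.ofHom fun x => X.a b (⟨fun _ => a, f, fun _ => x⟩ : C.Pt (fun _ => X.A) b)
  map_id a := by
    ext x
    exact congrArg (fun g => g a x) X.unit
  map_comp {a b c} f g := by
    ext x
    have := congrArg (fun h => h c (⟨fun _ => b, g, fun _ => ⟨fun _ => a, f, fun _ => x⟩⟩ :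
      C.Pt (fun _ : Fin 1 => fun d => C.Pt (fun _ : Fin 1 => X.A) d) c)) X.assoc
    refine Eq.trans ?_ this
    exact congrArg (X.a c) (Pt.subst_unary g f x _).symm

theorem action_functorOfAlgebra (X : C.multitensor.unary.Algebra) (c : C.Ob)
    (p : C.Pt (fun _ : Fin 1 => X.A) c) : action (functorOfAlgebra X) c p = X.a c p := by
  obtain ⟨a, f, x, rfl⟩ := Pt.exists_unary p
  rfl

instance comparison_faithful : C.comparison.Faithful where
  map_injective {X Y f g} h := by
    ext c x
    exact congrArg (fun e : C.comparison.obj X ⟶ C.comparison.obj Y => e.f c x) h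

instance comparison_full : C.comparison.Full where
  map_surjective {X Y} h := by
    refine ⟨{ app := fun c => h.f c, naturality := fun a c g => ?_ }, rfl⟩
    ext x
    exact (congrArg (fun e => e c (⟨fun _ => a, g, fun _ => x⟩ :
      C.Pt (fun _ : Fin 1 => X.obj) c)) h.h).symm

instance comparison_essSurj : C.comparison.EssSurj where
  mem_essImage X := ⟨functorOfAlgebra X, ⟨Monad.Algebra.isoMk (Iso.refl X.A) (by
    funext c
    ext p
    exact (action_functorOfAlgebra X c p).symm)⟩⟩

instance comparison_isEquivalence : C.comparison.IsEquivalence where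

/-- The map `C(A_1, ..., A_n; -) ⟶ F(X_1, ..., X_n)` given by elements of the `X_i(A_i)`. -/
def corepHom {n : ℕ} {A : Fin n → C.Ob} {X : Fin n → C.Lin ⥤ Type u} (x : ∀ i, (X i).obj (A i)) :
    corep A ⟶ convObj X where
  app _ := TypeCat.ofHom fun f => Quot.mk _ ⟨A, f, x⟩
  naturality _ _ _ := rfl

/-- Precomposition with linear maps, as a map of corepresentable functors. -/
def corepPre {n : ℕ} {A B : Fin n → C.Ob} (g : ∀ i, C.Hom (fun _ : Fin 1 => A i) (B i)) :
    corep B ⟶ corep A where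
  app c := TypeCat.ofHom fun f => pre f g
  naturality _ _ h := by
    ext f
    exact (post_comp _ h f g).symm

theorem corepPre_comp_corepHom {n : ℕ} {A B : Fin n → C.Ob} {X : Fin n → C.Lin ⥤ Type u}
    (g : ∀ i, C.Hom (fun _ : Fin 1 => A i) (B i)) (x : ∀ i, (X i).obj (A i)) :
    corepPre g ≫ corepHom x = corepHom fun i => (X i).map (g i) (x i) := by
  ext c f
  exact Quot.sound ⟨g, rfl, fun _ => rfl⟩

theorem inducedSubst_map_corepPre {k : ℕ} {n : Fin k → ℕ} {N : ℕ} {A A' : ∀ i, Fin (n i) → C.Ob}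
    {L L' : Fin N → C.Ob} (h : IsConcat A L) (h' : IsConcat A' L')
    (g : ∀ i j, C.Hom (fun _ : Fin 1 => A i j) (A' i j))
    (g' : ∀ a, C.Hom (fun _ : Fin 1 => L a) (L' a))
    (hg : IsConcat (fun i j => (⟨A i j, A' i j, g i j⟩ :
        Σ (a b : C.Ob), C.Hom (fun _ : Fin 1 => a) b)) (fun a => ⟨L a, L' a, g' a⟩))
    (c : C.Ob) (z : C.Coend (fun i => corep (A' i)) c) :
    inducedSubst h c (((conv C k).map fun i => corepPre (g i)).app c z) =
      pre (inducedSubst h' c z) g' := by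
  obtain ⟨p, rfl⟩ := Quot.exists_rep z
  exact comp_pre h h' p.op p.val g g' hg

/-- The splitting of an element of the coproduct along a decomposition of its index. -/
theorem Pt.exists_split {k : ℕ} {n : Fin k → ℕ} {N : ℕ} {X : ∀ i, Fin (n i) → C.Lin ⥤ Type u}
    {Y : Fin N → C.Lin ⥤ Type u} (h : IsConcat X Y) {c : C.Ob}
    (p : C.Pt (fun a => (Y a).obj) c) : ∃ s : ∀ i j, Σ d : C.Ob, (X i j).obj d,
      IsConcat (fun i j => (⟨X i j, s i j⟩ : Σ (Z : C.Lin ⥤ Type u) (d : C.Ob), Z.obj d))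
        (fun a => ⟨Y a, p.pair a⟩) :=
  h.exists_split (fun Z => Σ d : C.Ob, Z.obj d) p.pair

section Promonoidal

variable {k : ℕ} {n : Fin k → ℕ} {N : ℕ} {X : ∀ i, Fin (n i) → C.Lin ⥤ Type u}
    {Y : Fin N → C.Lin ⥤ Type u}

/-- `z` corresponds to the class of `p` under substitution. -/
def Desubst (c : C.Ob) (p : C.Pt (fun a => (Y a).obj) c) (z : C.Coend (fun i => convObj (X i)) c) :
    Prop :=
  ∃ (s : ∀ i j, Σ d : C.Ob, (X i j).obj d)
    (hs : IsConcat (fun i j => (⟨X i j, s i j⟩ : Σ (Z : C.Lin ⥤ Type u) (d : C.Ob), Z.obj d))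
      (fun a => ⟨Y a, p.pair a⟩)) (z' : C.Coend (fun i => corep fun j => (s i j).1) c),
    inducedSubst (hs.map fun t => t.2.1) c z' = p.op ∧
      ((conv C k).map fun i => corepHom fun j => (s i j).2).app c z' = z

theorem Desubst.convSubst (h : IsConcat X Y) {c : C.Ob} {p : C.Pt (fun a => (Y a).obj) c}
    {z : C.Coend (fun i => convObj (X i)) c} (hz : Desubst c p z) :
    Multicategory.convSubst h c z = Quot.mk _ p := by
  obtain ⟨s, hs, z', h1, rfl⟩ := hz
  obtain ⟨r, rfl⟩ := Quot.exists_rep z'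
  refine (convSubst_mk h r.op fun i => ⟨fun j => (s i j).1, r.val i, fun j => (s i j).2⟩).trans ?_
  refine congrArg (Quot.mk _) ((Pt.subst_eq (h.map fun Z => Z.obj) r.op
    (fun i => ⟨fun j => (s i j).1, r.val i, fun j => (s i j).2⟩) p.pair
    (hs.map fun t => (⟨t.1.obj, t.2⟩ : Σ Z : C.Ob → Type u, Σ d, Z d))).trans ?_)
  exact congrArg (fun o => (⟨p.inp, o, p.val⟩ : C.Pt (fun a => (Y a).obj) c)) h1

theorem Desubst.mk (h : IsConcat X Y) {c : C.Ob} {B : Fin k → C.Ob} (f : C.Hom B c)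
    (r : ∀ i, C.Pt (fun j => (X i j).obj) (B i)) :
    Desubst c (Pt.subst (h.map fun Z => Z.obj) f r)
      (Quot.mk _ ⟨B, f, fun i => (Quot.mk _ (r i) : C.Coend (X i) (B i))⟩) := by
  let s := fun i j => (r i).pair j
  obtain ⟨s', hs'⟩ := Pt.exists_split h (Pt.subst (h.map fun Z => Z.obj) f r)
  have h1 := (hs'.map fun t => (⟨t.1.obj, t.2⟩ : Σ Z : C.Ob → Type u, Σ d, Z d)).injective
    (Pt.con_subst (h.map fun Z => Z.obj) f r)
  have h2 : s' = s := by
    funext i j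
    exact eq_of_heq (Sigma.mk.inj (congrFun (congrFun h1 i) j)).2
  subst h2
  exact ⟨s, hs', Quot.mk _ ⟨B, f, fun i => (r i).op⟩, rfl, rfl⟩

variable (hC : C.IsPromonoidal)
include hC

theorem Desubst.exists (h : IsConcat X Y) {c : C.Ob} (p : C.Pt (fun a => (Y a).obj) c) :
    ∃ z : C.Coend (fun i => convObj (X i)) c, Desubst c p z := by
  obtain ⟨s, hs⟩ := Pt.exists_split h p
  obtain ⟨z', hz'⟩ := (hC _ _ (hs.map fun t => t.2.1) c).2 p.op
  exact ⟨_, s, hs, z', hz', rfl⟩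

theorem Desubst.unique (h : IsConcat X Y) {c : C.Ob} {p q : C.Pt (fun a => (Y a).obj) c}
    {z w : C.Coend (fun i => convObj (X i)) c} (hpq : C.Rel Y c p q) (hz : Desubst c p z)
    (hw : Desubst c q w) : z = w := by
  obtain ⟨s, hs, z', h1, rfl⟩ := hz
  obtain ⟨t, ht, w', h2, rfl⟩ := hw
  obtain ⟨f, h3, h4⟩ := hpq
  let 𝔹 : (C.Lin ⥤ Type u) → Type u := fun Z =>
    Σ (a b : C.Ob), C.Hom (fun _ : Fin 1 => a) b × Z.obj a
  obtain ⟨x, hx⟩ := h.exists_split 𝔹 fun a => ⟨_, _, f a, p.val a⟩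
  have h5 : s = fun i j => ⟨(x i j).1, (x i j).2.2.2⟩ := by
    have := hs.injective (hx.map fun y =>
      (⟨y.1, y.2.1, y.2.2.2.2⟩ : Σ (Z : C.Lin ⥤ Type u) (d : C.Ob), Z.obj d))
    funext i j
    simpa using congrFun (congrFun this i) j
  have h6 : t = fun i j => ⟨(x i j).2.1, (X i j).map (x i j).2.2.1 (x i j).2.2.2⟩ := by
    have h7 := hx.map fun y =>
      (⟨y.1, y.2.2.1, y.1.map y.2.2.2.1 y.2.2.2.2⟩ : Σ (Z : C.Lin ⥤ Type u) (d : C.Ob), Z.obj d)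
    simp only [h4] at h7
    have := ht.injective h7
    funext i j
    simpa using congrFun (congrFun this i) j
  subst h5 h6
  have h8 : z' = ((conv C k).map fun i => corepPre fun j => (x i j).2.2.1).app c w' := by
    refine (hC _ _ (hs.map fun t => t.2.1) c).1 ?_
    rw [h1, h3, ← h2]
    exact (inducedSubst_map_corepPre _ _ _ _ (hx.map fun y => (⟨y.2.1, y.2.2.1, y.2.2.2.1⟩ :
      Σ (a b : C.Ob), C.Hom (fun _ : Fin 1 => a) b)) c w').symm
  rw [h8]
  obtain ⟨r, rfl⟩ := Quot.exists_rep w'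
  refine congrArg (fun v => Quot.mk _ (Pt.mk r.inp r.op v)) (funext fun i => ?_)
  exact congrArg (fun e : corep (fun j => (x i j).2.1) ⟶ convObj (X i) => e.app (r.inp i) (r.val i))
    (corepPre_comp_corepHom (fun j => (x i j).2.2.1) fun j => (x i j).2.2.2)

/-- The convolution of a promonoidal category is a monoidal structure. -/
theorem IsPromonoidal.convolution_isMonoidal : C.convolution.IsMonoidal := by
  refine ⟨convolution_isFunctorOperad C, fun X Y h => ?_⟩
  have : ∀ c, IsIso ((C.convolution.σ X Y h).app c) := by
    intro c
    rw [isIso_iff_bijective]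
    choose d hd using fun p => Desubst.exists hC h (c := c) p
    have hrel : ∀ p q, C.Rel Y c p q → d p = d q := fun p q hpq =>
      Desubst.unique hC h hpq (hd p) (hd q)
    refine Function.bijective_iff_has_inverse.2 ⟨Quot.lift d hrel, fun z => ?_, fun y => ?_⟩
    · obtain ⟨B, f, r, rfl⟩ := exists_rep z
      refine (congrArg (Quot.lift d hrel) (convSubst_mk h f r)).trans ?_
      exact Desubst.unique hC h (Rel.refl _) (hd _) (Desubst.mk h f r)
    · obtain ⟨p, rfl⟩ := Quot.exists_rep y
      exact (hd p).convSubst h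
  exact NatIso.isIso_of_isIso_app _

end Promonoidal

end Multicategory

section Interval

variable {n : ℕ}

/-- The sequence of indices `i, ..., j - 1`. -/
def interval (i j : Fin (n + 1)) : Fin (j - i : ℕ) → Fin n := fun l => ⟨l + i, by omega⟩

theorem map_val_ofFn_interval (i j : Fin (n + 1)) :
    (List.ofFn (interval i j)).map Fin.val = List.range' i (j - i) := by
  refine List.ext_getElem (by simp) fun m h1 h2 => ?_
  simp [interval, Nat.add_comm]

theorem flatten_range' : ∀ {k : ℕ} (x : Fin (k + 1) → ℕ) (_ : ∀ l : Fin k, x l.castSucc ≤ x l.succ),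
    x 0 ≤ x (Fin.last k) ∧
    (List.ofFn fun l : Fin k => List.range' (x l.castSucc) (x l.succ - x l.castSucc)).flatten =
      List.range' (x 0) (x (Fin.last k) - x 0)
  | 0, x, _ => by simp
  | k + 1, x, h => by
    obtain ⟨h1, h2⟩ := flatten_range' (fun l => x l.succ) fun l => h l.succ
    have h3 : x 0 ≤ x (Fin.succ 0) := h 0
    refine ⟨h3.trans h1, ?_⟩
    rw [List.ofFn_succ, List.flatten_cons]
    refine (congrArg _ h2).trans ?_
    change List.range' (x 0) (x (Fin.succ 0) - x 0) ++ List.range' (x (Fin.succ 0))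
      (x (Fin.last (k + 1)) - x (Fin.succ 0)) = _
    have h4 : x (Fin.succ 0) = x 0 + 1 * (x (Fin.succ 0) - x 0) := by omega
    have h5 : x (Fin.succ 0) ≤ x (Fin.last (k + 1)) := h1
    nth_rw 2 [h4]
    rw [List.range'_append]
    congr 1
    omega

theorem IsPath.le {k : ℕ} {a b : Fin (n + 1)} {s t : Fin k → Fin (n + 1)} (h : IsPath a b s t)
    (hst : ∀ l, s l ≤ t l) : a ≤ b := by
  obtain ⟨x, rfl, rfl, h1, h2⟩ := h
  refine (flatten_range' (fun l => (x l : ℕ)) fun l => ?_).1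
  have := hst l
  rw [h1, h2] at this
  exact this

theorem IsPath.isConcat_interval {k : ℕ} {a b : Fin (n + 1)} {s t : Fin k → Fin (n + 1)}
    (h : IsPath a b s t) (hst : ∀ l, s l ≤ t l) :
    IsConcat (fun l => interval (s l) (t l)) (interval a b) := by
  obtain ⟨x, rfl, rfl, h1, h2⟩ := h
  obtain rfl := funext h1
  obtain rfl := funext h2
  refine (List.map_injective_iff.2 Fin.val_injective) ?_
  rw [map_val_ofFn_interval, List.map_flatten, List.map_ofFn]
  refine (flatten_range' (fun l => (x l : ℕ)) hst).2.symm.trans ?_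
  congr 2
  funext l
  exact (map_val_ofFn_interval _ _).symm

theorem isConcat_interval_succ (l : Fin n) :
    IsConcat (fun _ _ : Fin 1 => l) (interval l.castSucc l.succ) := by
  refine (List.map_injective_iff.2 Fin.val_injective) ?_
  rw [map_val_ofFn_interval]
  simp

theorem isPath_interval {a b : Fin (n + 1)} (h : a ≤ b) :
    IsPath a b (fun m => (interval a b m).castSucc) (fun m => (interval a b m).succ) := by
  have h' : (a : ℕ) ≤ b := h
  refine ⟨fun m => ⟨m + a, by omega⟩, ?_, ?_, fun i => ?_, fun i => ?_⟩ <;> ext <;>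
    simp [interval] <;> omega

/-- The sequence of all steps of a sequence of objects. -/
theorem isPath_steps {O : Type w} (y : Fin (n + 1) → O) :
    IsPath (y 0) (y (Fin.last n)) (fun i => y i.castSucc) (fun i => y i.succ) :=
  ⟨y, rfl, rfl, fun _ => rfl, fun _ => rfl⟩

end Interval

namespace Multitensor

variable {W : Type u} [Category.{v} W]

theorem map_pi_comp (M : Multitensor W) {k : ℕ} {A B D : Fin k → W} (f : ∀ i, A i ⟶ B i)
    (g : ∀ i, B i ⟶ D i) :
    (M.T k).map (fun i => f i ≫ g i) = (M.T k).map f ≫ (M.T k).map g :=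
  (M.T k).map_comp f g

theorem map_pi_id (M : Multitensor W) {k : ℕ} (A : Fin k → W) :
    (M.T k).map (fun i => 𝟙 (A i)) = 𝟙 _ :=
  (M.T k).map_id A

/-- A tensor product with an initial factor is initial. -/
def PreservesInitial (M : Multitensor W) : Prop :=
  ∀ (n : ℕ) (X : Fin n → W) (i : Fin n), Limits.IsInitial (X i) →
    Nonempty (Limits.IsInitial ((M.T n).obj X))

theorem IsDistributive.preservesInitial {M : Multitensor W} (h : M.IsDistributive) :
    M.PreservesInitial := by
  intro n X i hi
  have := h X i PEmpty
  have : Limits.PreservesColimitsOfShape (Discrete PEmpty.{1}) (M.variableFunctor X i) :=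
    Limits.preservesColimitsOfShape_of_equiv
      (Discrete.equivalence (Equiv.equivPEmpty PEmpty.{v + 1})) _
  have h1 := hi.isInitialObj (M.variableFunctor X i)
  have h2 : (M.variableFunctor X i).obj (X i) = (M.T n).obj X := by
    refine congrArg (M.T n).obj (funext fun j => ?_)
    change (if j = i then 𝟭 W else (Functor.const W).obj (X j)).obj (X i) = X j
    split_ifs with hj
    · rw [hj]
      rfl
    · rfl
  exact ⟨h2 ▸ h1⟩

section Chain

variable (M : Multitensor W) [Limits.HasInitial W] {n : ℕ} (X : Fin n → W)

/-- The factors of the tensor product `M(X_{i+1}, ..., X_j)`. -/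
abbrev chainSeq (i j : Fin (n + 1)) : Fin (j - i : ℕ) → W := fun l => X (interval i j l)

/-- The object `M(X_{i+1}, ..., X_j)` if `i ≤ j`, and the initial object otherwise. -/
noncomputable def chainHom (i j : Fin (n + 1)) : W :=
  if i ≤ j then (M.T _).obj (chainSeq X i j) else ⊥_ W

/-- The map from a hom of the chain to the tensor product. -/
noncomputable def chainTo (i j : Fin (n + 1)) : M.chainHom X i j ⟶ (M.T _).obj (chainSeq X i j) :=
  if h : i ≤ j then eqToHom (if_pos h) else eqToHom (if_neg h) ≫ Limits.initial.to _

/-- The map from the tensor product to a hom of the chain. -/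
noncomputable def chainOf {i j : Fin (n + 1)} (h : i ≤ j) :
    (M.T _).obj (chainSeq X i j) ⟶ M.chainHom X i j :=
  eqToHom (if_pos h).symm

theorem chainTo_chainOf {i j : Fin (n + 1)} (h : i ≤ j) :
    M.chainTo X i j ≫ M.chainOf X h = 𝟙 _ := by
  rw [chainTo, dif_pos h]
  exact (eqToHom_trans _ _).trans (eqToHom_refl _ _)

theorem chainOf_chainTo {i j : Fin (n + 1)} (h : i ≤ j) :
    M.chainOf X h ≫ M.chainTo X i j = 𝟙 _ := by
  rw [chainTo, dif_pos h]
  exact (eqToHom_trans _ _).trans (eqToHom_refl _ _)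

/-- The backwards homs of the chain are initial. -/
noncomputable def chainInitial {i j : Fin (n + 1)} (h : ¬ i ≤ j) :
    Limits.IsInitial (M.chainHom X i j) :=
  Limits.initialIsInitial.ofIso (eqToIso (if_neg h).symm)

variable {M}
variable (hM : M.PreservesInitial)

/-- A tensor product of homs of the chain, one of which is backwards, is initial. -/
noncomputable def chainTensorInitial {k : ℕ} {s t : Fin k → Fin (n + 1)}
    (h : ¬ ∀ l, s l ≤ t l) :
    Limits.IsInitial ((M.T k).obj fun l => M.chainHom X (s l) (t l)) :=
  (hM k (fun l => M.chainHom X (s l) (t l)) _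
    (M.chainInitial X (not_forall.1 h).choose_spec)).some

open Classical in
/-- The composition of the chain. -/
noncomputable def chainComp {k : ℕ} {a b : Fin (n + 1)}
    {s t : Fin k → Fin (n + 1)} (h : IsPath a b s t) :
    ((M.T k).obj fun l => M.chainHom X (s l) (t l)) ⟶ M.chainHom X a b :=
  if hst : ∀ l, s l ≤ t l then
    (M.T k).map (fun l => M.chainTo X (s l) (t l)) ≫
      M.σ (fun l => chainSeq X (s l) (t l)) (chainSeq X a b) ((h.isConcat_interval hst).map X) ≫
      M.chainOf X (h.le hst)
  else (chainTensorInitial X hM hst).to _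

theorem chainComp_eq {k : ℕ} {a b : Fin (n + 1)}
    {s t : Fin k → Fin (n + 1)} (h : IsPath a b s t) (hst : ∀ l, s l ≤ t l) :
    chainComp X hM h = (M.T k).map (fun l => M.chainTo X (s l) (t l)) ≫
      M.σ (fun l => chainSeq X (s l) (t l)) (chainSeq X a b) ((h.isConcat_interval hst).map X) ≫
      M.chainOf X (h.le hst) := dif_pos hst

theorem chainComp_chainTo {k : ℕ} {a b : Fin (n + 1)}
    {s t : Fin k → Fin (n + 1)} (h : IsPath a b s t) (hst : ∀ l, s l ≤ t l) :
    chainComp X hM h ≫ M.chainTo X a b = (M.T k).map (fun l => M.chainTo X (s l) (t l)) ≫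
      M.σ (fun l => chainSeq X (s l) (t l)) (chainSeq X a b) ((h.isConcat_interval hst).map X) := by
  rw [chainComp_eq X hM h hst, Category.assoc, Category.assoc, chainOf_chainTo, Category.comp_id]

theorem chainComp_unit (a b : Fin (n + 1)) :
    M.u (M.chainHom X a b) ≫ chainComp X hM (IsPath.single a b) = 𝟙 _ := by
  by_cases h : a ≤ b
  · rw [chainComp_eq X hM _ fun _ => h]
    have h1 := M.u_naturality (M.chainTo X a b)
    have h2 := M.u_σ (chainSeq X a b)
    rw [← reassoc_of% h1, reassoc_of% h2, chainTo_chainOf]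
  · exact (M.chainInitial X h).hom_ext _ _

theorem chainComp_assoc {k : ℕ} {m : Fin k → ℕ} {N : ℕ} {a b : Fin (n + 1)}
    {s t : Fin k → Fin (n + 1)} (h : IsPath a b s t) {s' t' : ∀ i, Fin (m i) → Fin (n + 1)}
    (h' : ∀ i, IsPath (s i) (t i) (s' i) (t' i)) {S T : Fin N → Fin (n + 1)}
    (hS : IsConcat (fun i j => (s' i j, t' i j)) (fun l => (S l, T l))) (H : IsPath a b S T)
    (hc : IsConcat (fun i j => M.chainHom X (s' i j) (t' i j)) (fun l => M.chainHom X (S l) (T l))) :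
    M.σ (fun i j => M.chainHom X (s' i j) (t' i j)) (fun l => M.chainHom X (S l) (T l)) hc ≫
      chainComp X hM H = (M.T k).map (fun i => chainComp X hM (h' i)) ≫ chainComp X hM h := by
  by_cases hst : ∀ i j, s' i j ≤ t' i j
  · have h1 : ∀ i, s i ≤ t i := fun i => (h' i).le (hst i)
    have h2 : ∀ l, S l ≤ T l := by
      obtain ⟨pos, -, h3⟩ := hS.exists_pos
      intro l
      have := h3 l
      simp only [Prod.mk.injEq] at this
      rw [← this.1, ← this.2]
      exact hst _ _
    have h3 := M.σ_naturality (fun i j => M.chainTo X (s' i j) (t' i j))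
      (fun l => M.chainTo X (S l) (T l))
      (hS.map fun p : Fin (n + 1) × Fin (n + 1) => Arrow.mk (M.chainTo X p.1 p.2)) hc
      (hS.map fun p : Fin (n + 1) × Fin (n + 1) => (M.T (p.2 - p.1)).obj (chainSeq X p.1 p.2))
    have h4 := M.assoc (fun i j => chainSeq X (s' i j) (t' i j)) (fun i => chainSeq X (s i) (t i))
      (fun l => chainSeq X (S l) (T l)) (chainSeq X a b)
      (hS.map fun p : Fin (n + 1) × Fin (n + 1) =>
        (⟨p.2 - p.1, chainSeq X p.1 p.2⟩ : Σ m, Fin m → W))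
      (hS.map fun p : Fin (n + 1) × Fin (n + 1) => (M.T (p.2 - p.1)).obj (chainSeq X p.1 p.2))
      (fun i => ((h' i).isConcat_interval (hst i)).map X) ((h.isConcat_interval h1).map X)
      ((H.isConcat_interval h2).map X)
    rw [chainComp_eq X hM h h1, chainComp_eq X hM H h2, reassoc_of% h3, reassoc_of% h4,
      ← Category.assoc, ← Category.assoc ((M.T k).map fun i => chainComp X hM (h' i)),
      ← map_pi_comp, ← map_pi_comp]
    exact congrArg (fun f => (M.T k).map f ≫ _)
      (funext fun i => (chainComp_chainTo X hM (h' i) (hst i)).symm)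
  · obtain ⟨i, hi⟩ := not_forall.1 hst
    exact Limits.IsInitial.hom_ext (hM _ _ i (chainTensorInitial X hM hi)).some _ _

/-- The free category on a chain of objects `X_1, ..., X_n`: its objects are `0, ..., n`, and its
homs are `M(X_{i+1}, ..., X_j)` from `i` to `j` for `i ≤ j`. -/
noncomputable def chain : EnrichedCat.{w} M where
  graph := ⟨ULift.{w} (Fin (n + 1)), fun i j => M.chainHom X i.down j.down⟩
  comp h := chainComp X hM (h.map ULift.down)
  unit a b := chainComp_unit X hM a.down b.down
  assoc h _ _ h' _ _ hS H hc := chainComp_assoc X hM (h.map ULift.down)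
    (fun i => (h' i).map ULift.down)
    (hS.map fun p : ULift.{w} (Fin (n + 1)) × ULift.{w} (Fin (n + 1)) => (p.1.down, p.2.down))
    (H.map ULift.down) hc

/-- The map from a generator to the hom of the chain. -/
noncomputable def chainUnit (l : Fin n) : X l ⟶ M.chainHom X l.castSucc l.succ :=
  M.u _ ≫ M.u _ ≫ M.σ (fun _ _ => X l) (chainSeq X l.castSucc l.succ)
    ((isConcat_interval_succ l).map X) ≫ M.chainOf X (Fin.castSucc_lt_succ).le

/-- The map from the hom between the ends of the chain to the tensor product. -/
noncomputable def chainTotal : M.chainHom X 0 (Fin.last n) ⟶ (M.T n).obj X :=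
  M.chainTo X 0 (Fin.last n)

theorem map_chainUnit_comp_chainTotal :
    (M.T n).map (chainUnit X) ≫ chainComp X hM (isPath_steps fun i => i) ≫ chainTotal X = 𝟙 _ := by
  have hst : ∀ l : Fin n, l.castSucc ≤ l.succ := fun _ => (Fin.castSucc_lt_succ).le
  have h1 : ∀ l, chainUnit X l ≫ M.chainTo X l.castSucc l.succ =
      (M.u (X l) ≫ M.u _) ≫ M.σ (fun _ _ => X l) (chainSeq X l.castSucc l.succ)
        ((isConcat_interval_succ l).map X) := fun l => by
    simp only [chainUnit, Category.assoc, chainOf_chainTo, Category.comp_id]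
  have h0 : (M.T n).map (chainUnit X) ≫
      (M.T n).map (fun l => M.chainTo X l.castSucc l.succ) =
      (M.T n).map (fun l => M.u (X l)) ≫ (M.T n).map (fun l => M.u _) ≫
        (M.T n).map fun l => M.σ (fun _ _ => X l) (chainSeq X l.castSucc l.succ)
        ((isConcat_interval_succ l).map X) := by
    rw [← map_pi_comp, funext h1, map_pi_comp, map_pi_comp, Category.assoc]
  have h2 := M.assoc (fun l (_ _ : Fin 1) => X l) (fun l => chainSeq X l.castSucc l.succ)
    (fun l (_ : Fin 1) => X l) X (IsConcat.singles _) (IsConcat.singles _)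
    (fun l => (isConcat_interval_succ l).map X)
    (((isPath_steps fun i => i).isConcat_interval hst).map X) (IsConcat.singles X)
  have h3 := M.map_u_σ fun l => (M.T 1).obj fun _ => X l
  refine (congrArg (fun g => (M.T n).map (chainUnit X) ≫ g)
    (chainComp_chainTo X hM (isPath_steps fun i => i) hst)).trans ?_
  refine (Category.assoc _ _ _).symm.trans ((congrArg (· ≫ _) h0).trans ?_)
  refine (Category.assoc _ _ _).trans ((congrArg (_ ≫ ·) (Category.assoc _ _ _)).trans ?_)
  refine (congrArg (fun f => (M.T n).map (fun l => M.u (X l)) ≫ (M.T n).map (fun l => M.u _) ≫ f)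
    h2.symm).trans ?_
  refine (congrArg (fun f => (M.T n).map (fun l => M.u (X l)) ≫ f)
    ((Category.assoc _ _ _).symm.trans ((congrArg (· ≫ _) h3).trans (Category.id_comp _)))).trans ?_
  exact M.map_u_σ X

section Lift

variable {Y : EnrichedCat.{w} M} (y : Fin (n + 1) → Y.graph.Ob)
  (f : ∀ l : Fin n, X l ⟶ Y.graph.hom (y l.castSucc) (y l.succ))

/-- The composite of the images of the generators. -/
noncomputable def chainLiftMap (a b : Fin (n + 1)) : M.chainHom X a b ⟶ Y.graph.hom (y a) (y b) :=
  if h : a ≤ b then M.chainTo X a b ≫ (M.T _).map (fun m => f (interval a b m)) ≫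
    Y.comp ((isPath_interval h).map y)
  else (M.chainInitial X h).to _

theorem chainLiftMap_eq {a b : Fin (n + 1)} (h : a ≤ b) :
    chainLiftMap X y f a b = M.chainTo X a b ≫ (M.T _).map (fun m => f (interval a b m)) ≫
      Y.comp ((isPath_interval h).map y) := dif_pos h

theorem chainLiftMap_comm {k : ℕ} {a b : Fin (n + 1)} {s t : Fin k → Fin (n + 1)}
    (h : IsPath a b s t) : chainComp X hM h ≫ chainLiftMap X y f a b =
      (M.T k).map (fun i => chainLiftMap X y f (s i) (t i)) ≫ Y.comp (h.map y) := by
  by_cases hst : ∀ i, s i ≤ t i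
  · have h1 := h.isConcat_interval hst
    have h2 := M.σ_naturality (fun i j => f (interval (s i) (t i) j)) (fun m => f (interval a b m))
      (h1.map fun l => Arrow.mk (f l)) (h1.map X)
      (h1.map fun l => Y.graph.hom (y l.castSucc) (y l.succ))
    have h3 := Y.assoc (h.map y) (fun i => (isPath_interval (hst i)).map y)
      (h1.map fun l => (y l.castSucc, y l.succ)) ((isPath_interval (h.le hst)).map y)
      (h1.map fun l => Y.graph.hom (y l.castSucc) (y l.succ))
    rw [chainLiftMap_eq X y f (h.le hst), ← Category.assoc, chainComp_chainTo X hM h hst,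
      Category.assoc, reassoc_of% h2, h3, ← Category.assoc, ← Category.assoc, ← map_pi_comp,
      ← map_pi_comp]
    refine congrArg (fun g => (M.T k).map g ≫ _) (funext fun i => ?_)
    rw [chainLiftMap_eq X y f (hst i), Category.assoc]
  · exact (chainTensorInitial X hM hst).hom_ext _ _

/-- The universal property of the free category on a chain. -/
noncomputable def chainLift : chain.{w} X hM ⟶ Y where
  toGraph := ⟨fun i => y i.down, fun a b => chainLiftMap X y f a.down b.down⟩
  comm h := chainLiftMap_comm X hM y f (h.map ULift.down)

theorem chainUnit_chainLiftMap (l : Fin n) :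
    chainUnit X l ≫ chainLiftMap X y f l.castSucc l.succ = f l := by
  have h := (Fin.castSucc_lt_succ (i := l)).le
  have h1 := isConcat_interval_succ l
  have h2 := M.σ_naturality (fun _ _ => f l) (fun m => f (interval l.castSucc l.succ m))
    (h1.map fun l => Arrow.mk (f l)) (h1.map X)
    (h1.map fun l => Y.graph.hom (y l.castSucc) (y l.succ))
  have h3 := Y.assoc (IsPath.single (y l.castSucc) (y l.succ))
    (fun _ => IsPath.single (y l.castSucc) (y l.succ))
    (h1.map fun l => (y l.castSucc, y l.succ)) ((isPath_interval h).map y)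
    (h1.map fun l => Y.graph.hom (y l.castSucc) (y l.succ))
  have h4 := M.u_naturality (f l)
  have h5 := M.u_naturality ((M.T 1).map (fun _ : Fin 1 => f l))
  have h6 := M.u_naturality (Y.comp (IsPath.single (y l.castSucc) (y l.succ)))
  have h7 := Y.unit (y l.castSucc) (y l.succ)
  rw [chainLiftMap_eq X y f h, chainUnit]
  simp only [Category.assoc]
  rw [reassoc_of% chainOf_chainTo M X, reassoc_of% h2, h3, ← reassoc_of% h5, ← reassoc_of% h4,
    ← reassoc_of% h6, h7, Category.comp_id, h7, Category.comp_id]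

end Lift

end Chain

end Multitensor

theorem List.map_val_ofFn_add {N n : ℕ} (c : ℕ) (x : Fin n → Fin N) (h : ∀ j, (x j : ℕ) = c + j) :
    (List.ofFn x).map Fin.val = List.range' c n := by
  refine List.ext_getElem (by simp) fun m h1 h2 => ?_
  simp [h]

/-- The positions of a doubly nested sequence in its concatenation. -/
theorem IsConcat.exists_steps {α : Type w} {k : ℕ} {n : Fin k → ℕ} {N : ℕ}
    {X : ∀ i : Fin k, Fin (n i) → α} {Y : Fin N → α} (h : IsConcat X Y) :
    ∃ (x : ∀ i, Fin (n i) → Fin N) (y : Fin (k + 1) → Fin (N + 1)),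
      IsConcat x (fun a => a) ∧ X = (fun i j => Y (x i j)) ∧ y 0 = 0 ∧ y (Fin.last k) = Fin.last N ∧
      ∀ i, IsPath (y i.castSucc) (y i.succ) (fun j => (x i j).castSucc) (fun j => (x i j).succ) := by
  have hlast : Fin.partialSum n (Fin.last k) = N := by
    rw [h.card_eq, Fin.partialSum, Fin.val_last, ← List.sum_ofFn, List.take_of_length_le (by simp)]
  have hstep : ∀ i : Fin k, Fin.partialSum n i.castSucc ≤ Fin.partialSum n i.succ := fun i => by
    rw [Fin.partialSum_succ]
    omega
  have hmono : ∀ i, Fin.partialSum n i ≤ N := fun i => by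
    rw [← hlast]
    exact Fin.monotone_iff_le_succ.2 hstep (Fin.le_last i)
  have hlt : ∀ i (j : Fin (n i)), Fin.partialSum n i.castSucc + j < N := fun i j => by
    have := hmono i.succ
    rw [Fin.partialSum_succ] at this
    omega
  let x : ∀ i, Fin (n i) → Fin N := fun i j => ⟨Fin.partialSum n i.castSucc + j, hlt i j⟩
  have hx : IsConcat x (fun a => a) := by
    refine (List.map_injective_iff.2 Fin.val_injective) ?_
    rw [List.map_val_ofFn_add 0 (fun a => a) (by simp), List.map_flatten, List.map_ofFn]
    have h1 := (flatten_range' (Fin.partialSum n) hstep).2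
    rw [hlast, Fin.partialSum_zero, Nat.sub_zero] at h1
    refine h1.symm.trans ?_
    congr 2
    funext i
    refine Eq.trans ?_ (List.map_val_ofFn_add (Fin.partialSum n i.castSucc) (x i)
      (fun j => rfl)).symm
    rw [Fin.partialSum_succ, Nat.add_sub_cancel_left]
  refine ⟨x, fun i => ⟨Fin.partialSum n i, Nat.lt_succ_of_le (hmono i)⟩, hx,
    h.injective (hx.map Y), by ext; simp, by ext; simpa using hlast, fun i => ?_⟩
  refine ⟨fun j => ⟨Fin.partialSum n i.castSucc + j, ?_⟩, ?_, ?_, fun j => ?_, fun j => ?_⟩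
  · have := hmono i.succ
    rw [Fin.partialSum_succ] at this
    omega
  · ext
    simp
  · ext
    simp [Fin.partialSum_succ]
  · rfl
  · ext
    simp [x, Nat.add_assoc]

namespace EnrichedCat

variable {W : Type u} [Category.{v} W]

/-- The structure of an `M`-category on a graph. -/
structure Str (M : Multitensor W) (G : EnrichedGraph.{w} W) where
  /-- the composition -/
  comp : ∀ {n : ℕ} {a b : G.Ob} {s t : Fin n → G.Ob}, IsPath a b s t →
    ((M.T n).obj (fun i => G.hom (s i) (t i)) ⟶ G.hom a b)
  unit : ∀ a b, M.u (G.hom a b) ≫ comp (IsPath.single a b) = 𝟙 _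
  assoc : ∀ {k : ℕ} {n : Fin k → ℕ} {N : ℕ} {a b : G.Ob} {s t : Fin k → G.Ob}
    (h : IsPath a b s t) {s' t' : ∀ i, Fin (n i) → G.Ob}
    (h' : ∀ i, IsPath (s i) (t i) (s' i) (t' i)) {S T : Fin N → G.Ob}
    (_ : IsConcat (fun i j => (s' i j, t' i j)) (fun l => (S l, T l)))
    (H : IsPath a b S T)
    (hc : IsConcat (fun i j => G.hom (s' i j) (t' i j)) (fun l => G.hom (S l) (T l))),
    M.σ (fun i j => G.hom (s' i j) (t' i j)) (fun l => G.hom (S l) (T l)) hc ≫ comp H =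
      (M.T k).map (fun i => comp (h' i)) ≫ comp h

variable {M M' M'' : Multitensor W}

/-- The structure of a category on its underlying graph. -/
def str (X : EnrichedCat.{w} M) : Str M X.graph := ⟨X.comp, X.unit, X.assoc⟩

/-- The category given by a structure on a graph. -/
abbrev Str.toCat {G : EnrichedGraph.{w} W} (S : Str M G) : EnrichedCat.{w} M :=
  ⟨G, S.comp, S.unit, S.assoc⟩

/-- The structure of a category on a graph equal to its underlying graph. -/
def strOn (X : EnrichedCat.{w} M) {G : EnrichedGraph.{w} W} (e : X.graph = G) : Str M G :=
  e ▸ X.str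

theorem strOn_toCat (X : EnrichedCat.{w} M) {G : EnrichedGraph.{w} W} (e : X.graph = G) :
    (X.strOn e).toCat = X := by
  subst e
  rfl

theorem strOn_eq {X Y : EnrichedCat.{w} M} (h : X = Y) (e : X.graph = Y.graph) :
    X.strOn e = Y.str := by
  subst h
  rfl

/-- A morphism of graphs is compatible with given structures of categories. -/
def Str.IsHom {G H : EnrichedGraph.{w} W} (S : Str M G) (T : Str M H) (f : G ⟶ H) : Prop :=
  ∀ {n : ℕ} {a b : G.Ob} {s t : Fin n → G.Ob} (h : IsPath a b s t),
    S.comp h ≫ EnrichedGraph.Hom.map f a b =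
      (M.T n).map (fun i => EnrichedGraph.Hom.map f (s i) (t i)) ≫
        T.comp (h.map (EnrichedGraph.Hom.obj f))

theorem isHom_strOn {X Y : EnrichedCat.{w} M} (F : X ⟶ Y) {G H : EnrichedGraph.{w} W}
    (eX : X.graph = G) (eY : Y.graph = H) (f : G ⟶ H)
    (hf : (EnrichedCat.forget M).map F = eqToHom eX ≫ f ≫ eqToHom eY.symm) :
    (X.strOn eX).IsHom (Y.strOn eY) f := by
  subst eX eY
  have : f = F.toGraph := by
    refine Eq.trans ?_ hf.symm
    simp
  subst this
  intro n a b s t h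
  exact F.comm h

/-- A way of making `M`-categories into `M'`-categories, and `M`-functors into `M'`-functors. -/
structure StrMap (M M' : Multitensor W) where
  /-- the structure of an `M'`-category on the graph of an `M`-category -/
  str : ∀ X : EnrichedCat.{w} M, Str M' X.graph
  isHom : ∀ {X Y : EnrichedCat.{w} M} (f : X ⟶ Y), (str X).IsHom (str Y) f.toGraph

/-- A functor over the category of graphs gives a map of structures. -/
def StrMap.ofFunctor (Φ : EnrichedCat.{w} M ⥤ EnrichedCat.{w} M')
    (h : Φ ⋙ EnrichedCat.forget M' = EnrichedCat.forget M) : StrMap M M' where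
  str X := (Φ.obj X).strOn (Functor.congr_obj h X)
  isHom f := isHom_strOn (Φ.map f) _ _ _ (Functor.congr_hom h f)

theorem StrMap.str_ofFunctor_toCat {Φ : EnrichedCat.{w} M ⥤ EnrichedCat.{w} M'}
    (h : Φ ⋙ EnrichedCat.forget M' = EnrichedCat.forget M)
    {Ψ : EnrichedCat.{w} M' ⥤ EnrichedCat.{w} M}
    (h' : Ψ ⋙ EnrichedCat.forget M = EnrichedCat.forget M') (hΦΨ : Φ ⋙ Ψ = 𝟭 _)
    (X : EnrichedCat.{w} M) :
    (ofFunctor Ψ h').str ((ofFunctor Φ h).str X).toCat = X.str := by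
  refine strOn_eq ?_ _
  rw [show ((ofFunctor Φ h).str X).toCat = Φ.obj X from strOn_toCat _ _]
  exact Functor.congr_obj hΦΨ X

namespace StrMap

open Multitensor

variable [Limits.HasInitial W] (hM : M.PreservesInitial)

/-- The composition of the `M'`-category given by a chain. -/
noncomputable def chainStrComp (Φ : StrMap.{w} M M') {n : ℕ} (X : Fin n → W) {k : ℕ}
    {a b : Fin (n + 1)} {s t : Fin k → Fin (n + 1)} (h : IsPath a b s t) :
    (M'.T k).obj (fun l => M.chainHom X (s l) (t l)) ⟶ M.chainHom X a b :=
  (Φ.str (chain.{w} X hM)).comp (h.map ULift.up.{w})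

/-- The comparison map `M'(X_1, ..., X_n) ⟶ M(X_1, ..., X_n)` given by a way of making
`M`-categories into `M'`-categories. -/
noncomputable def tensorMap (Φ : StrMap.{w} M M') {n : ℕ} (X : Fin n → W) :
    (M'.T n).obj X ⟶ (M.T n).obj X :=
  (M'.T n).map (chainUnit X) ≫ Φ.chainStrComp hM X (isPath_steps fun i => i) ≫ chainTotal X

theorem chainStrComp_chainLiftMap (Φ : StrMap.{w} M M') {n : ℕ} (X : Fin n → W)
    (Y : EnrichedCat.{w} M) (y : Fin (n + 1) → Y.graph.Ob)
    (f : ∀ l, X l ⟶ Y.graph.hom (y l.castSucc) (y l.succ)) :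
    Φ.chainStrComp hM X (isPath_steps fun i => i) ≫ chainLiftMap X y f 0 (Fin.last n) =
      (M'.T n).map (fun l : Fin n => chainLiftMap X y f l.castSucc l.succ) ≫
        (Φ.str Y).comp (isPath_steps y) :=
  Φ.isHom (chainLift X hM y f) (isPath_steps fun i : Fin (n + 1) => ULift.up.{w} i)

/-- The comparison map relates the two compositions of any `M`-category. -/
theorem tensorMap_comp (Φ : StrMap.{w} M M') {n : ℕ} (X : Fin n → W) (Y : EnrichedCat.{w} M)
    {a b : Y.graph.Ob} {s t : Fin n → Y.graph.Ob} (h : IsPath a b s t)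
    (f : ∀ l, X l ⟶ Y.graph.hom (s l) (t l)) :
    Φ.tensorMap hM X ≫ (M.T n).map f ≫ Y.comp h = (M'.T n).map f ≫ (Φ.str Y).comp h := by
  obtain ⟨y, rfl, rfl, h1, h2⟩ := h
  obtain rfl := funext h1
  obtain rfl := funext h2
  have h2 : chainLiftMap X y f 0 (Fin.last n) =
      chainTotal X ≫ (M.T n).map f ≫ Y.comp (isPath_steps y) :=
    chainLiftMap_eq X y f (Fin.zero_le _)
  have h3 : (M'.T n).map (chainUnit X) ≫
      (M'.T n).map (fun l : Fin n => chainLiftMap X y f l.castSucc l.succ) = (M'.T n).map f := by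
    rw [← map_pi_comp]
    exact congrArg (M'.T n).map (funext fun l => chainUnit_chainLiftMap X y f l)
  rw [tensorMap, Category.assoc, Category.assoc, ← h2, chainStrComp_chainLiftMap,
    ← Category.assoc, h3]

theorem tensorMap_chainComp (Φ : StrMap.{w} M M') {m n : ℕ} (X : Fin m → W) (Y : Fin n → W)
    {a b : Fin (n + 1)} {s t : Fin m → Fin (n + 1)} (h : IsPath a b s t)
    (f : ∀ l, X l ⟶ M.chainHom Y (s l) (t l)) :
    Φ.tensorMap hM X ≫ (M.T m).map f ≫ chainComp Y hM h =
      (M'.T m).map f ≫ Φ.chainStrComp hM Y h :=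
  Φ.tensorMap_comp hM X (chain.{w} Y hM) (h.map ULift.up.{w}) f

theorem tensorMap_naturality (Φ : StrMap.{w} M M') {n : ℕ} {X X' : Fin n → W}
    (g : ∀ i, X i ⟶ X' i) :
    (M'.T n).map g ≫ Φ.tensorMap hM X' = Φ.tensorMap hM X ≫ (M.T n).map g := by
  have h := Φ.tensorMap_chainComp hM X X' (isPath_steps fun i => i) fun l => g l ≫ chainUnit X' l
  rw [map_pi_comp, map_pi_comp] at h
  have h1 := congrArg (· ≫ chainTotal X') h
  simp only [Category.assoc, map_chainUnit_comp_chainTotal, Category.comp_id] at h1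
  exact h1.symm

theorem u_comp_chainStrComp (Φ : StrMap.{w} M M') {n : ℕ} (Y : Fin n → W) (X : W)
    {a b : Fin (n + 1)} {s t : Fin 1 → Fin (n + 1)} (h : IsPath a b s t)
    (f : ∀ l, X ⟶ M.chainHom Y (s l) (t l)) :
    M'.u X ≫ (M'.T 1).map f ≫ Φ.chainStrComp hM Y h =
      M.u X ≫ (M.T 1).map f ≫ chainComp Y hM h := by
  obtain ⟨x, rfl, rfl, hs, ht⟩ := h
  obtain rfl : s = fun _ => x 0 := funext fun l => by
    rw [hs, Subsingleton.elim l 0]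
    rfl
  obtain rfl : t = fun _ => x (Fin.last 1) := funext fun l => by
    rw [ht, Subsingleton.elim l 0]
    rfl
  obtain ⟨g, rfl⟩ : ∃ g, f = fun _ => g := ⟨f 0, funext fun l => by rw [Subsingleton.elim l 0]⟩
  have h1 := M'.u_naturality g
  have h2 := M.u_naturality g
  have h3 : M'.u _ ≫ Φ.chainStrComp hM Y (IsPath.single (x 0) (x (Fin.last 1))) = 𝟙 _ :=
    (Φ.str (chain.{w} Y hM)).unit (ULift.up (x 0)) (ULift.up (x (Fin.last 1)))
  have h4 := chainComp_unit Y hM (x 0) (x (Fin.last 1))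
  rw [← reassoc_of% h1, ← reassoc_of% h2]
  exact congrArg (g ≫ ·) (h3.trans h4.symm)

theorem u_tensorMap (Φ : StrMap.{w} M M') (X : W) :
    M'.u X ≫ Φ.tensorMap hM (fun _ : Fin 1 => X) = M.u X := by
  have h := Φ.u_comp_chainStrComp hM (fun _ : Fin 1 => X) X (isPath_steps fun i => i)
    (chainUnit fun _ : Fin 1 => X)
  have h1 := congrArg (· ≫ chainTotal fun _ : Fin 1 => X) h
  simp only [Category.assoc] at h1
  refine h1.trans ?_
  exact (congrArg (M.u X ≫ ·) (map_chainUnit_comp_chainTotal (fun _ : Fin 1 => X) hM)).trans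
    (Category.comp_id _)

theorem σ_tensorMap (Φ : StrMap.{w} M M') {k : ℕ} {n : Fin k → ℕ} {N : ℕ}
    (X : ∀ i, Fin (n i) → W) (Y : Fin N → W) (h : IsConcat X Y) :
    M'.σ X Y h ≫ Φ.tensorMap hM Y = (M'.T k).map (fun i => Φ.tensorMap hM (X i)) ≫
      Φ.tensorMap hM (fun i => (M.T (n i)).obj (X i)) ≫ M.σ X Y h := by
  obtain ⟨x, y, hx, rfl, h0, h1, hy⟩ := h.exists_steps
  have hp : IsPath (0 : Fin (N + 1)) (Fin.last N) (fun i => y i.castSucc) (fun i => y i.succ) :=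
    h1 ▸ h0 ▸ isPath_steps y
  have hA := hx.map fun l => Arrow.mk (chainUnit (M := M) Y l)
  have hH := hx.map fun l => M.chainHom Y l.castSucc l.succ
  have hS := hx.map fun l => (l.castSucc, l.succ)
  have e1 := M'.σ_naturality (fun i j => chainUnit (M := M) Y (x i j)) (chainUnit Y) hA h hH
  have e2 := M.σ_naturality (fun i j => chainUnit (M := M) Y (x i j)) (chainUnit Y) hA h hH
  have e3 : M'.σ (fun i j => M.chainHom Y (x i j).castSucc (x i j).succ)
      (fun l => M.chainHom Y l.castSucc l.succ) hH ≫
        Φ.chainStrComp hM Y (isPath_steps fun i => i) =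
      (M'.T k).map (fun i => Φ.chainStrComp hM Y (hy i)) ≫ Φ.chainStrComp hM Y hp :=
    (Φ.str (chain.{w} Y hM)).assoc (hp.map ULift.up.{w}) (fun i => (hy i).map ULift.up.{w})
      (hS.map fun p => (ULift.up.{w} p.1, ULift.up.{w} p.2)) _ hH
  have e4 := chainComp_assoc Y hM hp hy hS (isPath_steps fun i => i) hH
  have e5 := fun i => Φ.tensorMap_chainComp hM (fun j => Y (x i j)) Y (hy i)
    fun j => chainUnit Y (x i j)
  have e6 := Φ.tensorMap_chainComp hM (fun i => (M.T (n i)).obj fun j => Y (x i j)) Y hp fun i =>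
    (M.T (n i)).map (fun j => chainUnit Y (x i j)) ≫ chainComp Y hM (hy i)
  have e7 : M.σ _ Y h ≫ (M.T N).map (chainUnit Y) ≫ chainComp Y hM (isPath_steps fun i => i) =
      (M.T k).map (fun i => (M.T (n i)).map (fun j => chainUnit Y (x i j)) ≫
        chainComp Y hM (hy i)) ≫ chainComp Y hM hp := by
    rw [reassoc_of% e2, e4, map_pi_comp, Category.assoc]
  have e8 : M'.σ _ Y h ≫ (M'.T N).map (chainUnit Y) ≫
      Φ.chainStrComp hM Y (isPath_steps fun i => i) =
      (M'.T k).map (fun i => Φ.tensorMap hM fun j => Y (x i j)) ≫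
        Φ.tensorMap hM (fun i => (M.T (n i)).obj fun j => Y (x i j)) ≫
          M.σ _ Y h ≫ (M.T N).map (chainUnit Y) ≫ chainComp Y hM (isPath_steps fun i => i) := by
    rw [reassoc_of% e1, e3, e7, e6, ← Category.assoc, ← map_pi_comp, ← Category.assoc, ← map_pi_comp]
    exact congrArg (fun g => (M'.T k).map g ≫ _) (funext fun i => (e5 i).symm)
  have e9 := congrArg (· ≫ chainTotal Y) e8
  simp only [Category.assoc, map_chainUnit_comp_chainTotal, Category.comp_id] at e9
  exact e9

theorem tensorMap_tensorMap (hM' : M'.PreservesInitial) (Φ : StrMap.{w} M M')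
    (Ψ : StrMap.{w} M' M) (hΦΨ : ∀ X, Ψ.str (Φ.str X).toCat = X.str) {n : ℕ} (X : Fin n → W) :
    Ψ.tensorMap hM' X ≫ Φ.tensorMap hM X = 𝟙 _ := by
  have h : Ψ.tensorMap hM' X ≫ (M'.T n).map (chainUnit X) ≫
      Φ.chainStrComp hM X (isPath_steps fun i => i) = (M.T n).map (chainUnit X) ≫
        (Ψ.str (Φ.str (chain.{w} X hM)).toCat).comp
          (isPath_steps fun i : Fin (n + 1) => ULift.up.{w} i) :=
    Ψ.tensorMap_comp hM' X (Φ.str (chain.{w} X hM)).toCat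
      (isPath_steps fun i : Fin (n + 1) => ULift.up.{w} i) (chainUnit X)
  rw [hΦΨ] at h
  have h1 : Ψ.tensorMap hM' X ≫ (M'.T n).map (chainUnit X) ≫
      Φ.chainStrComp hM X (isPath_steps fun i => i) = (M.T n).map (chainUnit X) ≫
        chainComp X hM (isPath_steps fun i => i) := h
  have h2 := congrArg (· ≫ chainTotal X) h1
  simp only [Category.assoc, map_chainUnit_comp_chainTotal] at h2
  exact h2

end StrMap

end EnrichedCat

theorem IsoOver.symm {A : Type u} [Category.{v} A] {B : Type u'} [Category.{v'} B] {G : Type*}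
    [Category* G] {U : A ⥤ G} {U' : B ⥤ G} (h : IsoOver U U') : IsoOver U' U := by
  obtain ⟨Φ, Ψ, h1, h2, h3⟩ := h
  refine ⟨Ψ, Φ, h2, h1, ?_⟩
  rw [← h3, ← Functor.assoc, h2, Functor.id_comp]

theorem IsoOver.trans {A : Type*} [Category* A] {B : Type*} [Category* B] {D : Type*}
    [Category* D] {G : Type*} [Category* G] {U : A ⥤ G} {U' : B ⥤ G} {U'' : D ⥤ G}
    (h : IsoOver U U') (h' : IsoOver U' U'') : IsoOver U U'' := by
  obtain ⟨Φ, Ψ, h1, h2, h3⟩ := h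
  obtain ⟨Φ', Ψ', h1', h2', h3'⟩ := h'
  refine ⟨Φ ⋙ Φ', Ψ' ⋙ Ψ, ?_, ?_, ?_⟩
  · rw [Functor.assoc, ← Functor.assoc Φ', h1', Functor.id_comp, h1]
  · rw [Functor.assoc, ← Functor.assoc Ψ, h2, Functor.id_comp, h2']
  · rw [Functor.assoc, h3', h3]

/-- Multitensors which preserve initial objects and have isomorphic categories of enriched categories
are isomorphic. -/
theorem Multitensor.nonempty_iso_of_isoOver {W : Type u} [Category.{v} W] [Limits.HasInitial W]
    {M M' : Multitensor W} (hM : M.PreservesInitial) (hM' : M'.PreservesInitial)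
    (h : IsoOver (EnrichedCat.forget.{w} M) (EnrichedCat.forget.{w} M')) :
    Nonempty (MultitensorIso (𝟭 W) M' M) := by
  obtain ⟨Φ, Ψ, h1, h2, h3⟩ := h
  have h4 : Ψ ⋙ EnrichedCat.forget M = EnrichedCat.forget M' := by
    rw [← h3, ← Functor.assoc, h2, Functor.id_comp]
  let φ := EnrichedCat.StrMap.ofFunctor Φ h3
  let ψ := EnrichedCat.StrMap.ofFunctor Ψ h4
  exact ⟨{
    iso := fun X =>
      { hom := φ.tensorMap hM X
        inv := ψ.tensorMap hM' X
        hom_inv_id := EnrichedCat.StrMap.tensorMap_tensorMap hM' hM ψ φ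
          (EnrichedCat.StrMap.str_ofFunctor_toCat h4 h3 h2) X
        inv_hom_id := EnrichedCat.StrMap.tensorMap_tensorMap hM hM' φ ψ
          (EnrichedCat.StrMap.str_ofFunctor_toCat h3 h4 h1) X }
    naturality := fun f => φ.tensorMap_naturality hM f
    unit := fun X => φ.u_tensorMap hM X
    subst := fun X Y h => by
      refine (φ.σ_tensorMap hM X Y h).trans ?_
      refine (Category.assoc _ _ _).symm.trans ((congrArg (· ≫ M.σ X Y h)
        (φ.tensorMap_naturality hM fun i => φ.tensorMap hM (X i))).trans (Category.assoc _ _ _)) }⟩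

namespace Multitensor

variable {W : Type u'} [Category.{v} W] {V : Type u} [Category.{v} V]

section Transport

variable (F : Multitensor W) (e : W ≌ V)

/-- The transport of a multitensor along an equivalence. -/
def transport : Multitensor V where
  T n :=
    { obj := fun X => e.functor.obj ((F.T n).obj fun i => e.inverse.obj (X i))
      map := fun f => e.functor.map ((F.T n).map fun i => e.inverse.map (f i))
      map_id := fun X => by
        refine Eq.trans (congrArg e.functor.map ?_) (e.functor.map_id _)
        refine Eq.trans (congrArg (F.T n).map ?_) ((F.T n).map_id _)
        exact funext fun i => e.inverse.map_id _
      map_comp := fun f g => by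
        refine Eq.trans (congrArg e.functor.map ?_) (e.functor.map_comp _ _)
        refine Eq.trans (congrArg (F.T n).map ?_) ((F.T n).map_comp _ _)
        exact funext fun i => e.inverse.map_comp _ _ }
  u X := e.counitInv.app X ≫ e.functor.map (F.u (e.inverse.obj X))
  σ {k n N} X Y h := e.functor.map
    ((F.T k).map (fun i => e.unitInv.app ((F.T (n i)).obj fun j => e.inverse.obj (X i j))) ≫
      F.σ (fun i j => e.inverse.obj (X i j)) (fun a => e.inverse.obj (Y a)) (h.map e.inverse.obj))
  u_naturality {X Y} f := by
    have h1 := e.counitInv.naturality f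
    have h2 := F.u_naturality (e.inverse.map f)
    simp only [Functor.id_map, Functor.comp_map] at h1
    rw [reassoc_of% h1, ← e.functor.map_comp, h2, e.functor.map_comp, Category.assoc]
  σ_naturality {k n N X X' Y Y'} f g hfg h h' := by
    have h1 := F.σ_naturality (fun i j => e.inverse.map (f i j)) (fun a => e.inverse.map (g a))
      (hfg.map fun s : Arrow V => Arrow.mk (e.inverse.map s.hom)) (h.map e.inverse.obj)
      (h'.map e.inverse.obj)
    rw [← e.functor.map_comp, ← e.functor.map_comp, Category.assoc, h1, ← Category.assoc,
      ← Category.assoc, ← map_pi_comp, ← map_pi_comp]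
    refine congrArg (fun g => e.functor.map ((F.T k).map g ≫ _)) (funext fun i => ?_)
    exact (e.unitInv.naturality ((F.T (n i)).map fun j => e.inverse.map (f i j))).symm
  u_σ {n} X := by
    have h1 := F.u_naturality (e.unitInv.app ((F.T n).obj fun j => e.inverse.obj (X j)))
    have h2 := F.u_σ fun j => e.inverse.obj (X j)
    rw [Category.assoc, ← e.functor.map_comp, ← reassoc_of% h1, h2, Category.comp_id]
    exact e.counitInv_functor_comp _
  map_u_σ {n} X := by
    have h2 := F.map_u_σ fun j => e.inverse.obj (X j)
    rw [← e.functor.map_comp, ← Category.assoc, ← map_pi_comp, ← e.functor.map_id, ← h2]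
    refine congrArg (fun g => e.functor.map ((F.T n).map g ≫ _)) (funext fun i => ?_)
    have h3 := e.unitInv.naturality (F.u (e.inverse.obj (X i)))
    simp only [Functor.id_map, Functor.comp_map] at h3
    rw [Functor.map_comp, Category.assoc, h3, ← Category.assoc, e.inverse_counitInv_comp,
      Category.id_comp]
  assoc {k n p P M N q} X Y Z U hXZ hT hXY hYU hZU := by
    have hG := hXZ.map fun s : Σ m, Fin m → V =>
      (⟨s.1, fun l => e.inverse.obj (s.2 l)⟩ : Σ m, Fin m → W)
    have hA := hXZ.map fun s : Σ m, Fin m → V =>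
      Arrow.mk (e.unitInv.app ((F.T s.1).obj fun l => e.inverse.obj (s.2 l)))
    have hR := hG.map fun s : Σ m, Fin m → W => (F.T s.1).obj s.2
    have h1 := F.σ_naturality _ _ hA (hT.map e.inverse.obj) hR
    have h2 := F.assoc _ _ _ _ hG hR (fun i => (hXY i).map e.inverse.obj) (hYU.map e.inverse.obj)
      (hZU.map e.inverse.obj)
    rw [← e.functor.map_comp, ← e.functor.map_comp, Category.assoc]
    have h3 := fun i => e.unitInv.naturality ((F.T (n i)).map (fun j =>
      e.unitInv.app ((F.T (p i j)).obj fun l => e.inverse.obj (X i j l))) ≫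
      F.σ (fun j l => e.inverse.obj (X i j l)) (fun l => e.inverse.obj (Y i l))
        ((hXY i).map e.inverse.obj))
    refine congrArg e.functor.map ?_
    refine (congrArg (_ ≫ ·) ((Category.assoc _ _ _).symm.trans ((congrArg (· ≫ _) h1).trans
      ((Category.assoc _ _ _).trans (congrArg (_ ≫ ·) h2))))).trans ?_
    rw [← Category.assoc, ← Category.assoc, ← map_pi_comp, ← map_pi_comp, ← Category.assoc,
      ← map_pi_comp]
    refine congrArg (fun g => (F.T k).map g ≫ _) (funext fun i => ?_)
    rw [Category.assoc]
    exact (h3 i).symm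

/-- A multitensor is isomorphic to its transport. -/
def transportIso : MultitensorIso e.functor F (F.transport e) where
  iso X := e.functor.mapIso
    { hom := (F.T _).map fun i => e.unit.app (X i)
      inv := (F.T _).map fun i => e.unitInv.app (X i)
      hom_inv_id := by
        rw [← map_pi_comp, ← map_pi_id]
        exact congrArg (F.T _).map (funext fun i => e.unitIso.hom_inv_id_app (X i))
      inv_hom_id := by
        rw [← map_pi_comp, ← map_pi_id]
        exact congrArg (F.T _).map (funext fun i => e.unitIso.inv_hom_id_app (X i)) }
  naturality {n X Y} f := by
    refine (e.functor.map_comp _ _).symm.trans (Eq.trans (congrArg e.functor.map ?_)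
      (e.functor.map_comp _ _))
    rw [← map_pi_comp, ← map_pi_comp (g := fun i => e.inverse.map (e.functor.map (f i)))]
    exact congrArg (F.T n).map (funext fun i => e.unit.naturality (f i))
  unit X := by
    refine (e.functor.map_comp _ _).symm.trans ?_
    refine (congrArg e.functor.map (F.u_naturality (e.unit.app X)).symm).trans ?_
    refine (e.functor.map_comp _ _).trans (congrArg (· ≫ _) ?_)
    exact (e.counitInv_app_functor X).symm
  subst {k n N} X Y h := by
    have h1 := F.σ_naturality (fun i j => e.unit.app (X i j)) (fun a => e.unit.app (Y a))
      (h.map fun A => Arrow.mk (e.unit.app A)) h (h.map fun A => e.inverse.obj (e.functor.obj A))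
    refine (e.functor.map_comp _ _).symm.trans ((congrArg e.functor.map h1).trans ?_)
    refine Eq.trans ?_ (congrArg (_ ≫ ·) (e.functor.map_comp _ _))
    refine Eq.trans (congrArg e.functor.map ?_) (e.functor.map_comp _ _)
    change _ = (F.T k).map (fun i => e.unit.app ((F.T (n i)).obj (X i))) ≫
      (F.T k).map (fun i => e.inverse.map (e.functor.map
        ((F.T (n i)).map fun j => e.unit.app (X i j)))) ≫
      (F.T k).map (fun i => e.unitInv.app
        ((F.T (n i)).obj fun j => e.inverse.obj (e.functor.obj (X i j)))) ≫ F.σ _ _ _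
    rw [← Category.assoc, ← Category.assoc, ← map_pi_comp, ← map_pi_comp]
    refine congrArg (fun g => (F.T k).map g ≫ _) (funext fun i => ?_)
    have h2 := e.unit.naturality ((F.T (n i)).map fun j => e.unit.app (X i j))
    have h3 := e.unitIso.hom_inv_id_app ((F.T (n i)).obj fun j => e.inverse.obj (e.functor.obj (X i j)))
    refine Eq.symm ((congrArg (· ≫ _) h2.symm).trans ((Category.assoc _ _ _).trans ?_))
    exact (congrArg (_ ≫ ·) h3).trans (Category.comp_id _)

variable {F}

theorem IsFunctorOperad.transport (hF : F.IsFunctorOperad) : (F.transport e).IsFunctorOperad := by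
  intro X
  have := hF (e.inverse.obj X)
  change IsIso (e.counitInv.app X ≫ e.functor.map (F.u (e.inverse.obj X)))
  infer_instance

/-- Filling a slot commutes with functors. -/
def slotCompIso (p : Prop) [inst : Decidable p] (Z : V) (J : V ⥤ W) :
    slot p Z ⋙ J ≅ J ⋙ slot p (J.obj Z) := by
  cases inst with
  | isTrue _ => exact NatIso.ofComponents fun _ => Iso.refl _
  | isFalse _ =>
    exact NatIso.ofComponents (fun _ => Iso.refl (J.obj Z)) fun f => by
      change J.map (𝟙 Z) ≫ 𝟙 _ = 𝟙 _ ≫ 𝟙 (J.obj Z)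
      simp

variable (F) in
/-- The variable functors of a transported multitensor. -/
def transportVariableFunctorIso {n : ℕ} (X : Fin n → V) (i : Fin n) :
    (F.transport e).variableFunctor X i ≅
      e.inverse ⋙ F.variableFunctor (fun j => e.inverse.obj (X j)) i ⋙ e.functor :=
  let τ : Functor.pi' (fun j => slot (j = i) (X j)) ⋙ Functor.pi (fun _ => e.inverse) ≅
      e.inverse ⋙ Functor.pi' (fun j => slot (j = i) (e.inverse.obj (X j))) :=
    NatIso.pi' fun j => slotCompIso (j = i) (X j) e.inverse
  Functor.isoWhiskerRight τ (F.T n ⋙ e.functor)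

theorem IsCocomplete.isDistributive_transport (hF : F.IsCocomplete) :
    (F.transport e).IsDistributive := by
  intro n X i J
  have := hF (fun j => e.inverse.obj (X j)) i
  exact Limits.preservesColimitsOfShape_of_natIso (transportVariableFunctorIso F e X i).symm

end Transport

end Multitensor

/-- The action of the unary part of a multitensor on an algebra. -/
def Multitensor.act {V : Type u} [Category.{v} V] {E : Multitensor V} (X : E.unary.Algebra) :
    (E.T 1).obj (fun _ => X.A) ⟶ X.A := X.a

theorem Multitensor.act_naturality {V : Type u} [Category.{v} V] {E : Multitensor V}
    {X Y : E.unary.Algebra} (f : X ⟶ Y) :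
    (E.T 1).map (fun _ => f.f) ≫ act Y = act X ≫ f.f := f.h

/-- Multilinear maps `E(KZ_1, ..., KZ_n) ⟶ KF(Z_1, ..., Z_n)`, for a functor `K` to the category of
algebras of the unary part of `E`, which are universal among the maps compatible with the actions. -/
structure LiftData {V : Type u} [Category.{v} V] {W : Type u'} [Category.{v'} W]
    (E : Multitensor V) (F : Multitensor W) (K : W ⥤ E.unary.Algebra) where
  /-- the universal multilinear map -/
  q : ∀ {n : ℕ} (Z : Fin n → W),
    (E.T n).obj (fun i => (K.obj (Z i)).A) ⟶ (K.obj ((F.T n).obj Z)).A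
  naturality : ∀ {n : ℕ} {Z Z' : Fin n → W} (f : ∀ i, Z i ⟶ Z' i),
    (E.T n).map (fun i => (K.map (f i)).f) ≫ q Z' = q Z ≫ (K.map ((F.T n).map f)).f
  unit : ∀ Z : W, E.u (K.obj Z).A ≫ q (fun _ : Fin 1 => Z) = (K.map (F.u Z)).f
  subst : ∀ {k : ℕ} {n : Fin k → ℕ} {N : ℕ} (X : ∀ i, Fin (n i) → W) (Y : Fin N → W)
    (h : IsConcat X Y),
    (E.T k).map (fun i => q (X i)) ≫ q (fun i => (F.T (n i)).obj (X i)) ≫ (K.map (F.σ X Y h)).f =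
      E.σ (fun i j => (K.obj (X i j)).A) (fun a => (K.obj (Y a)).A)
        (h.map fun Z => (K.obj Z).A) ≫ q Y
  act_out : ∀ {n : ℕ} (Z : Fin n → W),
    (E.T 1).map (fun _ => q Z) ≫ Multitensor.act (K.obj ((F.T n).obj Z)) =
      E.σ (fun _ : Fin 1 => fun i => (K.obj (Z i)).A) (fun i => (K.obj (Z i)).A)
        (IsConcat.single _) ≫ q Z
  act_in : ∀ {n : ℕ} (Z : Fin n → W),
    (E.T n).map (fun i => Multitensor.act (K.obj (Z i))) ≫ q Z =
      E.σ (fun i (_ : Fin 1) => (K.obj (Z i)).A) (fun i => (K.obj (Z i)).A)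
        (IsConcat.singles _) ≫ q Z
  desc : ∀ {n : ℕ} (Z : Fin n → W) (B : E.unary.Algebra)
    (g : (E.T n).obj (fun i => (K.obj (Z i)).A) ⟶ B.A),
    E.σ (fun _ : Fin 1 => fun i => (K.obj (Z i)).A) (fun i => (K.obj (Z i)).A)
        (IsConcat.single _) ≫ g = (E.T 1).map (fun _ => g) ≫ Multitensor.act B →
    (E.T n).map (fun i => Multitensor.act (K.obj (Z i))) ≫ g =
      E.σ (fun i (_ : Fin 1) => (K.obj (Z i)).A) (fun i => (K.obj (Z i)).A)
        (IsConcat.singles _) ≫ g →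
    ∃ g' : K.obj ((F.T n).obj Z) ⟶ B, q Z ≫ g'.f = g
  epi : ∀ {n : ℕ} (Z : Fin n → W), Epi (q Z)
  epi_map : ∀ {k : ℕ} {n : Fin k → ℕ} (X : ∀ i, Fin (n i) → W),
    Epi ((E.T k).map (fun i => q (X i)))

namespace LiftData

open Multitensor

section Transport

variable {V : Type u} [Category.{v} V] {W : Type u'} [Category.{v} W]
    {E : Multitensor V} {F : Multitensor W} {e : W ≌ E.unary.Algebra}

/-- The equivalence `E(X_1, ..., X_n) ≅ E(KJX_1, ..., KJX_n)`. -/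
def counitTensor (E : Multitensor V) (e : W ≌ E.unary.Algebra) {n : ℕ}
    (X : Fin n → E.unary.Algebra) : (E.T n).obj (fun i => (X i).A) ≅
      (E.T n).obj fun i => (e.functor.obj (e.inverse.obj (X i))).A where
  hom := (E.T n).map fun i => (e.counitInv.app (X i)).f
  inv := (E.T n).map fun i => (e.counit.app (X i)).f
  hom_inv_id := by
    rw [← map_pi_comp, ← map_pi_id]
    exact congrArg (E.T n).map (funext fun i =>
      congrArg Monad.Algebra.Hom.f (e.counitIso.inv_hom_id_app (X i)))
  inv_hom_id := by
    rw [← map_pi_comp, ← map_pi_id]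
    exact congrArg (E.T n).map (funext fun i =>
      congrArg Monad.Algebra.Hom.f (e.counitIso.hom_inv_id_app (X i)))

theorem σ_counitTensor (E : Multitensor V) (e : W ≌ E.unary.Algebra)
    {k : ℕ} {n : Fin k → ℕ} {N : ℕ} (X : ∀ i, Fin (n i) → E.unary.Algebra)
    (Y : Fin N → E.unary.Algebra) (h : IsConcat X Y) :
    E.σ (fun i j => (X i j).A) (fun a => (Y a).A) (h.map fun Z => Z.A) ≫
        (counitTensor E e Y).hom =
      (E.T k).map (fun i => (counitTensor E e (X i)).hom) ≫
        E.σ (fun i j => (e.functor.obj (e.inverse.obj (X i j))).A)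
          (fun a => (e.functor.obj (e.inverse.obj (Y a))).A)
          (h.map fun Z => (e.functor.obj (e.inverse.obj Z)).A) :=
  E.σ_naturality (fun i j => (e.counitInv.app (X i j)).f) (fun a => (e.counitInv.app (Y a)).f)
    (h.map fun Z => Arrow.mk (e.counitInv.app Z).f) _ _

theorem σ_counitTensor_inv (E : Multitensor V) (e : W ≌ E.unary.Algebra)
    {k : ℕ} {n : Fin k → ℕ} {N : ℕ} (X : ∀ i, Fin (n i) → E.unary.Algebra)
    (Y : Fin N → E.unary.Algebra) (h : IsConcat X Y) :
    E.σ (fun i j => (e.functor.obj (e.inverse.obj (X i j))).A)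
          (fun a => (e.functor.obj (e.inverse.obj (Y a))).A)
          (h.map fun Z => (e.functor.obj (e.inverse.obj Z)).A) ≫ (counitTensor E e Y).inv =
      (E.T k).map (fun i => (counitTensor E e (X i)).inv) ≫
        E.σ (fun i j => (X i j).A) (fun a => (Y a).A) (h.map fun Z => Z.A) :=
  E.σ_naturality (fun i j => (e.counit.app (X i j)).f) (fun a => (e.counit.app (Y a)).f)
    (h.map fun Z => Arrow.mk (e.counit.app Z).f) _ _

theorem map_a_counitTensor (E : Multitensor V) (e : W ≌ E.unary.Algebra) {n : ℕ}
    (X : Fin n → E.unary.Algebra) :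
    (E.T n).map (fun i => act (X i)) ≫ (counitTensor E e X).hom =
      (E.T n).map (fun i => (E.T 1).map fun _ => (e.counitInv.app (X i)).f) ≫
        (E.T n).map (fun i => act (e.functor.obj (e.inverse.obj (X i)))) := by
  refine (map_pi_comp _ _ _).symm.trans (Eq.trans ?_ (map_pi_comp _ _ _))
  exact congrArg (E.T n).map (funext fun i => (act_naturality (e.counitInv.app (X i))).symm)

theorem map_a_counitTensor_inv (E : Multitensor V) (e : W ≌ E.unary.Algebra) {n : ℕ}
    (X : Fin n → E.unary.Algebra) :
    (E.T n).map (fun i => act (e.functor.obj (e.inverse.obj (X i)))) ≫ (counitTensor E e X).inv =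
      (E.T n).map (fun i => (E.T 1).map fun _ => (e.counit.app (X i)).f) ≫
        (E.T n).map (fun i => act (X i)) := by
  refine (map_pi_comp _ _ _).symm.trans (Eq.trans ?_ (map_pi_comp _ _ _))
  exact congrArg (E.T n).map (funext fun i => (act_naturality (e.counit.app (X i))).symm)

/-- Universal multilinear maps for the transported multitensor. -/
def transport (D : LiftData E F e.functor) : LiftData E (F.transport e) (𝟭 _) where
  q {n} X := (counitTensor E e X).hom ≫ D.q fun i => e.inverse.obj (X i)
  naturality {n X X'} f := by
    have h1 := D.naturality fun i => e.inverse.map (f i)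
    have h2 : (E.T n).map (fun i => (f i).f) ≫ (counitTensor E e X').hom =
        (counitTensor E e X).hom ≫
          (E.T n).map (fun i => (e.functor.map (e.inverse.map (f i))).f) := by
      refine (map_pi_comp _ _ _).symm.trans (Eq.trans ?_ (map_pi_comp _ _ _))
      exact congrArg (E.T n).map (funext fun i =>
        congrArg Monad.Algebra.Hom.f (e.counitInv.naturality (f i)))
    change (E.T n).map (fun i => (f i).f) ≫ (counitTensor E e X').hom ≫ _ =
      (_ ≫ _) ≫ (e.functor.map ((F.T n).map fun i => e.inverse.map (f i))).f
    rw [reassoc_of% h2, h1, Category.assoc]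
  unit X := by
    have h1 := D.unit (e.inverse.obj X)
    have h2 := E.u_naturality (e.counitInv.app X).f
    change E.u X.A ≫ (E.T 1).map (fun _ => (e.counitInv.app X).f) ≫ _ =
      (e.counitInv.app X).f ≫ (e.functor.map (F.u (e.inverse.obj X))).f
    rw [← reassoc_of% h2, h1]
  subst {k n N} X Y h := by
    have h1 := D.naturality fun i => e.unitInv.app ((F.T (n i)).obj fun j => e.inverse.obj (X i j))
    have h2 := D.subst _ _ (h.map e.inverse.obj)
    have h3 := σ_counitTensor E e X Y h
    have h4 : (counitTensor E e fun i => e.functor.obj ((F.T (n i)).obj fun j => e.inverse.obj (X i j))).hom ≫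
        (E.T k).map (fun i => (e.functor.map
          (e.unitInv.app ((F.T (n i)).obj fun j => e.inverse.obj (X i j)))).f) = 𝟙 _ := by
      refine (map_pi_comp _ _ _).symm.trans (Eq.trans ?_ (map_pi_id _ _))
      exact congrArg (E.T k).map (funext fun i =>
        congrArg Monad.Algebra.Hom.f (e.counitInv_functor_comp _))
    change (E.T k).map (fun i => (counitTensor E e (X i)).hom ≫ D.q fun j => e.inverse.obj (X i j)) ≫
      ((counitTensor E e fun i => e.functor.obj ((F.T (n i)).obj fun j => e.inverse.obj (X i j))).hom ≫
        D.q fun i => e.inverse.obj (e.functor.obj ((F.T (n i)).obj fun j => e.inverse.obj (X i j)))) ≫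
      (e.functor.map ((F.T k).map
    (fun i => e.unitInv.app ((F.T (n i)).obj fun j => e.inverse.obj (X i j))) ≫
      F.σ (fun i j => e.inverse.obj (X i j)) (fun a => e.inverse.obj (Y a)) (h.map e.inverse.obj))).f =
      E.σ (fun i j => (X i j).A) (fun a => (Y a).A) _ ≫ (counitTensor E e Y).hom ≫ _
    rw [reassoc_of% h3, ← h2, map_pi_comp, e.functor.map_comp]
    simp only [Category.assoc, Monad.Algebra.comp_f]
    rw [← reassoc_of% h1, reassoc_of% h4]
  act_out {n} X := by
    have h1 := D.act_out fun i => e.inverse.obj (X i)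
    have h2 := σ_counitTensor E e (fun _ : Fin 1 => X) X (IsConcat.single _)
    have h3 : (E.T 1).map (fun _ => (counitTensor E e X).hom ≫ D.q fun i => e.inverse.obj (X i)) ≫
        act (e.functor.obj ((F.T n).obj fun i => e.inverse.obj (X i))) =
      E.σ (fun _ : Fin 1 => fun i => (X i).A) (fun i => (X i).A) (IsConcat.single _) ≫
        (counitTensor E e X).hom ≫ D.q fun i => e.inverse.obj (X i) := by
      rw [reassoc_of% h2, ← h1, map_pi_comp, Category.assoc]
    exact h3
  act_in {n} X := by
    have h1 := D.act_in fun i => e.inverse.obj (X i)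
    have h2 := σ_counitTensor E e (fun i (_ : Fin 1) => X i) X (IsConcat.singles _)
    have h3 := map_a_counitTensor E e X
    have h4 : (E.T n).map (fun i => act (X i)) ≫ (counitTensor E e X).hom ≫
        D.q (fun i => e.inverse.obj (X i)) =
      E.σ (fun i (_ : Fin 1) => (X i).A) (fun i => (X i).A) (IsConcat.singles _) ≫
        (counitTensor E e X).hom ≫ D.q fun i => e.inverse.obj (X i) := by
      rw [reassoc_of% h2, reassoc_of% h3, h1]
      rfl
    exact h4
  desc {n} X B := by
    have h2 := σ_counitTensor_inv E e (fun _ : Fin 1 => X) X (IsConcat.single _)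
    have h3 := σ_counitTensor_inv E e (fun i (_ : Fin 1) => X i) X (IsConcat.singles _)
    have h4 := map_a_counitTensor_inv E e X
    have h5 : ∀ (g : (E.T n).obj (fun i => (X i).A) ⟶ B.A),
        E.σ (fun _ : Fin 1 => fun i => (X i).A) (fun i => (X i).A) (IsConcat.single _) ≫ g =
          (E.T 1).map (fun _ => g) ≫ act B →
        (E.T n).map (fun i => act (X i)) ≫ g = E.σ (fun i (_ : Fin 1) => (X i).A)
          (fun i => (X i).A) (IsConcat.singles _) ≫ g →
        ∃ g' : e.functor.obj ((F.T n).obj fun i => e.inverse.obj (X i)) ⟶ B,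
          ((counitTensor E e X).hom ≫ D.q fun i => e.inverse.obj (X i)) ≫ g'.f = g := by
      intro g hg1 hg2
      obtain ⟨g', hg'⟩ := D.desc (fun i => e.inverse.obj (X i)) B ((counitTensor E e X).inv ≫ g)
        (by rw [reassoc_of% h2, hg1, map_pi_comp, Category.assoc])
        (by
          rw [reassoc_of% h3, reassoc_of% h4, hg2]
          rfl)
      exact ⟨g', by rw [Category.assoc, hg', Iso.hom_inv_id_assoc]⟩
    exact h5
  epi X := by
    have := D.epi fun i => e.inverse.obj (X i)
    have h : Epi ((counitTensor E e X).hom ≫ D.q fun i => e.inverse.obj (X i)) := epi_comp _ _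
    exact h
  epi_map {k n} X := by
    have h1 := D.epi_map fun i j => e.inverse.obj (X i j)
    have h2 : IsIso (show (fun i => (E.T (n i)).obj fun j => (X i j).A) ⟶
        fun i => (E.T (n i)).obj fun j => (e.functor.obj (e.inverse.obj (X i j))).A from
      fun i => (counitTensor E e (X i)).hom) := (isIso_pi_iff _).2 fun i => inferInstance
    have h3 : Epi ((E.T k).map fun i => (counitTensor E e (X i)).hom ≫
        D.q fun j => e.inverse.obj (X i j)) := by
      rw [map_pi_comp]
      have : IsIso ((E.T k).map fun i => (counitTensor E e (X i)).hom) :=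
        Functor.map_isIso (E.T k) _
      exact epi_comp _ _
    exact h3

end Transport

end LiftData

theorem CategoryTheory.Functor.eq_of_comp_faithful {A B D : Type*} [Category* A] [Category* B]
    [Category* D] {F G : A ⥤ B} (U : B ⥤ D) [U.Faithful] (hobj : ∀ X, F.obj X = G.obj X)
    (h : F ⋙ U = G ⋙ U) : F = G :=
  Functor.ext hobj fun X Y f => U.map_injective (by
    rw [U.map_comp, U.map_comp, eqToHom_map, eqToHom_map]
    exact Functor.congr_hom h f)

theorem CategoryTheory.Monad.Algebra.ext_of_a {V : Type u} [Category.{v} V] {T : Monad V}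
    (B : T.Algebra) {a : (T : V ⥤ V).obj B.A ⟶ B.A} (h1) (h2) (h : a = B.a) :
    (⟨B.A, a, h1, h2⟩ : T.Algebra) = B := by
  subst h
  rfl

theorem CategoryTheory.Monad.Algebra.eqToHom_f {V : Type u} [Category.{v} V] {T : Monad V}
    {X Y : T.Algebra} (h : X = Y) (hA : X.A = Y.A) :
    Monad.Algebra.Hom.f (eqToHom h) = eqToHom hA := by
  subst h
  rfl

theorem EnrichedGraph.hom_eq_eqToHom_comp {V : Type u} [Category.{v} V] {O P : Type w}
    {hom hom' : O → O → V} {kom kom' : P → P → V} (h : hom = hom') (k : kom = kom') (o : O → P)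
    (m : ∀ a b, hom a b ⟶ kom (o a) (o b)) (m' : ∀ a b, hom' a b ⟶ kom' (o a) (o b))
    (hm : ∀ a b, m a b ≫ eqToHom (congrFun (congrFun k _) _) =
      eqToHom (congrFun (congrFun h _) _) ≫ m' a b) :
    (⟨o, m⟩ : (⟨O, hom⟩ : EnrichedGraph.{w} V) ⟶ ⟨P, kom⟩) =
      eqToHom (congrArg (EnrichedGraph.mk O) h) ≫
        (⟨o, m'⟩ : (⟨O, hom'⟩ : EnrichedGraph.{w} V) ⟶ ⟨P, kom'⟩) ≫
          eqToHom (congrArg (EnrichedGraph.mk P) k).symm := by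
  subst h k
  obtain rfl : m = m' := by
    funext a b
    simpa using hm a b
  simp

theorem EnrichedCat.Str.ext_comp {V : Type u} [Category.{v} V] {M : Multitensor V}
    {G : EnrichedGraph.{w} V} {S S' : EnrichedCat.Str M G}
    (h : ∀ {n : ℕ} {a b : G.Ob} {s t : Fin n → G.Ob} (p : IsPath a b s t), S.comp p = S'.comp p) :
    S = S' := by
  obtain ⟨c, _, _⟩ := S
  obtain ⟨c', _, _⟩ := S'
  obtain rfl : @c = @c' := by
    funext n a b s t p
    exact h p
  rfl

theorem EnrichedCat.Str.toCat_eq {V : Type u} [Category.{v} V] {M : Multitensor V} {O : Type w}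
    {hom hom' : O → O → V} (h : hom = hom') (S : EnrichedCat.Str M ⟨O, hom⟩)
    (S' : EnrichedCat.Str M ⟨O, hom'⟩)
    (hS : ∀ {n : ℕ} {a b : O} {s t : Fin n → O} (p : IsPath a b s t),
      S.comp p ≫ eqToHom (congrFun (congrFun h a) b) =
        (M.T n).map (fun i => eqToHom (congrFun (congrFun h (s i)) (t i))) ≫ S'.comp p) :
    S.toCat = S'.toCat := by
  subst h
  refine congrArg Str.toCat (ext_comp fun p => ?_)
  have := hS p
  simp only [eqToHom_refl, Category.comp_id] at this
  refine this.trans ?_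
  rw [M.map_pi_id]
  exact Category.id_comp _

instance EnrichedCat.forget_faithful {V : Type u} [Category.{v} V] (M : Multitensor V) :
    (EnrichedCat.forget.{w} M).Faithful where
  map_injective h := EnrichedCat.Hom.ext h

namespace LiftData

open Multitensor

variable {V : Type u} [Category.{v} V] {E : Multitensor V} {E' : Multitensor E.unary.Algebra}
  (D : LiftData E E' (𝟭 _))

/-- The universal multilinear map. -/
def mul {n : ℕ} (X : Fin n → E.unary.Algebra) :
    (E.T n).obj (fun i => (X i).A) ⟶ ((E'.T n).obj X).A := D.q X

instance mul_epi {n : ℕ} (X : Fin n → E.unary.Algebra) : Epi (D.mul X) := D.epi X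

instance map_mul_epi {k : ℕ} {n : Fin k → ℕ} (X : ∀ i, Fin (n i) → E.unary.Algebra) :
    Epi ((E.T k).map fun i => D.mul (X i)) := D.epi_map X

theorem mul_naturality {n : ℕ} {X X' : Fin n → E.unary.Algebra} (f : ∀ i, X i ⟶ X' i) :
    (E.T n).map (fun i => (f i).f) ≫ D.mul X' = D.mul X ≫ ((E'.T n).map f).f := D.naturality f

theorem u_mul (X : E.unary.Algebra) :
    E.u X.A ≫ D.mul (fun _ : Fin 1 => X) = (E'.u X).f := D.unit X

theorem map_mul_mul {k : ℕ} {n : Fin k → ℕ} {N : ℕ} (X : ∀ i, Fin (n i) → E.unary.Algebra)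
    (Y : Fin N → E.unary.Algebra) (h : IsConcat X Y) :
    (E.T k).map (fun i => D.mul (X i)) ≫ D.mul (fun i => (E'.T (n i)).obj (X i)) ≫
      (E'.σ X Y h).f =
    E.σ (fun i j => (X i j).A) (fun a => (Y a).A) (h.map fun Z => Z.A) ≫ D.mul Y :=
  D.subst X Y h

theorem map_mul_act {n : ℕ} (X : Fin n → E.unary.Algebra) :
    (E.T 1).map (fun _ => D.mul X) ≫ act ((E'.T n).obj X) =
      E.σ (fun _ : Fin 1 => fun i => (X i).A) (fun i => (X i).A)
        (IsConcat.single _) ≫ D.mul X := D.act_out X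

theorem mul_desc {n : ℕ} (X : Fin n → E.unary.Algebra) (B : E.unary.Algebra)
    (g : (E.T n).obj (fun i => (X i).A) ⟶ B.A)
    (h1 : E.σ (fun _ : Fin 1 => fun i => (X i).A) (fun i => (X i).A)
        (IsConcat.single _) ≫ g = (E.T 1).map (fun _ => g) ≫ act B)
    (h2 : (E.T n).map (fun i => act (X i)) ≫ g =
      E.σ (fun i (_ : Fin 1) => (X i).A) (fun i => (X i).A) (IsConcat.singles _) ≫ g) :
    ∃ g' : (E'.T n).obj X ⟶ B, D.mul X ≫ g'.f = g := D.desc X B g h1 h2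

/-- The unary universal multilinear map is determined by the action. -/
theorem mul_single (X : E.unary.Algebra) :
    D.mul (fun _ : Fin 1 => X) = act X ≫ (E'.u X).f := by
  have h1 := D.map_mul_act fun _ : Fin 1 => X
  have h2 := E.map_u_σ fun _ : Fin 1 => X.A
  have h3 := act_naturality (E'.u X)
  rw [← h3, ← D.u_mul, map_pi_comp, Category.assoc, h1]
  exact ((Category.assoc _ _ _).symm.trans ((congrArg (· ≫ _) h2).trans (Category.id_comp _))).symm

/-- The `E`-category underlying an `E'`-category. -/
def underlying (X : EnrichedCat.{w} E') : EnrichedCat.{w} E where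
  graph := ⟨X.graph.Ob, fun a b => (X.graph.hom a b).A⟩
  comp {n a b s t} h := D.mul (fun i => X.graph.hom (s i) (t i)) ≫ (X.comp h).f
  unit a b := by
    refine (Category.assoc _ _ _).symm.trans ((congrArg (· ≫ _) (D.u_mul _)).trans ?_)
    exact congrArg Monad.Algebra.Hom.f (X.unit a b)
  assoc {k n N a b s t} h {s' t'} h' {S T} hS H hc := by
    have hc' := hS.map fun p : X.graph.Ob × X.graph.Ob => X.graph.hom p.1 p.2
    have h1 := (reassoc_of% D.map_mul_mul) _ _ hc' (X.comp H).f
    have h2 := congrArg Monad.Algebra.Hom.f (X.assoc h h' hS H hc')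
    have h3 := D.mul_naturality fun i => X.comp (h' i)
    simp only [Monad.Algebra.comp_f] at h2
    rw [h2, ← reassoc_of% h3] at h1
    refine h1.symm.trans ?_
    exact (Category.assoc _ _ _).symm.trans (congrArg (· ≫ _) (map_pi_comp _ _ _).symm)

/-- The functor sending an `E'`-category to its underlying `E`-category. -/
def underlyingFunctor : EnrichedCat.{w} E' ⥤ EnrichedCat.{w} E where
  obj := D.underlying
  map {X Y} F :=
    { toGraph := ⟨F.toGraph.obj, fun a b => (F.toGraph.map a b).f⟩
      comm := fun {n a b s t} h => by
        have h1 := congrArg Monad.Algebra.Hom.f (F.comm h)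
        have h2 := D.mul_naturality fun i => F.toGraph.map (s i) (t i)
        simp only [Monad.Algebra.comp_f] at h1
        refine (Category.assoc _ _ _).trans ((congrArg (_ ≫ ·) h1).trans ?_)
        exact (Category.assoc _ _ _).symm.trans ((congrArg (· ≫ _) h2.symm).trans
          (Category.assoc _ _ _)) }

theorem exists_lift (X : EnrichedCat.{w} E) {n : ℕ} {a b : X.graph.Ob} {s t : Fin n → X.graph.Ob}
    (h : IsPath a b s t) :
    ∃ g : (E'.T n).obj (fun i => X.homAlgebra (s i) (t i)) ⟶ X.homAlgebra a b,
      D.mul (fun i => X.homAlgebra (s i) (t i)) ≫ g.f = X.comp h := by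
  refine D.mul_desc (fun i => X.homAlgebra (s i) (t i)) (X.homAlgebra a b) (X.comp h) ?_ ?_
  · exact X.assoc (IsPath.single a b) (fun _ => h) (IsConcat.single _) h (IsConcat.single _)
  · exact (X.assoc h (fun i => IsPath.single (s i) (t i))
      (IsConcat.singles fun i => (s i, t i)) h (IsConcat.singles _)).symm

/-- The composition of the `E'`-category of an `E`-category. -/
noncomputable def liftComp (X : EnrichedCat.{w} E) {n : ℕ} {a b : X.graph.Ob}
    {s t : Fin n → X.graph.Ob} (h : IsPath a b s t) :
    (E'.T n).obj (fun i => X.homAlgebra (s i) (t i)) ⟶ X.homAlgebra a b :=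
  (D.exists_lift X h).choose

theorem mul_liftComp (X : EnrichedCat.{w} E) {n : ℕ} {a b : X.graph.Ob}
    {s t : Fin n → X.graph.Ob} (h : IsPath a b s t) :
    D.mul (fun i => X.homAlgebra (s i) (t i)) ≫ (D.liftComp X h).f = X.comp h :=
  (D.exists_lift X h).choose_spec

/-- The `E'`-category of an `E`-category. -/
noncomputable def lift (X : EnrichedCat.{w} E) : EnrichedCat.{w} E' where
  graph := ⟨X.graph.Ob, X.homAlgebra⟩
  comp h := D.liftComp X h
  unit a b := by
    refine Monad.Algebra.Hom.ext ?_
    have h1 := D.mul_liftComp X (IsPath.single a b)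
    have h2 := D.u_mul (X.homAlgebra a b)
    refine (congrArg (· ≫ (D.liftComp X (IsPath.single a b)).f) h2.symm).trans ?_
    exact (Category.assoc _ _ _).trans ((congrArg (_ ≫ ·) h1).trans (X.unit a b))
  assoc {k n N a b s t} h {s' t'} h' {S T} hS H hc := by
    refine Monad.Algebra.Hom.ext ?_
    have h1 := (reassoc_of% D.map_mul_mul) _ _ hc (D.liftComp X H).f
    have h2 := (reassoc_of% D.mul_naturality) (fun i => D.liftComp X (h' i)) (D.liftComp X h).f
    have h3 := D.mul_liftComp X h
    have h4 := D.mul_liftComp X H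
    have h5 := X.assoc h h' hS H (hc.map fun Z => Z.A)
    rw [← cancel_epi (D.mul fun i => (E'.T (n i)).obj fun j => X.homAlgebra (s' i j) (t' i j)),
      ← cancel_epi ((E.T k).map fun i => D.mul fun j => X.homAlgebra (s' i j) (t' i j))]
    refine h1.trans (Eq.trans ?_ (congrArg (_ ≫ ·) h2))
    refine (congrArg (_ ≫ ·) h4).trans (h5.trans ?_)
    refine Eq.trans ?_ (congrArg (_ ≫ ·) (congrArg (_ ≫ ·) h3.symm))
    refine Eq.trans ?_ (Category.assoc _ _ _)
    refine congrArg (· ≫ _) ?_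
    exact (congrArg (E.T k).map (funext fun i => (D.mul_liftComp X (h' i)).symm)).trans
      (map_pi_comp _ _ _)

/-- The functor sending an `E`-category to its `E'`-category. -/
noncomputable def liftFunctor : EnrichedCat.{w} E ⥤ EnrichedCat.{w} E' where
  obj := D.lift
  map {X Y} F :=
    { toGraph := (EnrichedCat.forgetToAlgebra E).map F
      comm := fun {n a b s t} h => by
        refine Monad.Algebra.Hom.ext ?_
        have h1 := (reassoc_of% D.mul_naturality) (fun i =>
          EnrichedGraph.Hom.map ((EnrichedCat.forgetToAlgebra E).map F) (s i) (t i))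
          (D.liftComp Y (h.map F.toGraph.obj)).f
        have h2 := (reassoc_of% D.mul_liftComp) X h (F.toGraph.map a b)
        have h3 := D.mul_liftComp Y (h.map F.toGraph.obj)
        refine (cancel_epi (D.mul fun i => X.homAlgebra (s i) (t i))).1 ?_
        refine h2.trans (Eq.trans ?_ h1)
        exact (F.comm h).trans (congrArg (_ ≫ ·) h3.symm) }

theorem homAlgebra_underlying (X : EnrichedCat.{w} E') (a b : X.graph.Ob) :
    (D.underlying X).homAlgebra a b = X.graph.hom a b := by
  refine Monad.Algebra.ext_of_a (X.graph.hom a b) _ _ ?_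
  have h1 := congrArg Monad.Algebra.Hom.f (X.unit a b)
  refine (congrArg (· ≫ _) (D.mul_single (X.graph.hom a b))).trans ((Category.assoc _ _ _).trans ?_)
  exact (congrArg (_ ≫ ·) h1).trans (Category.comp_id _)

theorem homAlgebra_underlying_eq (X : EnrichedCat.{w} E') :
    (D.underlying X).homAlgebra = X.graph.hom :=
  funext fun a => funext fun b => D.homAlgebra_underlying X a b

theorem underlyingFunctor_comp_forgetToAlgebra :
    D.underlyingFunctor ⋙ EnrichedCat.forgetToAlgebra.{w} E = EnrichedCat.forget.{w} E' := by
  have hobj (X : EnrichedCat.{w} E') :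
      (D.underlyingFunctor ⋙ EnrichedCat.forgetToAlgebra.{w} E).obj X =
        (EnrichedCat.forget.{w} E').obj X :=
    congrArg (EnrichedGraph.mk X.graph.Ob) (D.homAlgebra_underlying_eq X)
  refine CategoryTheory.Functor.ext hobj fun X Y F => ?_
  refine EnrichedGraph.hom_eq_eqToHom_comp (D.homAlgebra_underlying_eq X)
    (D.homAlgebra_underlying_eq Y) F.toGraph.obj _ F.toGraph.map fun a b => ?_
  refine Monad.Algebra.Hom.ext ?_
  have h1 := Monad.Algebra.eqToHom_f
    (D.homAlgebra_underlying Y (F.toGraph.obj a) (F.toGraph.obj b)) rfl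
  have h2 := Monad.Algebra.eqToHom_f (D.homAlgebra_underlying X a b) rfl
  refine (congrArg ((F.toGraph.map a b).f ≫ ·) h1).trans ((Category.comp_id _).trans ?_)
  exact ((congrArg (· ≫ (F.toGraph.map a b).f) h2).trans (Category.id_comp _)).symm

/-- Universal multilinear maps identify `E'`-categories with `E`-categories. -/
theorem isoOver (D : LiftData E E' (𝟭 _)) :
    IsoOver (EnrichedCat.forget.{w} E') (EnrichedCat.forgetToAlgebra.{w} E) := by
  refine ⟨D.underlyingFunctor, D.liftFunctor, ?_, ?_, D.underlyingFunctor_comp_forgetToAlgebra⟩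
  · refine Functor.eq_of_comp_faithful (EnrichedCat.forget E') (fun X => ?_)
      D.underlyingFunctor_comp_forgetToAlgebra
    refine EnrichedCat.Str.toCat_eq (D.homAlgebra_underlying_eq X)
      (D.lift (D.underlying X)).str X.str fun {n a b s t} p => ?_
    refine Monad.Algebra.Hom.ext ?_
    have h1 := D.mul_liftComp (D.underlying X) p
    have h2 := (reassoc_of% D.mul_naturality) (fun i => eqToHom (D.homAlgebra_underlying X (s i) (t i)))
      (X.comp p).f
    refine (cancel_epi (D.mul fun i => (D.underlying X).homAlgebra (s i) (t i))).1 ?_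
    refine Eq.trans ?_ h2
    refine (congrArg (D.mul (fun i => (D.underlying X).homAlgebra (s i) (t i)) ≫ ·)
      ((congrArg ((D.liftComp (D.underlying X) p).f ≫ ·)
        (Monad.Algebra.eqToHom_f (D.homAlgebra_underlying X a b) rfl)).trans
          (Category.comp_id _))).trans (h1.trans ?_)
    have h3 : (fun i => Monad.Algebra.Hom.f (eqToHom (D.homAlgebra_underlying X (s i) (t i)))) =
        fun i => 𝟙 (X.graph.hom (s i) (t i)).A :=
      funext fun i => Monad.Algebra.eqToHom_f (D.homAlgebra_underlying X (s i) (t i)) rfl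
    refine Eq.symm ((congrArg (fun g => (E.T n).map g ≫
      D.mul (fun i => X.graph.hom (s i) (t i)) ≫ (X.comp p).f) h3).trans ?_)
    exact (congrArg (· ≫ _) (map_pi_id _ _)).trans (Category.id_comp _)
  · refine Functor.eq_of_comp_faithful (EnrichedCat.forget E) (fun X => ?_) rfl
    exact congrArg EnrichedCat.Str.toCat (EnrichedCat.Str.ext_comp
      (S := (D.underlying (D.lift X)).str) (S' := X.str) fun p => D.mul_liftComp X p)

end LiftData

theorem CategoryTheory.epi_pi_of_surjective {ι : Type u} {X Y : ι → Type u} (f : X ⟶ Y)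
    (hf : ∀ i, Function.Surjective (f i)) : Epi f where
  left_cancellation g h e := by
    funext i
    have : Epi (f i) := (epi_iff_surjective _).2 (hf i)
    exact (cancel_epi (f i)).1 (congrFun e i)

namespace Multicategory

variable {C : Multicategory.{u}}

theorem Pt.subst_single_unary {n : ℕ} {X : Fin n → C.Ob → Type u} {a c : C.Ob}
    (f : C.Hom (fun _ : Fin 1 => a) c) (p : C.Pt X a)
    (h : IsConcat (fun _ : Fin 1 => X) X) :
    Pt.subst (k := 1) (n := fun _ => n) h f (fun _ => p) = p.post f :=
  Pt.subst_eq h f _ p.pair (IsConcat.single _)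

theorem Pt.subst_singles_unary {n : ℕ} {X : Fin n → C.Ob → Type u} {A B : Fin n → C.Ob} {c : C.Ob}
    (f : C.Hom B c) (g : ∀ i, C.Hom (fun _ : Fin 1 => A i) (B i)) (x : ∀ i, X i (A i))
    (h : IsConcat (fun i (_ : Fin 1) => X i) X) :
    Pt.subst (k := n) (n := fun _ => 1) h f (fun i => ⟨fun _ => A i, g i, fun _ => x i⟩) =
      ⟨A, Multicategory.pre f g, x⟩ :=
  Pt.subst_eq h f _ (fun i => ⟨A i, x i⟩) (IsConcat.singles _)

variable (C)

/-- The projections of the coproducts onto the coends. -/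
def coendProj {n : ℕ} (Z : Fin n → C.Lin ⥤ Type u) :
    (C.multitensor.T n).obj (fun i => (C.comparison.obj (Z i)).A) ⟶
      (C.comparison.obj ((C.convolution.T n).obj Z)).A :=
  fun c => TypeCat.ofHom (Quot.mk (C.Rel Z c))

theorem coendProj_desc {n : ℕ} (Z : Fin n → C.Lin ⥤ Type u) (B : C.multitensor.unary.Algebra)
    (g : (C.multitensor.T n).obj (fun i => (C.comparison.obj (Z i)).A) ⟶ B.A)
    (h1 : C.multitensor.σ (fun _ : Fin 1 => fun i => (C.comparison.obj (Z i)).A)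
        (fun i => (C.comparison.obj (Z i)).A) (IsConcat.single _) ≫ g =
      (C.multitensor.T 1).map (fun _ => g) ≫ Multitensor.act B)
    (h2 : (C.multitensor.T n).map (fun i => Multitensor.act (C.comparison.obj (Z i))) ≫ g =
      C.multitensor.σ (fun i (_ : Fin 1) => (C.comparison.obj (Z i)).A)
        (fun i => (C.comparison.obj (Z i)).A) (IsConcat.singles _) ≫ g) :
    ∃ g' : C.comparison.obj ((C.convolution.T n).obj Z) ⟶ B, C.coendProj Z ≫ g'.f = g := by
  have hg (c : C.Ob) (p q : C.Pt (fun i => (Z i).obj) c) (hpq : C.Rel Z c p q) : g c p = g c q := by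
    obtain ⟨A, op, x⟩ := p
    obtain ⟨A', op', x'⟩ := q
    obtain ⟨f, hf1, hf2⟩ := hpq
    have h := congrArg (fun k => k ⟨A', op', fun i => ⟨fun _ => A i, f i, fun _ => x i⟩⟩)
      (congrFun h2 c)
    have e : g c ⟨A', op', fun i => (Z i).map (f i) (x i)⟩ = g c ⟨A, Multicategory.pre op' f, x⟩ :=
      h.trans (congrArg (g c) (Pt.subst_singles_unary op' f x _))
    exact (congrArg (fun o => g c ⟨A, o, x⟩) hf1).trans
      (e.symm.trans (congrArg (fun y => g c ⟨A', op', y⟩) (funext hf2)))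
  refine ⟨⟨fun c => TypeCat.ofHom (Quot.lift (g c) (hg c)), ?_⟩, rfl⟩
  funext c
  ext y
  obtain ⟨a, f, z, rfl⟩ := Pt.exists_unary y
  obtain ⟨p, rfl⟩ := Quot.exists_rep z
  have h := congrArg (fun k => k ⟨fun _ => a, f, fun _ => p⟩) (congrFun h1 c)
  exact h.symm.trans (congrArg (g c) (Pt.subst_single_unary f p _))

/-- The projections of the coproducts onto the coends are universal multilinear maps. -/
def liftData : LiftData C.multitensor C.convolution C.comparison where
  q Z := C.coendProj Z
  naturality f := rfl
  unit Z := rfl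
  subst X Y h := by
    funext c
    ext p
    exact convSubst_mk h p.op p.val
  act_out Z := by
    funext c
    ext y
    obtain ⟨a, f, p, rfl⟩ := Pt.exists_unary y
    exact congrArg (Quot.mk (C.Rel Z c)) (Pt.subst_single_unary f p _).symm
  act_in Z := by
    funext c
    ext ⟨B, op, v⟩
    choose a f x hx using fun i => Pt.exists_unary (v i)
    obtain rfl : v = _ := funext hx
    refine Eq.trans ?_ (congrArg (Quot.mk (C.Rel Z c)) (Pt.subst_singles_unary op f x _)).symm
    exact (Quot.sound ⟨f, rfl, fun _ => rfl⟩).symm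
  desc Z B g h1 h2 := C.coendProj_desc Z B g h1 h2
  epi Z := epi_pi_of_surjective _ fun c => Quot.exists_rep
  epi_map X := epi_pi_of_surjective _ fun c => by
    rintro ⟨B, op, v⟩
    choose r hr using fun i => Quot.exists_rep (v i)
    exact ⟨⟨B, op, r⟩, congrArg (Pt.mk B op) (funext hr)⟩

end Multicategory

/-- Composition of isomorphisms of multitensors. -/
def MultitensorIso.trans {W : Type u'} [Category.{v'} W] {V : Type u} [Category.{v} V]
    {K : W ⥤ V} {F : Multitensor W} {E E' : Multitensor V} (α : MultitensorIso K F E)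
    (β : MultitensorIso (𝟭 V) E E') : MultitensorIso K F E' where
  iso X := α.iso X ≪≫ β.iso fun i => K.obj (X i)
  naturality f := by
    have h1 := α.naturality f
    have h2 := β.naturality fun i => K.map (f i)
    refine (Category.assoc _ _ _).symm.trans ((congrArg (· ≫ _) h1).trans ?_)
    exact (Category.assoc _ _ _).trans ((congrArg (_ ≫ ·) h2).trans (Category.assoc _ _ _).symm)
  unit X := by
    have h1 := α.unit X
    have h2 := β.unit (K.obj X)
    exact (Category.assoc _ _ _).symm.trans ((congrArg (· ≫ _) h1).trans h2)
  subst {k n N} X Y h := by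
    have h1 := α.subst X Y h
    have h2 := β.subst (fun i j => K.obj (X i j)) (fun a => K.obj (Y a)) (h.map K.obj)
    have h3 := β.naturality fun i => (α.iso (X i)).hom
    have h4 : (E'.T k).map (fun i => (α.iso (X i) ≪≫ β.iso fun j => K.obj (X i j)).hom) =
        (E'.T k).map (fun i => (α.iso (X i)).hom) ≫
          (E'.T k).map (fun i => (β.iso fun j => K.obj (X i j)).hom) :=
      Multitensor.map_pi_comp _ _ _
    refine (Category.assoc _ _ _).symm.trans ((congrArg (· ≫ _) h1).trans ?_)
    refine Eq.trans ?_ (congrArg (fun m => _ ≫ m ≫ _) h4).symm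
    refine (Category.assoc _ _ _).trans ((congrArg (_ ≫ ·) (Category.assoc _ _ _)).trans ?_)
    refine (congrArg (fun m => _ ≫ _ ≫ m) h2).trans ?_
    refine Eq.trans (congrArg (_ ≫ ·) ?_) (Category.assoc _ _ _).symm
    refine (Category.assoc _ _ _).symm.trans ((congrArg (· ≫ _) h3).trans ?_)
    refine (Category.assoc _ _ _).trans (congrArg (_ ≫ ·) ?_)
    exact (Category.assoc _ _ _).symm

theorem mainTheorem2 (C : Multicategory.{u}) :
    C.multitensor.IsCocomplete ∧
    C.convolution.IsCocomplete ∧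
    C.convolution.IsFunctorOperad ∧
    C.comparison.IsEquivalence ∧
    (∃ E' : Multitensor C.multitensor.unary.Algebra, IsLift C.multitensor E') ∧
    (∀ E' : Multitensor C.multitensor.unary.Algebra, IsLift C.multitensor E' →
      Nonempty (MultitensorIso C.comparison C.convolution E')) ∧
    (C.IsPromonoidal → C.convolution.IsMonoidal) := by
  let e : (C.Lin ⥤ Type u) ≌ C.multitensor.unary.Algebra := C.comparison.asEquivalence
  have hlift : IsLift C.multitensor (C.convolution.transport e) :=
    ⟨(Multicategory.convolution_isFunctorOperad C).transport e,
      Multitensor.IsCocomplete.isDistributive_transport e (Multicategory.convolution_isCocomplete C),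
      (LiftData.transport (e := e) C.liftData).isoOver⟩
  refine ⟨Multicategory.multitensor_isCocomplete C, Multicategory.convolution_isCocomplete C,
    Multicategory.convolution_isFunctorOperad C, inferInstance, ⟨_, hlift⟩, fun E' hE' => ?_,
    fun hC => hC.convolution_isMonoidal⟩
  have : Limits.HasInitial C.multitensor.unary.Algebra :=
    Adjunction.hasColimitsOfShape_of_equivalence e.inverse
  obtain ⟨α⟩ := Multitensor.nonempty_iso_of_isoOver (Multitensor.IsDistributive.preservesInitial hE'.2.1)
    (Multitensor.IsDistributive.preservesInitial hlift.2.1) (hE'.2.2.trans hlift.2.2.symm)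
  exact ⟨(Multitensor.transportIso C.convolution e).trans α⟩
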